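/- Let $T$ be a tangle diagram in a disk (a planar diagram with finitely many crossings, closed loops without crossings allowed, considered up to planar isotopy rel boundary), with $g\ge 0$ boundary points. The Kauffman skein module of the disk with these boundary points is the quotient of the free $\mathbb{Z}[A,A^{-1}]$-module on the isotopy classes of such diagrams by the submodule generated by the local relations \[ T\sqcup\bigcirc = (-A^2-A^{-2})\,T, \qquad T_{\times} = A\,T_{A} + A^{-1}\,T_{B}, \] where $\bigcirc$ is a circle bounding an empty disk, and $T_A$ (resp. $T_B$) is obtained from $T_\times$ by smoothing a crossing so that the two regions swept by the over strand when it turns counterclockwise (resp. clockwise) become connected. A base tangle is a diagram without crossings and without closed loops. Then $T$ has a unique expansion $T=\sum_B P_B(A)\,B$ in the skein module as a finite $\mathbb{Z}[A,A^{-1}]$-linear combination of base tangles with the same boundary points, and for each base tangle $B$: (1) all exponents of $A$ that occur with nonzero coefficient in $P_B$ are congruent to each other modulo $4$; (2) for every checkerboarding $\tilde T$ of $T$ (a colouring of the faces dark or light, with different colours on the two sides of each edge), if $\tilde B$ is the checkerboarding of $B$ with the same colours along the boundary circle, then every exponent of $A$ that occurs in $P_B$ is congruent to \[ w_{\tilde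 T}+2e_{\tilde T}-2e_{\tilde B} \pmod 4 . \] Here $e$ is the Euler characteristic of the dark surface, formed by the dark faces together with one half-twisted band at each crossing connecting the two dark corners there, and $w$ is the number of positive minus the number of negative crossings, a crossing being positive if the dark surface rotates clockwise as one passes through it, i.e. if the dark corners are the regions swept by the over strand when it turns counterclockwise, and negative otherwise. -/

import Mathlib

/-!
Tangle diagrams in a disk, up to planar isotopy, through their combinatorial structure, and the
Kauffman skein module.

Contracting the outside of the disk to one point turns a diagram into a graph embedded in the
sphere.  Such a graph is recorded, up to an orientation-preserving homeomorphism that fixes the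
boundary circle (equivalently, up to isotopy of the disk rel boundary), by: its vertices with the
cyclic order of the half-edges (darts) around each of them, the pairing of darts into edges, and
the set of faces together with the face in which each corner lies.  The faces have to be recorded
because the graph may be disconnected.
-/

/-- The darts (half-edges) of a diagram with set `X` of crossings, set `V` of bivalent vertices
and `g` boundary points.  Around each vertex the darts are numbered counterclockwise; at a crossing
the darts `0`, `2` form the under strand and `1`, `3` the over strand.  The boundary points are
numbered counterclockwise along the boundary circle, starting from a base point. -/
inductive Dart (X V : Type) (g : ℕ) : Type
  | cross (x : X) (i : ZMod 4)
  | biv (v : V) (i : ZMod 2)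
  | bdry (i : Fin g)

/-- The corners at the vertices.  `cross x i` is the corner at `x` swept when turning
counterclockwise from the dart `i` to the dart `i + 1`, and similarly for `biv v i`.  `arc j` is the
piece of the boundary circle between the boundary points `j - 1` and `j`; the base point cuts
one arc of the circle into the two pieces `arc 0` and `arc g`. -/
inductive Corner (X V : Type) (g : ℕ) : Type
  | cross (x : X) (i : ZMod 4)
  | biv (v : V) (i : ZMod 2)
  | arc (j : Fin (g + 1))

/-- The corner on the left when leaving the vertex along the dart. -/
def Dart.left {X V : Type} {g : ℕ} : Dart X V g → Corner X V g
  | .cross x i => .cross x i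
  | .biv v i => .biv v i
  | .bdry i => .arc i.castSucc

/-- The corner on the right when leaving the vertex along the dart. -/
def Dart.right {X V : Type} {g : ℕ} : Dart X V g → Corner X V g
  | .cross x i => .cross x (i - 1)
  | .biv v i => .biv v (i - 1)
  | .bdry i => .arc i.succ

/-- The vertex of a corner; `none` is the contracted outside of the disk. -/
def Corner.vertex {X V : Type} {g : ℕ} : Corner X V g → Option (X ⊕ V)
  | .cross x _ => some (.inl x)
  | .biv v _ => some (.inr v)
  | .arc _ => none

/-- Two corners are consecutive if one passes from one to the other along a side of an edge, or
across the base point of the boundary circle. -/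
inductive Corner.Consecutive {X V : Type} {g : ℕ} (edge : Dart X V g → Dart X V g) :
    Corner X V g → Corner X V g → Prop
  | side (d : Dart X V g) : Corner.Consecutive edge (edge d).left d.right
  | base : Corner.Consecutive edge (.arc 0) (.arc (Fin.last g))

/-- The boundary curves of the faces: the closed walks along the sides of the graph. -/
def BoundaryCurve {X V : Type} {g : ℕ} (edge : Dart X V g → Dart X V g) : Type :=
  Quot (Corner.Consecutive edge)

/-- A tangle diagram in the disk with `g` boundary points.  Bivalent vertices are allowed on every
edge (see `IsSubdivision`); every closed loop without crossings carries at least one.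

Each face is a sphere with holes, one for each of its boundary curves, hence of Euler
characteristic `2 - (number of boundary curves)`.  The conditions `connected` and `euler` say that
gluing the faces to the graph (with the contracted outside of the disk as one further vertex)
gives a connected closed surface of Euler characteristic `2`, that is, a sphere. -/
structure TangleDiagram (g : ℕ) : Type 1 where
  Crossing : Type
  Bivalent : Type
  Face : Type
  [fintypeCrossing : Fintype Crossing]
  [fintypeBivalent : Fintype Bivalent]
  [fintypeFace : Fintype Face]
  /-- the other half of the edge -/
  edge : Dart Crossing Bivalent g → Dart Crossing Bivalent g
  edge_edge : ∀ d, edge (edge d) = d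
  edge_ne : ∀ d, edge d ≠ d
  /-- the face in which a corner lies -/
  face : Corner Crossing Bivalent g → Face
  face_consecutive : ∀ c c', Corner.Consecutive edge c c' → face c = face c'
  face_surjective : Function.Surjective face
  connected : ∀ c c' : Corner Crossing Bivalent g,
    Relation.EqvGen (fun a b => a.vertex = b.vertex ∨ face a = face b) c c'
  euler :
    ((Fintype.card Crossing + Fintype.card Bivalent + 1 : ℕ) : ℤ)
      - ((Nat.card (Dart Crossing Bivalent g) / 2 : ℕ) : ℤ)
      + ∑ F : Face, (2 - (Nat.card {c : BoundaryCurve edge //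
          Quot.lift face face_consecutive c = F} : ℤ)) = 2

namespace TangleDiagram

attribute [instance] fintypeCrossing fintypeBivalent fintypeFace

variable {g : ℕ}

/-- The Euler characteristic of a face. -/
noncomputable def faceEuler (T : TangleDiagram g) (F : T.Face) : ℤ :=
  2 - (Nat.card {c : BoundaryCurve T.edge // Quot.lift T.face T.face_consecutive c = F} : ℤ)

/-- The map `ι` on darts and the map `q` on faces are compatible with edges, up to the set `S` of
darts, with the boundary, and with the faces of all corners. -/
def Compatible (T T' : TangleDiagram g)
    (ι : Dart T.Crossing T.Bivalent g → Dart T'.Crossing T'.Bivalent g) (q : T.Face → T'.Face)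
    (S : Set (Dart T.Crossing T.Bivalent g)) : Prop :=
  (∀ d ∉ S, T'.edge (ι d) = ι (T.edge d)) ∧
  (∀ i, ι (.bdry i) = .bdry i) ∧
  (∀ d, T'.face (ι d).left = q (T.face d.left)) ∧
  (∀ j, T'.face (.arc j) = q (T.face (.arc j)))

/-- The two diagrams have the same combinatorial structure.  The numbering of the darts may rotate
at each vertex, by a half turn or not at all at crossings, so that over and under are kept. -/
def IsIso (T T' : TangleDiagram g) : Prop :=
  ∃ (eX : T.Crossing ≃ T'.Crossing) (eV : T.Bivalent ≃ T'.Bivalent) (eF : T.Face ≃ T'.Face)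
    (r : T.Crossing → ZMod 4) (s : T.Bivalent → ZMod 2)
    (ι : Dart T.Crossing T.Bivalent g → Dart T'.Crossing T'.Bivalent g),
    (∀ x, r x = 0 ∨ r x = 2) ∧
    (∀ x i, ι (.cross x i) = .cross (eX x) (i + r x)) ∧
    (∀ v i, ι (.biv v i) = .biv (eV v) (i + s v)) ∧
    Compatible T T' ι eF ∅

/-- `T'` arises from `T` by placing a new bivalent vertex on the edge of the dart `d`. -/
def IsSubdivision (T T' : TangleDiagram g) : Prop :=
  ∃ (eX : T.Crossing ≃ T'.Crossing) (eV : Option T.Bivalent ≃ T'.Bivalent)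
    (eF : T.Face ≃ T'.Face)
    (ι : Dart T.Crossing T.Bivalent g → Dart T'.Crossing T'.Bivalent g)
    (d : Dart T.Crossing T.Bivalent g),
    (∀ x i, ι (.cross x i) = .cross (eX x) i) ∧
    (∀ v i, ι (.biv v i) = .biv (eV (some v)) i) ∧
    T'.edge (ι d) = .biv (eV none) 0 ∧
    T'.edge (ι (T.edge d)) = .biv (eV none) 1 ∧
    Compatible T T' ι eF {d, T.edge d}

/-- `T'` arises from `T` by splitting the crossing `x` into two arcs, one joining the darts `k` and
`k + 1`, the other the darts `k + 2` and `k + 3` of `x`, so that the faces at the corners `k + 1`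
and `k + 3` of `x` get connected.  Each of the two arcs carries a bivalent vertex. -/
def IsSmoothing (T : TangleDiagram g) (x : T.Crossing) (k : ZMod 4) (T' : TangleDiagram g) :
    Prop :=
  ∃ (eX : {y : T.Crossing // y ≠ x} ≃ T'.Crossing) (eV : T.Bivalent ⊕ Bool ≃ T'.Bivalent)
    (q : T.Face → T'.Face)
    (ι : Dart T.Crossing T.Bivalent g → Dart T'.Crossing T'.Bivalent g),
    Function.Surjective q ∧
    (∀ F F', q F = q F' ↔ F = F' ∨
      (F = T.face (.cross x (k + 1)) ∧ F' = T.face (.cross x (k + 3))) ∨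
      (F = T.face (.cross x (k + 3)) ∧ F' = T.face (.cross x (k + 1)))) ∧
    (∀ (y : {y : T.Crossing // y ≠ x}) i, ι (.cross y i) = .cross (eX y) i) ∧
    (∀ v i, ι (.biv v i) = .biv (eV (.inl v)) i) ∧
    ι (.cross x k) = .biv (eV (.inr false)) 0 ∧
    ι (.cross x (k + 1)) = .biv (eV (.inr false)) 1 ∧
    ι (.cross x (k + 2)) = .biv (eV (.inr true)) 0 ∧
    ι (.cross x (k + 3)) = .biv (eV (.inr true)) 1 ∧
    Compatible T T' ι q ∅

/-- `T'` arises from `T` by adding, inside some face `F`, a small circle that bounds an empty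
disk. -/
def IsLoopAddition (T T' : TangleDiagram g) : Prop :=
  ∃ (F : T.Face) (eX : T.Crossing ≃ T'.Crossing) (eV : Option T.Bivalent ≃ T'.Bivalent)
    (eF : Option T.Face ≃ T'.Face)
    (ι : Dart T.Crossing T.Bivalent g → Dart T'.Crossing T'.Bivalent g),
    (∀ x i, ι (.cross x i) = .cross (eX x) i) ∧
    (∀ v i, ι (.biv v i) = .biv (eV (some v)) i) ∧
    T'.edge (.biv (eV none) 0) = .biv (eV none) 1 ∧
    T'.face (.biv (eV none) 0) = eF none ∧
    T'.face (.biv (eV none) 1) = eF (some F) ∧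
    Compatible T T' ι (fun G => eF (some G)) ∅

/-- A checkerboarding: the faces are coloured dark (`true`) or light (`false`), with different
colours on the two sides of each edge. -/
structure Checkerboarding (T : TangleDiagram g) where
  dark : T.Face → Bool
  alternate : ∀ d : Dart T.Crossing T.Bivalent g,
    dark (T.face d.left) ≠ dark (T.face d.right)

/-- The Euler characteristic of the dark surface: it is made of the dark faces and of one band
(half-twisted) for each crossing, connecting the two dark corners there. -/
noncomputable def Checkerboarding.eulerChar {T : TangleDiagram g} (κ : T.Checkerboarding) : ℤ :=
  (∑ F : T.Face, if κ.dark F = true then T.faceEuler F else 0) - (Fintype.card T.Crossing : ℤ)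

/-- The signed number of crossings.  A crossing is positive if the dark surface rotates clockwise as
one passes through it, that is, if the dark corners are those swept by the over strand when it
turns counterclockwise: from the dart `1` to the dart `2` and from `3` to `0`. -/
def Checkerboarding.signedCrossings {T : TangleDiagram g} (κ : T.Checkerboarding) : ℤ :=
  ∑ x : T.Crossing, if κ.dark (T.face (.cross x 1)) = true then 1 else -1

end TangleDiagram

/-- Tangle diagrams with `g` boundary points up to planar isotopy (rel boundary) and up to
inserting and erasing bivalent vertices, keeping at least one on every closed loop. -/
def TangleClass (g : ℕ) : Type 1 :=
  Quot (fun T T' : TangleDiagram g => T.IsIso T' ∨ T.IsSubdivision T')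

/-- The class of a diagram. -/
def TangleDiagram.toClass {g : ℕ} (T : TangleDiagram g) : TangleClass g := Quot.mk _ T

/-- Base tangles: classes of diagrams without crossings and without closed loops. -/
def BaseTangle (g : ℕ) : Type 1 :=
  {B : TangleClass g // ∃ T : TangleDiagram g,
    T.toClass = B ∧ IsEmpty T.Crossing ∧ IsEmpty T.Bivalent}

/-- The free `ℤ[A, A⁻¹]`-module on the diagrams. -/
abbrev DiagramModule (g : ℕ) : Type 1 := TangleClass g →₀ LaurentPolynomial ℤ

/-- The generator of the free module given by a class of diagrams. -/
noncomputable def TangleClass.gen {g : ℕ} (t : TangleClass g) : DiagramModule g :=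
  Finsupp.single t 1

/-- The submodule generated by the Kauffman relations
`⟨loop⟩ = (-A² - A⁻²) ⟨no loop⟩` and `⟨crossing⟩ = A ⟨A-smoothing⟩ + A⁻¹ ⟨B-smoothing⟩`.  The
`A`-smoothing connects the two regions swept by the over strand turning counterclockwise. -/
noncomputable def kauffmanSubmodule (g : ℕ) :
    Submodule (LaurentPolynomial ℤ) (DiagramModule g) :=
  Submodule.span (LaurentPolynomial ℤ)
    ({r | ∃ T T' : TangleDiagram g, T.IsLoopAddition T' ∧
        r = T'.toClass.gen
          - (-LaurentPolynomial.T 2 - LaurentPolynomial.T (-2) : LaurentPolynomial ℤ)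
              • T.toClass.gen} ∪
     {r | ∃ (T : TangleDiagram g) (x : T.Crossing) (TA TB : TangleDiagram g),
        T.IsSmoothing x 0 TA ∧ T.IsSmoothing x 1 TB ∧
        r = T.toClass.gen
          - ((LaurentPolynomial.T 1 : LaurentPolynomial ℤ) • TA.toClass.gen
            + (LaurentPolynomial.T (-1) : LaurentPolynomial ℤ) • TB.toClass.gen)})

/-- The Kauffman skein module of the disk with `g` boundary points. -/
abbrev SkeinModule (g : ℕ) : Type 1 := DiagramModule g ⧸ kauffmanSubmodule g

/-- The element of the skein module represented by a class of diagrams. -/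
noncomputable def TangleClass.skein {g : ℕ} (t : TangleClass g) : SkeinModule g :=
  (kauffmanSubmodule g).mkQ t.gen

/-- `c` is an expansion of `T` in base tangles: `T = ∑ c_B B` in the skein module. -/
def TangleDiagram.IsExpansion {g : ℕ} (T : TangleDiagram g)
    (c : BaseTangle g →₀ LaurentPolynomial ℤ) : Prop :=
  T.toClass.skein = c.sum fun B p => p • B.1.skein

/-! Existence and congruences are proved together. A checkerboarding `κ` of a diagram has the degree
`w + 2e` modulo 4 (`Checkerboarding.degree`). Since a face contributes 2 minus its number of
boundary curves, `2e` modulo 4 only sees the parities of the numbers of dark curves and of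
crossings. An `A`-smoothing with the induced colours lowers the degree by 1, a `B`-smoothing raises
it by 1 (`exists_push_zero`, `exists_push_one`), and an added circle changes it by 2. These are
exactly the shifts of exponents caused by the coefficients `A`, `A⁻¹` and `-A² - A⁻²`. So when a
diagram is resolved into base tangles, for which `w = 0`, every exponent at `B` is congruent to the
degree of `T` minus `2e` of `B`. This is (2), and (1) follows because every diagram has a
checkerboarding.

The resolution is the induction principle `reduction`: smooth crossings, erase superfluous bivalent
vertices, erase a circle that bounds an empty disk. Uniqueness comes from the Kauffman state sum: it
respects the skein relations and takes values in the free module on relations between boundary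
points, where base tangles become distinct basis vectors, because a base tangle is determined by its
matching (`isIso_of_edge_eq`).

Diagrams being combinatorial, planarity has to be extracted from the Euler characteristic. Vertices,
edges and boundary curves are the orbits of permutations of the corners, and the inequality `V - E +
F ≤ 2C` (`numOrbits_add_numOrbits_mul_le`) says that no component has negative genus. Together with
the Euler condition it makes the bipartite graph of faces and components, with the boundary curves
as edges, a tree. Hence a face and a component share at most one curve (`curve_eq_of_face_eq`),
which shows that smoothings are planar. The same counts give an innermost circle
(`exists_empty_disk`) and prevent the arcs of a base tangle from crossing, so that they join
boundary points of opposite parity and alternating colours along the boundary circle extend inwards.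
-/

/-! ### Counting classes of generated equivalence relations -/

section Counting

variable {α β : Type*}

/-- Maps in both directions that respect the relations up to generated equivalence, and are inverse
to each other up to generated equivalence, give a bijection of the classes. -/
def quotEquivOfMaps {r : α → α → Prop} {s : β → β → Prop} (f : α → β) (h : β → α)
    (hf : ∀ a b, r a b → Quot.mk s (f a) = Quot.mk s (f b))
    (hh : ∀ a b, s a b → Quot.mk r (h a) = Quot.mk r (h b))
    (hfh : ∀ a, Quot.mk r (h (f a)) = Quot.mk r a)
    (hhf : ∀ b, Quot.mk s (f (h b)) = Quot.mk s b) : Quot r ≃ Quot s where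
  toFun := Quot.lift (fun a => Quot.mk s (f a)) hf
  invFun := Quot.lift (fun b => Quot.mk r (h b)) hh
  left_inv := by rintro ⟨a⟩; exact hfh a
  right_inv := by rintro ⟨b⟩; exact hhf b

theorem card_quot_congr {r s : α → α → Prop} (hr : ∀ a b, r a b → Quot.mk s a = Quot.mk s b)
    (hs : ∀ a b, s a b → Quot.mk r a = Quot.mk r b) : Nat.card (Quot r) = Nat.card (Quot s) :=
  Nat.card_congr (quotEquivOfMaps id id hr hs (fun _ => rfl) (fun _ => rfl))

theorem Quot.mk_eq_of_forall {r : α → α → Prop} {s : β → β → Prop} {f : α → β}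
    (h : ∀ a b, r a b → Quot.mk s (f a) = Quot.mk s (f b)) {a b : α}
    (hab : Quot.mk r a = Quot.mk r b) : Quot.mk s (f a) = Quot.mk s (f b) :=
  congrArg (Quot.lift (fun a => Quot.mk s (f a)) h) hab

theorem Quot.apply_eq_of_forall {r : α → α → Prop} {f : α → β}
    (h : ∀ a b, r a b → f a = f b) {a b : α}
    (hab : Quot.mk r a = Quot.mk r b) : f a = f b :=
  congrArg (Quot.lift f h) hab

theorem Quot.iff_of_forall {r : α → α → Prop} {p : α → Prop}
    (h : ∀ a b, r a b → (p a ↔ p b)) {a b : α}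
    (hab : Quot.mk r a = Quot.mk r b) : p a ↔ p b :=
  iff_of_eq (Quot.apply_eq_of_forall (fun a b hr => propext (h a b hr)) hab)

/-- The relation `r` together with one more pair. -/
def AddPair (r : α → α → Prop) (a b : α) : α → α → Prop := fun x y => r x y ∨ (x = a ∧ y = b)

theorem card_quot_addPair_of_eq {r : α → α → Prop} {a b : α} (h : Quot.mk r a = Quot.mk r b) :
    Nat.card (Quot (AddPair r a b)) = Nat.card (Quot r) := by
  refine card_quot_congr ?_ fun x y hxy => Quot.sound (Or.inl hxy)
  rintro x y (hxy | ⟨rfl, rfl⟩)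
  exacts [Quot.sound hxy, h]

open Classical in
theorem card_quot_addPair_of_ne [Finite α] {r : α → α → Prop} {a b : α}
    (h : Quot.mk r a ≠ Quot.mk r b) :
    Nat.card (Quot (AddPair r a b)) + 1 = Nat.card (Quot r) := by
  -- The class of `b` is absorbed by that of `a`: the classes of the enlarged relation correspond to
  -- the old classes other than that of `b`.
  let f : α → {c : Quot r // c ≠ Quot.mk r b} := fun x =>
    if hx : Quot.mk r x = Quot.mk r b then ⟨Quot.mk r a, h⟩ else ⟨Quot.mk r x, hx⟩
  have hf : ∀ x y, AddPair r a b x y → f x = f y := by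
    rintro x y (hxy | ⟨rfl, rfl⟩)
    · have : Quot.mk r x = Quot.mk r y := Quot.sound hxy
      simp [f, this]
    · simp [f, h]
  have hk : ∀ x y, r x y → Quot.mk (AddPair r a b) x = Quot.mk (AddPair r a b) y :=
    fun x y hxy => Quot.sound (Or.inl hxy)
  let k : Quot r → Quot (AddPair r a b) := Quot.lift (Quot.mk _) hk
  have e : Quot (AddPair r a b) ≃ {c : Quot r // c ≠ Quot.mk r b} :=
    { toFun := Quot.lift f hf
      invFun := fun c => k c.1
      left_inv := by
        rintro ⟨x⟩
        by_cases hx : Quot.mk r x = Quot.mk r b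
        · simp only [f, hx, dite_true, k]
          have h2 : Quot.mk (AddPair r a b) a = Quot.mk (AddPair r a b) b :=
            Quot.sound (Or.inr ⟨rfl, rfl⟩)
          exact h2.trans (Quot.mk_eq_of_forall (f := id) hk hx.symm)
        · simp [f, hx, k]
      right_inv := by
        rintro ⟨⟨x⟩, hx⟩
        simp only [k, f]
        rw [dif_neg hx] }
  have : Fintype (Quot r) := Fintype.ofFinite _
  rw [Nat.card_congr e, Nat.card_eq_fintype_card, Nat.card_eq_fintype_card,
    Fintype.card_subtype_compl, Fintype.card_subtype_eq]
  have : 0 < Fintype.card (Quot r) := Fintype.card_pos_iff.2 ⟨Quot.mk r a⟩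
  omega

theorem card_quot_le_addPair [Finite α] (r : α → α → Prop) (a b : α) :
    Nat.card (Quot r) ≤ Nat.card (Quot (AddPair r a b)) + 1 := by
  by_cases h : Quot.mk r a = Quot.mk r b
  · rw [card_quot_addPair_of_eq h]; omega
  · rw [card_quot_addPair_of_ne h]

/-- A graph with `m` edges on `n` vertices has at least `n - m` components. -/
theorem card_le_card_add_card_quot [Finite α] {ι : Type*} [Finite ι] (u v : ι → α) :
    Nat.card α ≤ Nat.card ι + Nat.card (Quot fun x y => ∃ i, x = u i ∧ y = v i) := by
  classical
  have := Fintype.ofFinite ι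
  -- Adding the edges one at a time, each lowers the number of components by at most one.
  have key : ∀ s : Finset ι,
      Nat.card α ≤ s.card + Nat.card (Quot fun x y => ∃ i ∈ s, x = u i ∧ y = v i) := by
    intro s
    induction s using Finset.induction_on with
    | empty =>
      have : Nat.card (Quot fun x y : α => ∃ i ∈ (∅ : Finset ι), x = u i ∧ y = v i)
          = Nat.card α := by
        refine (Nat.card_congr (Equiv.ofBijective (Quot.mk _) ⟨?_, Quot.mk_surjective⟩)).symm
        intro x y hxy
        exact Quot.apply_eq_of_forall (f := id) (by simp) hxy
      omega
    | insert i s hi ih =>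
      have h1 := card_quot_le_addPair (fun x y => ∃ i ∈ s, x = u i ∧ y = v i) (u i) (v i)
      have h2 : Nat.card (Quot (AddPair (fun x y => ∃ i ∈ s, x = u i ∧ y = v i) (u i) (v i)))
          = Nat.card (Quot fun x y => ∃ j ∈ insert i s, x = u j ∧ y = v j) := by
        refine card_quot_congr ?_ ?_
        · rintro x y (⟨j, hj, h⟩ | h)
          · exact Quot.sound ⟨j, Finset.mem_insert_of_mem hj, h⟩
          · exact Quot.sound ⟨i, Finset.mem_insert_self _ _, h⟩
        · rintro x y ⟨j, hj, h⟩
          rcases Finset.mem_insert.1 hj with hj | hj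
          · exact Quot.sound (Or.inr (hj ▸ h))
          · exact Quot.sound (Or.inl ⟨j, hj, h⟩)
      rw [Finset.card_insert_of_notMem hi, ← h2]
      omega
  simpa using key Finset.univ

/-- Classes inside an invariant set. -/
theorem card_quot_subtype {r : α → α → Prop} (p : α → Prop) (P : Quot r → Prop)
    (hP : ∀ a, P (Quot.mk r a) ↔ p a) :
    Nat.card {c : Quot r // P c} = Nat.card (Quot fun a b : {a // p a} => r a b) := by
  have hp : ∀ a b, r a b → (p a ↔ p b) := fun a b hab => by
    rw [← hP, ← hP, Quot.sound hab]
  let f : Quot (fun a b : {a // p a} => r a b) → {c : Quot r // P c} :=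
    Quot.lift (fun a => ⟨Quot.mk r a, (hP _).2 a.2⟩)
      fun a b hab => Subtype.ext (Quot.sound hab)
  refine (Nat.card_congr (Equiv.ofBijective f ⟨?_, ?_⟩)).symm
  · rintro ⟨a, ha⟩ ⟨b, hb⟩ hab'
    have hab : Relation.EqvGen r a b := Quot.eqvGen_exact (congrArg Subtype.val hab')
    -- The invariance of `p` is carried through the induction, since a chain from `a` to `b` must be
    -- known to stay inside `p`.
    have : (p a ↔ p b) ∧ ∀ ha hb, Quot.mk (fun a b : {a // p a} => r a b) ⟨a, ha⟩
        = Quot.mk (fun a b : {a // p a} => r a b) ⟨b, hb⟩ := by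
      clear ha hb hab'
      induction hab with
      | rel x y h => exact ⟨hp x y h, fun hx hy => Quot.sound h⟩
      | refl x => exact ⟨Iff.rfl, fun _ _ => rfl⟩
      | symm x y _ ih => exact ⟨ih.1.symm, fun hx hy => (ih.2 hy hx).symm⟩
      | trans x y z _ _ ih1 ih2 =>
        exact ⟨ih1.1.trans ih2.1, fun hx hz =>
          (ih1.2 hx (ih1.1.1 hx)).trans (ih2.2 _ hz)⟩
    exact this.2 ha hb
  · rintro ⟨⟨a⟩, ha⟩
    exact ⟨Quot.mk _ ⟨a, (hP a).1 ha⟩, rfl⟩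

end Counting

/-! ### Orbits of permutations -/

namespace Equiv.Perm

variable {α : Type*}

/-- The number of orbits of a permutation. -/
noncomputable def numOrbits (σ : Perm α) : ℕ := Nat.card (Quot fun x y => y = σ x)

/-- The number of orbits of the group generated by two permutations. -/
noncomputable def numOrbits₂ (σ τ : Perm α) : ℕ := Nat.card (Quot fun x y => y = σ x ∨ y = τ x)

/-- Lying in the same orbit. -/
abbrev orbitMk (σ : Perm α) (x : α) : Quot fun x y => y = σ x := Quot.mk _ x

theorem orbitMk_apply (σ : Perm α) (x : α) : σ.orbitMk (σ x) = σ.orbitMk x :=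
  (Quot.sound (r := fun x y => y = σ x) rfl).symm

theorem orbitMk_iterate (σ : Perm α) (n : ℕ) (x : α) : σ.orbitMk (σ^[n] x) = σ.orbitMk x := by
  induction n with
  | zero => rfl
  | succ n ih => rw [Function.iterate_succ_apply', orbitMk_apply, ih]

theorem exists_iterate_of_orbitMk_eq [Finite α] {σ : Perm α} {x y : α}
    (h : σ.orbitMk x = σ.orbitMk y) : ∃ n, σ^[n] x = y := by
  classical
  have : σ.SameCycle x x ↔ σ.SameCycle x y :=
    Quot.iff_of_forall (p := fun z => σ.SameCycle x z) (fun a b hab => by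
      subst hab; exact sameCycle_apply_right.symm) h
  obtain ⟨n, -, hn⟩ := (this.1 (SameCycle.refl _ _)).exists_pow_eq'
  exact ⟨n, by rw [← coe_pow]; exact hn⟩

variable [DecidableEq α]

/-- The swap cuts the cycle: if `σ^n a = b` with `n` minimal, the new orbit of `b` stays in `σ a, …,
σ^n a = b`, which does not contain `a`. -/
theorem orbitMk_mul_swap_ne [Finite α] {σ : Perm α} {a b : α} (hab : a ≠ b)
    (h : σ.orbitMk a = σ.orbitMk b) : (σ * swap a b).orbitMk a ≠ (σ * swap a b).orbitMk b := by
  classical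
  have hex : ∃ n, σ^[n] a = b := exists_iterate_of_orbitMk_eq h
  set n := Nat.find hex with hn
  have hnb : σ^[n] a = b := Nat.find_spec hex
  have hmin : ∀ m < n, σ^[m] a ≠ b := fun m hm => Nat.find_min hex hm
  have hn0 : n ≠ 0 := by rintro h0; rw [h0] at hnb; exact hab hnb
  have hna : ∀ m, 1 ≤ m → m ≤ n → σ^[m] a ≠ a := by
    intro m h1 h2 hma
    have : σ^[n - m] a = b := by
      rw [← hnb]
      conv_rhs => rw [← Nat.sub_add_cancel h2, Function.iterate_add_apply, hma]
    exact hmin (n - m) (by omega) this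
  let p : α → Prop := fun x => ∃ m, 1 ≤ m ∧ m ≤ n ∧ x = σ^[m] a
  have hp : ∀ x, p x → p ((σ * swap a b) x) := by
    rintro x ⟨m, h1, h2, rfl⟩
    rcases Nat.lt_or_ge m n with hlt | hge
    · refine ⟨m + 1, by omega, by omega, ?_⟩
      rw [mul_apply, swap_apply_of_ne_of_ne (hna m h1 h2) (hmin m hlt),
        Function.iterate_succ_apply']
    · obtain rfl : m = n := le_antisymm h2 hge
      exact ⟨1, le_rfl, h1, by rw [hnb, mul_apply, swap_apply_right]; rfl⟩
  intro hq
  obtain ⟨k, hk⟩ := exists_iterate_of_orbitMk_eq hq.symm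
  have : ∀ k, p ((⇑(σ * swap a b))^[k] b) := by
    intro k
    induction k with
    | zero => exact ⟨n, by omega, le_rfl, hnb.symm⟩
    | succ k ih => rw [Function.iterate_succ_apply']; exact hp _ ih
  obtain ⟨m, h1, h2, h3⟩ := hk ▸ this k
  exact hna m h1 h2 h3.symm

/-- The new permutation sends `a` to `σ b` and then follows the old cycle of `b`, which avoids `a`,
until it arrives at `b`. -/
theorem orbitMk_mul_swap_eq [Finite α] {σ : Perm α} {a b : α}
    (h : σ.orbitMk a ≠ σ.orbitMk b) : (σ * swap a b).orbitMk a = (σ * swap a b).orbitMk b := by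
  classical
  have hab : a ≠ b := by rintro rfl; exact h rfl
  have hex : ∃ n, σ^[n] (σ b) = b :=
    exists_iterate_of_orbitMk_eq (orbitMk_apply σ b)
  set n := Nat.find hex with hn
  have hnb : σ^[n] (σ b) = b := Nat.find_spec hex
  have hmin : ∀ m < n, σ^[m] (σ b) ≠ b := fun m hm => Nat.find_min hex hm
  have hna : ∀ m, σ^[m] (σ b) ≠ a := by
    intro m hm
    apply h
    rw [← hm, orbitMk_iterate, orbitMk_apply]
  have key : ∀ m, m ≤ n → (⇑(σ * swap a b))^[m] (σ b) = σ^[m] (σ b) := by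
    intro m
    induction m with
    | zero => intro _; rfl
    | succ m ih =>
      intro hm
      rw [Function.iterate_succ_apply', ih (by omega), mul_apply,
        swap_apply_of_ne_of_ne (hna m) (hmin m (by omega)), Function.iterate_succ_apply']
  have h1 : (σ * swap a b) a = σ b := by simp
  rw [← orbitMk_apply (σ * swap a b) a, h1, ← orbitMk_iterate (σ * swap a b) n (σ b),
    key n le_rfl, hnb]

/-- Since `σ * swap a b` differs from `σ` only by the exchange of `a` and `b`, its orbits lie inside
the classes obtained by gluing the orbits of `a` and `b`. -/
theorem addPair_mul_swap_le {σ : Perm α} {a b x y : α} (hxy : y = (σ * swap a b) x) :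
    Quot.mk (AddPair (fun x y => y = σ x) a b) x = Quot.mk (AddPair (fun x y => y = σ x) a b) y := by
  have hs : ∀ x, Quot.mk (AddPair (fun x y => y = σ x) a b) (σ x)
      = Quot.mk (AddPair (fun x y => y = σ x) a b) x := fun x =>
    (Quot.sound (r := AddPair (fun x y => y = σ x) a b) (Or.inl rfl)).symm
  have hp : Quot.mk (AddPair (fun x y => y = σ x) a b) a
      = Quot.mk (AddPair (fun x y => y = σ x) a b) b := Quot.sound (Or.inr ⟨rfl, rfl⟩)
  subst hxy
  rw [mul_apply, hs]
  by_cases hxa : x = a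
  · subst hxa; rw [swap_apply_left]; exact hp
  by_cases hxb : x = b
  · subst hxb; rw [swap_apply_right]; exact hp.symm
  · rw [swap_apply_of_ne_of_ne hxa hxb]

/-- The classes of `σ` glued at `a` and `b` are the orbits of `σ * swap a b`. The second inclusion
is the first one applied to `σ * swap a b`, as the swap is its own inverse and `a`, `b` already
share an orbit there. -/
theorem numOrbits_mul_swap_of_ne [Finite α] {σ : Perm α} {a b : α}
    (h : σ.orbitMk a ≠ σ.orbitMk b) : (σ * swap a b).numOrbits + 1 = σ.numOrbits := by
  unfold numOrbits
  rw [← card_quot_addPair_of_ne h]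
  congr 1
  refine card_quot_congr (fun x y hxy => addPair_mul_swap_le hxy) ?_
  have hq : σ = (σ * swap a b) * swap a b := by rw [mul_assoc, swap_mul_self, mul_one]
  have he := orbitMk_mul_swap_eq h
  rintro x y (hxy | ⟨rfl, rfl⟩)
  · rw [hq] at hxy
    have := addPair_mul_swap_le hxy
    refine Quot.mk_eq_of_forall (f := id) ?_ this
    rintro x y (hxy | ⟨rfl, rfl⟩)
    exacts [Quot.sound hxy, he]
  · exact he

theorem numOrbits_mul_swap_of_eq [Finite α] {σ : Perm α} {a b : α} (hab : a ≠ b)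
    (h : σ.orbitMk a = σ.orbitMk b) : (σ * swap a b).numOrbits = σ.numOrbits + 1 := by
  have := numOrbits_mul_swap_of_ne (orbitMk_mul_swap_ne hab h)
  rw [mul_assoc, swap_mul_self, mul_one] at this
  exact this.symm

/-- The Euler characteristic of a hypermap whose edges have at most two ends is at most twice the
number of its components. -/
theorem numOrbits_add_numOrbits_mul_le [Fintype α] (ρ ε : Perm α) (hε : ∀ x, ε (ε x) = x) :
    2 * (ρ.numOrbits + (ρ * ε).numOrbits) ≤ ε.support.card + 4 * ρ.numOrbits₂ ε := by
  -- Read the orbits of `ρ` as vertices, the 2-cycles of `ε` as edges and the orbits of `ρ * ε` as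
  -- faces. The claim is `V - E + F ≤ 2C`, proved by deleting edges; without edges each vertex is
  -- one component with one face.
  induction hc : ε.support.card using Nat.strong_induction_on generalizing ε with
  | _ n ih =>
  subst hc
  by_cases h1 : ε = 1
  · subst h1
    have : ρ.numOrbits₂ 1 = ρ.numOrbits := by
      refine card_quot_congr ?_ fun x y hxy => Quot.sound (Or.inl hxy)
      rintro x y (hxy | rfl)
      exacts [Quot.sound hxy, rfl]
    simp [this]; omega
  obtain ⟨a, ha⟩ : ∃ a, ε a ≠ a := by
    by_contra! h; exact h1 (Equiv.ext h)
  set b := ε a with hb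
  have hba : ε b = a := hε a
  set ε' := ε * swap a b with hε'
  have e1 : ε' a = a := by simp [hε', hba]
  have e2 : ε' b = b := by simp [hε', hb]
  have e3 : ∀ x, x ≠ a → x ≠ b → ε' x = ε x := fun x h1 h2 => by
    simp [hε', swap_apply_of_ne_of_ne h1 h2]
  have hi : ∀ x, ε' (ε' x) = x := by
    intro x
    by_cases hxa : x = a
    · rw [hxa, e1, e1]
    by_cases hxb : x = b
    · rw [hxb, e2, e2]
    have h3 : ε x ≠ a := fun h => hxb (by rw [hb, ← h, hε])
    have h4 : ε x ≠ b := fun h => hxa (ε.injective h)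
    rw [e3 x hxa hxb, e3 _ h3 h4, hε]
  have hcard : ε'.support.card + 2 = ε.support.card := by
    have : ε'.support = (ε.support.erase a).erase b := by
      ext x
      simp only [mem_support, Finset.mem_erase]
      by_cases hxa : x = a
      · simp [hxa, e1]
      by_cases hxb : x = b
      · simp [hxb, e2]
      simp [e3 x hxa hxb, hxa, hxb]
    rw [this, Finset.card_erase_of_mem, Finset.card_erase_of_mem]
    · have : 1 < ε.support.card := Finset.one_lt_card.2
        ⟨a, by simpa using ha, b, by simpa [hba] using Ne.symm ha, Ne.symm ha⟩
      omega
    · simpa using ha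
    · simp only [Finset.mem_erase, mem_support]
      exact ⟨ha, by rw [hba]; exact Ne.symm ha⟩
  have hρ : ρ * ε = (ρ * ε') * swap a b := by
    rw [hε', mul_assoc, mul_assoc, swap_mul_self, mul_one]
  have hk : ρ.numOrbits₂ ε = Nat.card (Quot (AddPair (fun x y => y = ρ x ∨ y = ε' x) a b)) := by
    refine card_quot_congr ?_ ?_
    · rintro x y (hxy | hxy)
      · exact Quot.sound (Or.inl (Or.inl hxy))
      · by_cases hxa : x = a
        · subst hxa; exact Quot.sound (Or.inr ⟨rfl, hxy⟩)
        by_cases hxb : x = b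
        · rw [hxb, hba] at hxy
          rw [hxb, hxy]
          symm
          exact Quot.sound (Or.inr ⟨rfl, rfl⟩)
        · exact Quot.sound (Or.inl (Or.inr (by rw [hxy, e3 x hxa hxb])))
    · rintro x y ((hxy | hxy) | ⟨rfl, rfl⟩)
      · exact Quot.sound (Or.inl hxy)
      · by_cases hxa : x = a
        · rw [hxy, hxa, e1]
        by_cases hxb : x = b
        · rw [hxy, hxb, e2]
        · exact Quot.sound (Or.inr (by rw [hxy, e3 x hxa hxb]))
      · exact Quot.sound (Or.inr hb)
  have IH := ih _ (by omega) ε' hi rfl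
  have hab : a ≠ b := Ne.symm ha
  -- If the ends of the deleted edge stay connected, `C` is unchanged and restoring the edge creates
  -- at most one face. Otherwise the edge is a bridge: restoring it joins two components and merges
  -- two faces.
  by_cases hq : (Quot.mk (fun x y => y = ρ x ∨ y = ε' x) a) = Quot.mk _ b
  · rw [card_quot_addPair_of_eq hq] at hk
    change _ = ρ.numOrbits₂ ε' at hk
    have : (ρ * ε).numOrbits ≤ (ρ * ε').numOrbits + 1 := by
      rw [hρ]
      by_cases ho : (ρ * ε').orbitMk a = (ρ * ε').orbitMk b
      · rw [numOrbits_mul_swap_of_eq hab ho]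
      · have := numOrbits_mul_swap_of_ne ho
        omega
    omega
  · have hk' := card_quot_addPair_of_ne hq
    change _ = ρ.numOrbits₂ ε' at hk'
    have ho : (ρ * ε').orbitMk a ≠ (ρ * ε').orbitMk b := by
      intro ho
      apply hq
      refine Quot.mk_eq_of_forall (f := id) ?_ ho
      rintro x y rfl
      exact (Quot.sound (r := fun x y => y = ρ x ∨ y = ε' x) (Or.inr rfl)).trans
        (Quot.sound (Or.inl rfl))
    have := numOrbits_mul_swap_of_ne ho
    rw [← hρ] at this
    omega

end Equiv.Perm

/-! ### The permutations of the corners of a diagram -/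

section Corners

variable {X V : Type} {g : ℕ}

/-- Darts as a sum type. -/
def dartEquivSum : Dart X V g ≃ (X × ZMod 4) ⊕ (V × ZMod 2) ⊕ Fin g where
  toFun
    | .cross x i => .inl (x, i)
    | .biv v i => .inr (.inl (v, i))
    | .bdry i => .inr (.inr i)
  invFun
    | .inl p => .cross p.1 p.2
    | .inr (.inl p) => .biv p.1 p.2
    | .inr (.inr i) => .bdry i
  left_inv := by rintro (_ | _ | _) <;> rfl
  right_inv := by rintro (_ | _ | _) <;> rfl

instance [Finite X] [Finite V] : Finite (Dart X V g) := Finite.of_equiv _ dartEquivSum.symm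

theorem card_dart [Fintype X] [Fintype V] :
    Nat.card (Dart X V g) = 4 * Fintype.card X + 2 * Fintype.card V + g := by
  rw [Nat.card_congr dartEquivSum, Nat.card_eq_fintype_card]
  simp [ZMod.card]
  ring

/-- The corner on the left of a dart; the outer vertex gets one additional dart at the base
point. -/
def leftEquiv : Option (Dart X V g) ≃ Corner X V g where
  toFun
    | some d => d.left
    | none => .arc (Fin.last g)
  invFun
    | .cross x i => some (.cross x i)
    | .biv v i => some (.biv v i)
    | .arc j => Fin.lastCases none (fun i => some (.bdry i)) j
  left_inv := by rintro (_ | (_ | _ | _)) <;> simp [Dart.left]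
  right_inv := by
    rintro (_ | _ | j)
    · rfl
    · rfl
    · induction j using Fin.lastCases <;> simp [Dart.left]

/-- The corner on the right of a dart; the outer vertex gets one additional dart at the base
point. -/
def rightEquiv : Option (Dart X V g) ≃ Corner X V g where
  toFun
    | some d => d.right
    | none => .arc 0
  invFun
    | .cross x i => some (.cross x (i + 1))
    | .biv v i => some (.biv v (i + 1))
    | .arc j => Fin.cases none (fun i => some (.bdry i)) j
  left_inv := by rintro (_ | (_ | _ | _)) <;> simp [Dart.right]
  right_inv := by
    rintro (_ | _ | j)
    · simp [Dart.right]
    · simp [Dart.right]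
    · induction j using Fin.cases <;> simp [Dart.right]

instance [Finite X] [Finite V] : Finite (Corner X V g) := Finite.of_equiv _ leftEquiv

/-- The clockwise rotation of the corners around the vertices. -/
def cornerRot : Equiv.Perm (Corner X V g) := leftEquiv.symm.trans rightEquiv

@[simp] theorem cornerRot_left (d : Dart X V g) : cornerRot d.left = d.right := by
  change rightEquiv (leftEquiv.symm (leftEquiv (some d))) = rightEquiv (some d)
  simp

@[simp] theorem cornerRot_last : cornerRot (.arc (Fin.last g) : Corner X V g) = .arc 0 := by
  change rightEquiv (leftEquiv.symm (leftEquiv none)) = rightEquiv none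
  simp

theorem Corner.eq_left_or_last (c : Corner X V g) :
    (∃ d : Dart X V g, c = d.left) ∨ c = .arc (Fin.last g) := by
  obtain ⟨o, rfl⟩ := leftEquiv.surjective c
  cases o with
  | none => exact Or.inr rfl
  | some d => exact Or.inl ⟨d, rfl⟩

theorem Corner.eq_left_or_arc (c : Corner X V g) :
    (∃ d : Dart X V g, c = d.left) ∨ ∃ j, c = .arc j := by
  rcases c.eq_left_or_last with h | h
  exacts [Or.inl h, Or.inr ⟨_, h⟩]

theorem Dart.left_injective : Function.Injective (Dart.left : Dart X V g → _) := fun a b h =>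
  Option.some_injective _ (leftEquiv.injective (a₁ := some a) (a₂ := some b) h)

theorem Dart.left_vertex (d : Dart X V g) : d.left.vertex = d.right.vertex := by
  cases d <;> rfl

theorem cornerRot_vertex (c : Corner X V g) : (cornerRot c).vertex = c.vertex := by
  rcases c.eq_left_or_last with ⟨d, rfl⟩ | rfl
  · rw [cornerRot_left, d.left_vertex]
  · rw [cornerRot_last]; rfl

/-- Going around a vertex meets all its corners. At the outer vertex the orbit closes up through the
additional dart at the base point. -/
theorem orbitMk_cornerRot_eq_iff {c c' : Corner X V g} :
    cornerRot.orbitMk c = cornerRot.orbitMk c' ↔ c.vertex = c'.vertex := by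
  constructor
  · refine Quot.apply_eq_of_forall ?_
    rintro x y rfl
    exact (cornerRot_vertex x).symm
  · have hd : ∀ d : Dart X V g, cornerRot.orbitMk d.right = cornerRot.orbitMk d.left := fun d => by
      rw [← cornerRot_left, Equiv.Perm.orbitMk_apply]
    have hx : ∀ (x : X) i, cornerRot.orbitMk (.cross x i : Corner X V g)
        = cornerRot.orbitMk (.cross x 0) := by
      have h : ∀ (x : X) i, cornerRot.orbitMk (.cross x (i - 1) : Corner X V g)
        = cornerRot.orbitMk (.cross x i) := fun x i => hd (.cross x i)
      have h1 : ∀ x : X, _ := fun x => h x 1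
      have h2 : ∀ x : X, _ := fun x => h x 2
      have h3 : ∀ x : X, _ := fun x => h x 3
      intro x i
      fin_cases i
      · rfl
      · exact (h1 x).symm
      · exact (h2 x).symm.trans (h1 x).symm
      · exact (h3 x).symm.trans ((h2 x).symm.trans (h1 x).symm)
    have hv : ∀ (v : V) i, cornerRot.orbitMk (.biv v i : Corner X V g)
        = cornerRot.orbitMk (.biv v 0) := by
      intro v i
      fin_cases i
      · rfl
      · exact (hd (.biv v 1)).symm
    have ha : ∀ j, cornerRot.orbitMk (.arc j : Corner X V g) = cornerRot.orbitMk (.arc 0) := by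
      intro j
      induction j using Fin.induction with
      | zero => rfl
      | succ i ih => exact (hd (.bdry i)).trans ih
    intro h
    cases c <;> cases c' <;> simp [Corner.vertex] at h
    · subst h; rw [hx, hx _ (_ : ZMod 4)]; exact (hx _ _).symm
    · subst h; rw [hv]; exact (hv _ _).symm
    · rw [ha]; exact (ha _).symm

theorem numOrbits_cornerRot [Fintype X] [Fintype V] :
    (cornerRot : Equiv.Perm (Corner X V g)).numOrbits
      = Fintype.card X + Fintype.card V + 1 := by
  have e : Quot (fun x y : Corner X V g => y = cornerRot x) ≃ Option (X ⊕ V) := by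
    refine Equiv.ofBijective (Quot.lift Corner.vertex ?_) ⟨?_, ?_⟩
    · rintro x y rfl; exact (cornerRot_vertex x).symm
    · rintro ⟨a⟩ ⟨b⟩ hab
      exact orbitMk_cornerRot_eq_iff.2 hab
    · rintro (_ | (x | v))
      exacts [⟨Quot.mk _ (.arc 0), rfl⟩, ⟨Quot.mk _ (.cross x 0), rfl⟩,
        ⟨Quot.mk _ (.biv v 0), rfl⟩]
  rw [Equiv.Perm.numOrbits, Nat.card_congr e, Nat.card_eq_fintype_card]
  simp

variable {edge : Dart X V g → Dart X V g}

/-- The pairing of the darts, on their left corners. -/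
def cornerEdge (h : ∀ d, edge (edge d) = d) : Equiv.Perm (Corner X V g) :=
  leftEquiv.permCongr (Equiv.optionCongr (Function.Involutive.toPerm edge h))

variable (h : ∀ d, edge (edge d) = d)

@[simp] theorem cornerEdge_left (d : Dart X V g) : cornerEdge h d.left = (edge d).left := by
  change leftEquiv (Equiv.optionCongr _ (leftEquiv.symm (leftEquiv (some d)))) = leftEquiv (some _)
  simp only [Equiv.symm_apply_apply, Equiv.optionCongr_apply, Option.map_some]
  rfl

@[simp] theorem cornerEdge_last : cornerEdge h (.arc (Fin.last g)) = .arc (Fin.last g) := by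
  change leftEquiv (Equiv.optionCongr _ (leftEquiv.symm (leftEquiv none))) = leftEquiv none
  simp

theorem cornerEdge_cornerEdge (c : Corner X V g) : cornerEdge h (cornerEdge h c) = c := by
  rcases c.eq_left_or_last with ⟨d, rfl⟩ | rfl <;> simp [h]

/-- Walking along a side of an edge takes the left corner of `d` to the right corner of `edge d`,
which is `cornerRot * cornerEdge`. At the additional dart, which `cornerEdge` fixes, the same
product is the step across the base point. -/
theorem boundaryCurve_eq_iff_orbit {c c' : Corner X V g} :
    (Quot.mk (Corner.Consecutive edge) c = Quot.mk _ c') ↔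
      (cornerRot * cornerEdge h).orbitMk c = (cornerRot * cornerEdge h).orbitMk c' := by
  constructor
  · refine Quot.mk_eq_of_forall (f := id) ?_
    rintro a b (⟨d⟩ | _)
    · refine Quot.sound ?_
      simp [h]
    · symm
      refine Quot.sound ?_
      simp
  · refine Quot.mk_eq_of_forall (f := id) ?_
    rintro a b rfl
    rcases a.eq_left_or_last with ⟨d, rfl⟩ | rfl
    · have := Corner.Consecutive.side (edge := edge) (edge d)
      rw [h] at this
      simpa using Quot.sound this
    · simpa using (Quot.sound (Corner.Consecutive.base (edge := edge))).symm

theorem card_boundaryCurve :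
    Nat.card (BoundaryCurve edge) = (cornerRot * cornerEdge h).numOrbits := by
  refine card_quot_congr ?_ ?_
  · intro a b hab
    exact (boundaryCurve_eq_iff_orbit h).1 (Quot.sound hab)
  · intro a b hab
    exact (boundaryCurve_eq_iff_orbit h).2 (Quot.sound hab)

/-- The number of components of the graph. -/
noncomputable def numComponents : ℕ := cornerRot.numOrbits₂ (cornerEdge h)

/-- The component of a corner. -/
def componentMk (c : Corner X V g) : Quot fun x y => y = cornerRot x ∨ y = cornerEdge h x :=
  Quot.mk _ c

theorem componentMk_eq_of_vertex {c c' : Corner X V g} (hv : c.vertex = c'.vertex) :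
    componentMk h c = componentMk h c' :=
  Quot.mk_eq_of_forall (r := fun x y => y = cornerRot x) (f := id)
    (fun _ _ hab => Quot.sound (Or.inl hab)) (orbitMk_cornerRot_eq_iff.2 hv)

theorem componentMk_eq_of_curve {c c' : Corner X V g}
    (hv : Quot.mk (Corner.Consecutive edge) c = Quot.mk _ c') :
    componentMk h c = componentMk h c' := by
  refine Quot.mk_eq_of_forall (f := id) ?_ ((boundaryCurve_eq_iff_orbit h).1 hv)
  rintro a b rfl
  have h1 := Quot.sound (r := fun x y => y = cornerRot x ∨ y = cornerEdge h x)
    (a := a) (Or.inr rfl)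
  exact h1.trans (Quot.sound (Or.inl rfl))

theorem numComponents_le [Fintype X] [Fintype V] :
    numComponents h ≤ Fintype.card X + Fintype.card V + 1 := by
  rw [← numOrbits_cornerRot (g := g)]
  refine Nat.card_le_card_of_surjective
    (Quot.lift (componentMk h) fun a b hab => Quot.sound (Or.inl hab)) ?_
  rintro ⟨c⟩
  exact ⟨Quot.mk _ c, rfl⟩

/-- The additional dart at the base point is fixed, so it does not count as an end of an edge. -/
theorem card_support_cornerEdge_le [Fintype X] [Fintype V] [Fintype (Corner X V g)]
    [DecidableEq (Corner X V g)] : (cornerEdge h).support.card ≤ Nat.card (Dart X V g) := by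
  let := Fintype.ofFinite (Dart X V g)
  rw [Nat.card_eq_fintype_card, ← Finset.card_univ]
  refine le_trans (Finset.card_le_card (t := Finset.univ.image Dart.left) fun c hc => ?_)
    Finset.card_image_le
  rcases c.eq_left_or_last with ⟨d, rfl⟩ | rfl
  · exact Finset.mem_image_of_mem _ (Finset.mem_univ d)
  · simp at hc

/-- The genus of the components is nonnegative. -/
theorem card_vertices_add_card_boundaryCurve_le [Fintype X] [Fintype V] :
    2 * (Fintype.card X + Fintype.card V + 1 + Nat.card (BoundaryCurve edge))
      ≤ Nat.card (Dart X V g) + 4 * numComponents h := by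
  classical
  let := Fintype.ofFinite (Corner X V g)
  rw [← numOrbits_cornerRot (g := g), card_boundaryCurve h]
  have := Equiv.Perm.numOrbits_add_numOrbits_mul_le cornerRot (cornerEdge h)
    (cornerEdge_cornerEdge h)
  have := card_support_cornerEdge_le h
  rw [numComponents]
  omega

end Corners

/-! ### Consequences of planarity: faces, components and boundary curves. -/

namespace TangleDiagram

variable {g : ℕ} (T : TangleDiagram g)

/-- The boundary curve through a corner. -/
abbrev curve (c : Corner T.Crossing T.Bivalent g) : BoundaryCurve T.edge := Quot.mk _ c

/-- The face bounded by a curve. -/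
abbrev curveFace : BoundaryCurve T.edge → T.Face := Quot.lift T.face T.face_consecutive

instance : Finite (BoundaryCurve T.edge) := Quot.finite _

/-- Each curve bounds exactly one face, so the curves may be counted face by face. The predicate `p`
serves to restrict the count to dark faces. -/
theorem sum_euler {X V F : Type} [Fintype F] [Finite X] [Finite V]
    {edge : Dart X V g → Dart X V g} (face : BoundaryCurve edge → F) (p : F → Prop)
    [DecidablePred p] :
    (∑ G : F, if p G then 2 - (Nat.card {c : BoundaryCurve edge // face c = G} : ℤ) else 0)
      = 2 * (Nat.card {G // p G} : ℤ) - Nat.card {c : BoundaryCurve edge // p (face c)} := by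
  classical
  have : Finite (BoundaryCurve edge) := Quot.finite _
  let := Fintype.ofFinite (BoundaryCurve edge)
  have h1 : Nat.card {c : BoundaryCurve edge // p (face c)}
      = ∑ G : F, if p G then Nat.card {c : BoundaryCurve edge // face c = G} else 0 := by
    simp only [Nat.card_eq_fintype_card, Fintype.card_subtype]
    rw [← Finset.sum_filter, Finset.card_eq_sum_card_fiberwise
      (f := face) (t := Finset.univ.filter p) (fun c hc => by simpa using hc)]
    refine Finset.sum_congr rfl fun G hG => ?_
    congr 1
    ext c
    simp only [Finset.mem_filter, Finset.mem_univ, true_and] at hG ⊢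
    exact ⟨fun h => h.2, fun h => ⟨h ▸ hG, h⟩⟩
  rw [h1, Nat.card_eq_fintype_card, Fintype.card_subtype, ← Finset.sum_filter,
    ← Finset.sum_filter, Finset.sum_sub_distrib]
  simp [mul_comm]

theorem sum_faceEuler :
    ∑ F : T.Face, T.faceEuler F
      = 2 * (Fintype.card T.Face : ℤ) - Nat.card (BoundaryCurve T.edge) := by
  have := sum_euler T.curveFace (fun _ => True)
  simp only [if_true] at this
  rw [Nat.card_congr (Equiv.subtypeUnivEquiv fun _ => trivial),
    Nat.card_congr (Equiv.subtypeUnivEquiv fun _ => trivial), Nat.card_eq_fintype_card] at this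
  exact this

/-- The condition `euler`, with the faces and the boundary curves counted separately. -/
theorem euler_count :
    (Fintype.card T.Crossing + Fintype.card T.Bivalent + 1 : ℤ)
      - ((Nat.card (Dart T.Crossing T.Bivalent g) / 2 : ℕ) : ℤ)
      + (2 * (Fintype.card T.Face : ℤ) - Nat.card (BoundaryCurve T.edge)) = 2 := by
  rw [← T.sum_faceEuler]
  have := T.euler
  push_cast at this ⊢
  exact this

/-- The number of faces plus the number of components is at most one more than the number of
boundary curves, and fewer curves suffice if they connect the same faces with the same
components. -/
theorem card_face_add_numComponents_le {ι : Type} [Finite ι]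
    (c : ι → Corner T.Crossing T.Bivalent g)
    (hc : ∀ a, ∃ i, T.face (c i) = T.face a ∧
      componentMk T.edge_edge (c i) = componentMk T.edge_edge a) :
    Fintype.card T.Face + numComponents T.edge_edge ≤ Nat.card ι + 1 := by
  -- In the bipartite graph of faces and components, each chosen corner is an edge between its face
  -- and its component. The condition `connected` makes this graph connected, so it has at most one
  -- node more than it has edges.
  let N := T.Face ⊕ (Quot fun x y => y = cornerRot x ∨ y = cornerEdge T.edge_edge x)
  let r : N → N → Prop := fun x y => ∃ i, x = Sum.inl (T.face (c i)) ∧ y = Sum.inr (componentMk T.edge_edge (c i))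
  have h0 := card_le_card_add_card_quot (α := N) (fun i => Sum.inl (T.face (c i)))
    (fun i => Sum.inr (componentMk T.edge_edge (c i)))
  have h1 : ∀ a, Quot.mk r (Sum.inl (T.face a)) = Quot.mk r (Sum.inr (componentMk T.edge_edge a)) := by
    intro a
    obtain ⟨i, h1, h2⟩ := hc a
    exact Quot.sound ⟨i, by rw [h1], by rw [h2]⟩
  have h2 : ∀ a b, Quot.mk r (Sum.inl (T.face a)) = Quot.mk r (Sum.inl (T.face b)) := by
    intro a b
    have := T.connected a b
    induction this with
    | rel x y h =>
      rcases h with h | h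
      · rw [h1, h1, componentMk_eq_of_vertex _ h]
      · rw [h]
    | refl x => rfl
    | symm x y _ ih => exact ih.symm
    | trans x y z _ _ ih1 ih2 => exact ih1.trans ih2
  have h3 : Nat.card (Quot r) ≤ 1 := by
    have : Subsingleton (Quot r) := by
      have h4 : ∀ z : Quot r, z = Quot.mk r (Sum.inl (T.face (.arc 0))) := by
        rintro ⟨F | x⟩
        · obtain ⟨a, rfl⟩ := T.face_surjective F
          exact h2 _ _
        · obtain ⟨a, rfl⟩ := Quot.exists_rep x
          exact (h1 a).symm.trans (h2 _ _)
      exact ⟨fun a b => (h4 a).trans (h4 b).symm⟩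
    exact Finite.card_le_one_iff_subsingleton.2 this
  change Nat.card (_ ⊕ _) ≤ _ at h0
  rw [Nat.card_sum, Nat.card_eq_fintype_card (α := T.Face)] at h0
  change _ + numComponents _ ≤ Nat.card ι + Nat.card (Quot r) at h0
  omega

/-- Nonnegative genus of the components, inserted in the Euler condition. This is the reverse of the
connectivity bound: the graph of faces and components with the curves as edges is a tree. -/
theorem card_boundaryCurve_add_one_le :
    Nat.card (BoundaryCurve T.edge) + 1 ≤ Fintype.card T.Face + numComponents T.edge_edge := by
  have h1 := card_vertices_add_card_boundaryCurve_le T.edge_edge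
  have h2 := T.euler_count
  omega

/-- In a planar diagram a face and a component have at most one boundary curve in common. -/
theorem curve_eq_of_face_eq {a b : Corner T.Crossing T.Bivalent g} (hF : T.face a = T.face b)
    (hK : componentMk T.edge_edge a = componentMk T.edge_edge b) : T.curve a = T.curve b := by
  by_contra hab
  -- Two curves between the same face and component would be a double edge in a tree: without the
  -- curve of `b` the graph would still be connected, with one edge too few.
  have h1 := T.card_face_add_numComponents_le
    (fun i : {c : BoundaryCurve T.edge // c ≠ T.curve b} => i.1.out) (by
      intro d
      by_cases hd : T.curve d = T.curve b
      · refine ⟨⟨T.curve a, hab⟩, ?_, ?_⟩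
        · have h2 : T.curveFace (Quot.mk _ (T.curve a).out) = T.curveFace (T.curve a) := by
            rw [Quot.out_eq]
          have h3 : T.curveFace (T.curve d) = T.curveFace (T.curve b) := by rw [hd]
          exact h2.trans (hF.trans h3.symm)
        · rw [componentMk_eq_of_curve T.edge_edge hd, ← hK]
          exact componentMk_eq_of_curve T.edge_edge (Quot.out_eq _)
      · refine ⟨⟨T.curve d, hd⟩, ?_, ?_⟩
        · have h2 : T.curveFace (Quot.mk _ (T.curve d).out) = T.curveFace (T.curve d) := by
            rw [Quot.out_eq]
          exact h2
        · exact componentMk_eq_of_curve T.edge_edge (Quot.out_eq _))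
  have h2 := T.card_boundaryCurve_add_one_le
  classical
  let := Fintype.ofFinite (BoundaryCurve T.edge)
  have h3 : Nat.card {c : BoundaryCurve T.edge // c ≠ T.curve b} + 1
      = Nat.card (BoundaryCurve T.edge) := by
    rw [Nat.card_eq_fintype_card, Nat.card_eq_fintype_card, Fintype.card_subtype_compl,
      Fintype.card_subtype_eq]
    have : 0 < Fintype.card (BoundaryCurve T.edge) := Fintype.card_pos_iff.2 ⟨T.curve b⟩
    omega
  omega

end TangleDiagram

/-! ### Smoothing a crossing -/

theorem Equiv.Perm.numOrbits_congr {α β : Type*} {σ : Equiv.Perm α} {τ : Equiv.Perm β} (e : α ≃ β)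
    (h : ∀ x, e (σ x) = τ (e x)) : σ.numOrbits = τ.numOrbits :=
  Nat.card_congr (Quot.congr e fun a b => by rw [← h, e.apply_eq_iff_eq])

theorem card_range_ite {α : Type*} [Fintype α] [DecidableEq α] (a b : α) :
    Nat.card (Set.range fun x : α => if x = b then a else x) + 1
      = Fintype.card α + if a = b then 1 else 0 := by
  split_ifs with h
  · subst h
    have : Set.range (fun x : α => if x = a then a else x) = Set.univ := by
      ext y
      simp only [Set.mem_range, Set.mem_univ, iff_true]
      exact ⟨y, by split_ifs with h <;> simp [h]⟩
    rw [this, Nat.card_univ, Nat.card_eq_fintype_card]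
  · have : Set.range (fun x : α => if x = b then a else x) = {y | y ≠ b} := by
      ext y
      simp only [Set.mem_range, Set.mem_ofPred_eq]
      constructor
      · rintro ⟨x, rfl⟩
        split_ifs with hx
        exacts [h, hx]
      · intro hy
        exact ⟨y, if_neg hy⟩
    rw [this]
    change Nat.card {y // y ≠ b} + 1 = _
    rw [Nat.card_eq_fintype_card, Fintype.card_subtype_compl, Fintype.card_subtype_eq]
    have : 0 < Fintype.card α := Fintype.card_pos_iff.2 ⟨a⟩
    omega

namespace TangleDiagram

variable {g : ℕ}

theorem sum_euler_all {X V F : Type} [Fintype F] [Finite X] [Finite V]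
    {edge : Dart X V g → Dart X V g} (face : BoundaryCurve edge → F) :
    (∑ G : F, (2 - (Nat.card {c : BoundaryCurve edge // face c = G} : ℤ)))
      = 2 * (Nat.card F : ℤ) - Nat.card (BoundaryCurve edge) := by
  have := sum_euler face (fun _ => True)
  simp only [if_true] at this
  rw [Nat.card_congr (Equiv.subtypeUnivEquiv fun _ => trivial),
    Nat.card_congr (Equiv.subtypeUnivEquiv fun _ => trivial)] at this
  exact this

end TangleDiagram

/-- The two arcs of a smoothed crossing have together four darts. -/
def smoothIndex (b : Bool) (i : ZMod 2) : ZMod 4 := (if b then 2 else 0) + (i.val : ZMod 4)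

theorem smoothIndex_injective : ∀ b i b' i', smoothIndex b i = smoothIndex b' i' → b = b' ∧ i = i' := by
  decide

theorem exists_smoothIndex : ∀ j, ∃ b i, smoothIndex b i = j := by decide

section Smoothing

variable {X V : Type} {g : ℕ} (x : X) (k : ZMod 4)

/-- The dart of the original diagram that a dart of the smoothed diagram comes from. -/
def unsmoothDart : Dart {y // y ≠ x} (V ⊕ Bool) g → Dart X V g
  | .cross y i => .cross y i
  | .biv (.inl v) i => .biv v i
  | .biv (.inr b) i => .cross x (k + smoothIndex b i)
  | .bdry i => .bdry i

/-- The corner of the original diagram that a corner of the smoothed diagram comes from. -/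
def unsmoothCorner : Corner {y // y ≠ x} (V ⊕ Bool) g → Corner X V g
  | .cross y i => .cross y i
  | .biv (.inl v) i => .biv v i
  | .biv (.inr b) i => .cross x (k + smoothIndex b i)
  | .arc i => .arc i

theorem unsmoothDart_bijective : Function.Bijective (unsmoothDart (V := V) (g := g) x k) := by
  constructor
  · rintro (⟨⟨y, hy⟩, i⟩ | ⟨v | b, i⟩ | i) (⟨⟨y', hy'⟩, i'⟩ | ⟨v' | b', i'⟩ | i') h <;>
      simp only [unsmoothDart, Dart.cross.injEq, Dart.biv.injEq, Dart.bdry.injEq, reduceCtorEq,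
        add_right_inj] at h
    · obtain ⟨rfl, rfl⟩ := h; rfl
    · exact absurd h.1 hy
    · obtain ⟨rfl, rfl⟩ := h; rfl
    · exact absurd h.1.symm hy'
    · obtain ⟨rfl, rfl⟩ := smoothIndex_injective _ _ _ _ h.2; rfl
    · subst h; rfl
  · rintro (⟨y, i⟩ | ⟨v, i⟩ | i)
    · by_cases hy : y = x
      · obtain ⟨b, i', h⟩ := exists_smoothIndex (i - k)
        exact ⟨.biv (.inr b) i', by simp [unsmoothDart, h, hy]⟩
      · exact ⟨.cross ⟨y, hy⟩ i, rfl⟩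
    · exact ⟨.biv (.inl v) i, rfl⟩
    · exact ⟨.bdry i, rfl⟩

theorem unsmoothCorner_bijective : Function.Bijective (unsmoothCorner (V := V) (g := g) x k) := by
  constructor
  · rintro (⟨⟨y, hy⟩, i⟩ | ⟨v | b, i⟩ | i) (⟨⟨y', hy'⟩, i'⟩ | ⟨v' | b', i'⟩ | i') h <;>
      simp only [unsmoothCorner, Corner.cross.injEq, Corner.biv.injEq, Corner.arc.injEq,
        reduceCtorEq, add_right_inj] at h
    · obtain ⟨rfl, rfl⟩ := h; rfl
    · exact absurd h.1 hy
    · obtain ⟨rfl, rfl⟩ := h; rfl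
    · exact absurd h.1.symm hy'
    · obtain ⟨rfl, rfl⟩ := smoothIndex_injective _ _ _ _ h.2; rfl
    · subst h; rfl
  · rintro (⟨y, i⟩ | ⟨v, i⟩ | i)
    · by_cases hy : y = x
      · obtain ⟨b, i', h⟩ := exists_smoothIndex (i - k)
        exact ⟨.biv (.inr b) i', by simp [unsmoothCorner, h, hy]⟩
      · exact ⟨.cross ⟨y, hy⟩ i, rfl⟩
    · exact ⟨.biv (.inl v) i, rfl⟩
    · exact ⟨.arc i, rfl⟩

/-- `unsmoothDart` as a bijection. -/
noncomputable def unsmoothDartEquiv : Dart {y // y ≠ x} (V ⊕ Bool) g ≃ Dart X V g :=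
  Equiv.ofBijective _ (unsmoothDart_bijective x k)

/-- `unsmoothCorner` as a bijection. -/
noncomputable def unsmoothCornerEquiv : Corner {y // y ≠ x} (V ⊕ Bool) g ≃ Corner X V g :=
  Equiv.ofBijective _ (unsmoothCorner_bijective x k)

theorem unsmoothCorner_left (d : Dart {y // y ≠ x} (V ⊕ Bool) g) :
    unsmoothCorner x k d.left = (unsmoothDart x k d).left := by
  rcases d with _ | ⟨_ | _, _⟩ | _ <;> rfl

variable [DecidableEq (Corner X V g)]

/-- Splitting the crossing into two bivalent vertices changes the rotation of the corners only by
the exchange of the corners `k + 1` and `k + 3`, where the two faces meet after the smoothing. -/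
theorem unsmoothCorner_right (d : Dart {y // y ≠ x} (V ⊕ Bool) g) :
    unsmoothCorner x k d.right
      = Equiv.swap (.cross x (k + 1)) (.cross x (k + 3)) (unsmoothDart x k d).right := by
  rcases d with ⟨⟨y, hy⟩, i⟩ | ⟨v | b, i⟩ | i
  · simp only [unsmoothCorner, unsmoothDart, Dart.right]
    rw [Equiv.swap_apply_of_ne_of_ne] <;> simp [hy]
  · simp only [unsmoothCorner, unsmoothDart, Dart.right]
    rw [Equiv.swap_apply_of_ne_of_ne] <;> simp
  · have key : ∀ (k : ZMod 4) (b : Bool) (i : ZMod 2), k + smoothIndex b i - 1 = k + 3 ∧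
        k + smoothIndex b (i - 1) = k + 1 ∨ k + smoothIndex b i - 1 = k + 1 ∧
        k + smoothIndex b (i - 1) = k + 3 ∨ (k + smoothIndex b i - 1 ≠ k + 1 ∧
          k + smoothIndex b i - 1 ≠ k + 3 ∧
          k + smoothIndex b (i - 1) = k + smoothIndex b i - 1) := by decide
    simp only [unsmoothCorner, unsmoothDart, Dart.right]
    rcases key k b i with ⟨h1, h2⟩ | ⟨h1, h2⟩ | ⟨h1, h2, h3⟩
    · rw [h1, h2, Equiv.swap_apply_right]
    · rw [h1, h2, Equiv.swap_apply_left]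
    · rw [h3, Equiv.swap_apply_of_ne_of_ne] <;> simpa
  · simp only [unsmoothCorner, unsmoothDart, Dart.right]
    rw [Equiv.swap_apply_of_ne_of_ne] <;> simp

/-- The swap is moved to the other side of `σ`, where it exchanges the preimages of `a` and `b`,
which lie in the same orbits. -/
theorem numOrbits_swap_mul_of_eq {α : Type*} [DecidableEq α] [Finite α] {σ : Equiv.Perm α} {a b : α}
    (hab : a ≠ b) (h : σ.orbitMk a = σ.orbitMk b) :
    (Equiv.swap a b * σ).numOrbits = σ.numOrbits + 1 := by
  rw [Equiv.swap_mul_eq_mul_swap]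
  refine Equiv.Perm.numOrbits_mul_swap_of_eq (by simpa using hab) ?_
  have : ∀ c, σ.orbitMk (σ⁻¹ c) = σ.orbitMk c := fun c => by
    rw [← Equiv.Perm.orbitMk_apply σ (σ⁻¹ c)]
    congr 1
    exact σ.apply_symm_apply c
  rw [this, this, h]

theorem numOrbits_swap_mul_of_ne {α : Type*} [DecidableEq α] [Finite α] {σ : Equiv.Perm α} {a b : α}
    (h : σ.orbitMk a ≠ σ.orbitMk b) :
    (Equiv.swap a b * σ).numOrbits + 1 = σ.numOrbits := by
  rw [Equiv.swap_mul_eq_mul_swap]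
  refine Equiv.Perm.numOrbits_mul_swap_of_ne ?_
  have : ∀ c, σ.orbitMk (σ⁻¹ c) = σ.orbitMk c := fun c => by
    rw [← Equiv.Perm.orbitMk_apply σ (σ⁻¹ c)]
    congr 1
    exact σ.apply_symm_apply c
  rwa [this, this]

end Smoothing

/-! ### The smoothed diagram and its planarity. -/

namespace TangleDiagram

variable {g : ℕ} (T : TangleDiagram g) (x : T.Crossing) (k : ZMod 4)

/-- The pairing of the darts after smoothing. -/
noncomputable def smoothEdge (d : Dart {y // y ≠ x} (T.Bivalent ⊕ Bool) g) :
    Dart {y // y ≠ x} (T.Bivalent ⊕ Bool) g :=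
  (unsmoothDartEquiv x k).symm (T.edge (unsmoothDart x k d))

theorem unsmoothDart_smoothEdge (d : Dart {y // y ≠ x} (T.Bivalent ⊕ Bool) g) :
    unsmoothDart x k (T.smoothEdge x k d) = T.edge (unsmoothDart x k d) :=
  (unsmoothDartEquiv x k).apply_symm_apply _

theorem smoothEdge_smoothEdge (d : Dart {y // y ≠ x} (T.Bivalent ⊕ Bool) g) :
    T.smoothEdge x k (T.smoothEdge x k d) = d := by
  apply (unsmoothDart_bijective x k).1
  rw [unsmoothDart_smoothEdge, unsmoothDart_smoothEdge, T.edge_edge]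

open Classical in
theorem card_boundaryCurve_smoothEdge :
    Nat.card (BoundaryCurve (T.smoothEdge x k))
      = (Equiv.swap (Corner.cross x (k + 1)) (Corner.cross x (k + 3))
          * (cornerRot * cornerEdge T.edge_edge)).numOrbits := by
  rw [card_boundaryCurve (T.smoothEdge_smoothEdge x k)]
  refine Equiv.Perm.numOrbits_congr (unsmoothCornerEquiv x k) fun c => ?_
  change unsmoothCorner x k _ = (_ * _ : Equiv.Perm _) (unsmoothCorner x k c)
  rcases c.eq_left_or_last with ⟨d, rfl⟩ | rfl
  · simp [unsmoothCorner_left, unsmoothCorner_right, unsmoothDart_smoothEdge]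
  · simp only [Equiv.Perm.mul_apply, cornerEdge_last, cornerRot_last]
    simp only [unsmoothCorner, cornerEdge_last, cornerRot_last]
    rw [Equiv.swap_apply_of_ne_of_ne] <;> simp

open Classical in
/-- The identification of the faces in a smoothing. -/
noncomputable def smoothFace (F : T.Face) : T.Face :=
  if F = T.face (.cross x (k + 3)) then T.face (.cross x (k + 1)) else F

theorem smoothFace_eq_iff (F F' : T.Face) : T.smoothFace x k F = T.smoothFace x k F' ↔ F = F' ∨
      (F = T.face (.cross x (k + 1)) ∧ F' = T.face (.cross x (k + 3))) ∨
      (F = T.face (.cross x (k + 3)) ∧ F' = T.face (.cross x (k + 1))) := by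
  unfold smoothFace
  split_ifs <;> grind

open Classical in
theorem smoothFace_face_swap (c : Corner T.Crossing T.Bivalent g) :
    T.smoothFace x k (T.face (Equiv.swap (.cross x (k + 1)) (.cross x (k + 3)) c))
      = T.smoothFace x k (T.face c) := by
  rw [smoothFace_eq_iff]
  by_cases h1 : c = .cross x (k + 1)
  · subst h1; rw [Equiv.swap_apply_left]; exact Or.inr (Or.inr ⟨rfl, rfl⟩)
  by_cases h2 : c = .cross x (k + 3)
  · subst h2; rw [Equiv.swap_apply_right]; exact Or.inr (Or.inl ⟨rfl, rfl⟩)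
  rw [Equiv.swap_apply_of_ne_of_ne h1 h2]
  exact Or.inl rfl

/-- The face of a corner after smoothing. -/
noncomputable def smoothFaceMap (c : Corner {y // y ≠ x} (T.Bivalent ⊕ Bool) g) :
    Set.range (T.smoothFace x k) :=
  ⟨T.smoothFace x k (T.face (unsmoothCorner x k c)), Set.mem_range_self _⟩

theorem smoothFaceMap_consecutive (c c' : Corner {y // y ≠ x} (T.Bivalent ⊕ Bool) g)
    (h : Corner.Consecutive (T.smoothEdge x k) c c') :
    T.smoothFaceMap x k c = T.smoothFaceMap x k c' := by
  classical
  apply Subtype.ext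
  simp only [smoothFaceMap]
  rcases h with ⟨d⟩ | _
  · rw [unsmoothCorner_right, smoothFace_face_swap, unsmoothCorner_left, unsmoothDart_smoothEdge,
      T.face_consecutive _ _ (.side _)]
  · simp only [unsmoothCorner]
    rw [T.face_consecutive _ _ .base]

theorem smoothFaceMap_connected (c c' : Corner {y // y ≠ x} (T.Bivalent ⊕ Bool) g) :
    Relation.EqvGen (fun a b => a.vertex = b.vertex ∨
      T.smoothFaceMap x k a = T.smoothFaceMap x k b) c c' := by
  let r := fun a b : Corner {y // y ≠ x} (T.Bivalent ⊕ Bool) g => a.vertex = b.vertex ∨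
      T.smoothFaceMap x k a = T.smoothFaceMap x k b
  apply Quot.eqvGen_exact
  change Quot.mk r c = Quot.mk r c'
  have hv : ∀ {a b}, a.vertex = b.vertex → Quot.mk r a = Quot.mk r b :=
    fun h => Quot.sound (Or.inl h)
  have hF : ∀ {a b}, T.face (unsmoothCorner x k a) = T.face (unsmoothCorner x k b) →
    Quot.mk r a = Quot.mk r b := fun h => Quot.sound (Or.inr (Subtype.ext (congrArg (T.smoothFace x k) h)))
  -- The crossing has become two vertices, but the merged face touches both, at the corners `k + 1`
  -- and `k + 3`, so connectedness survives.
  have hx : ∀ b i, Quot.mk r (.biv (.inr b) i) = Quot.mk r (.biv (.inr false) 0) := by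
    intro b i
    cases b
    · exact hv rfl
    · have h1 : Quot.mk r (.biv (.inr true) i) = Quot.mk r (.biv (.inr true) 1) := hv rfl
      have h2 : Quot.mk r (.biv (.inr false) 1) = Quot.mk r (.biv (.inr false) 0) := hv rfl
      rw [h1, ← h2]
      refine Quot.sound (Or.inr (Subtype.ext ?_))
      refine (smoothFace_eq_iff ..).2 (Or.inr (Or.inr ⟨?_, ?_⟩)) <;> rfl
  have key : ∀ a b, Relation.EqvGen (fun a b => a.vertex = b.vertex ∨ T.face a = T.face b) a b →
      Quot.mk r ((unsmoothCornerEquiv x k).symm a) = Quot.mk r ((unsmoothCornerEquiv x k).symm b) := by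
    intro a b hab
    induction hab with
    | rel a b h =>
      obtain ⟨a, rfl⟩ := (unsmoothCornerEquiv x k).surjective a
      obtain ⟨b, rfl⟩ := (unsmoothCornerEquiv x k).surjective b
      simp only [Equiv.symm_apply_apply]
      rcases h with h | h
      · change (unsmoothCorner x k a).vertex = (unsmoothCorner x k b).vertex at h
        rcases a with ⟨⟨y, hy⟩, i⟩ | ⟨v | e, i⟩ | i <;>
          rcases b with ⟨⟨y', hy'⟩, i'⟩ | ⟨v' | e', i'⟩ | i' <;>
          simp only [unsmoothCorner, Corner.vertex, Option.some.injEq, Sum.inl.injEq,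
            Sum.inr.injEq, reduceCtorEq] at h
        · subst h; exact hv rfl
        · exact absurd h hy
        · subst h; exact hv rfl
        · exact absurd h.symm hy'
        · exact (hx _ _).trans (hx _ _).symm
        · exact hv rfl
      · exact hF h
    | refl a => rfl
    | symm a b _ ih => exact ih.symm
    | trans a b c _ _ ih1 ih2 => exact ih1.trans ih2
  have := key _ _ (T.connected (unsmoothCornerEquiv x k c) (unsmoothCornerEquiv x k c'))
  simpa using this

/-- If the two opposite corners lie in one face, they lie on one curve by planarity, and the swap
splits this curve; otherwise two faces and two curves merge. In both cases twice the number of faces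
minus the number of curves drops by one, which balances the one additional vertex in the Euler
condition. -/
theorem card_smoothFace_boundaryCurve :
    (Nat.card (Set.range (T.smoothFace x k)) = Fintype.card T.Face ∧
      Nat.card (BoundaryCurve (T.smoothEdge x k)) = Nat.card (BoundaryCurve T.edge) + 1) ∨
    (Nat.card (Set.range (T.smoothFace x k)) + 1 = Fintype.card T.Face ∧
      Nat.card (BoundaryCurve (T.smoothEdge x k)) + 1 = Nat.card (BoundaryCurve T.edge)) := by
  classical
  have h1 := card_range_ite (T.face (.cross x (k + 1))) (T.face (.cross x (k + 3)))
  have h2 : Nat.card (Set.range (T.smoothFace x k)) = Nat.card (Set.range fun F =>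
      if F = T.face (.cross x (k + 3)) then T.face (.cross x (k + 1)) else F) := by
    have : T.smoothFace x k = fun F =>
        if F = T.face (.cross x (k + 3)) then T.face (.cross x (k + 1)) else F := by
      funext F
      unfold smoothFace
      congr
    rw [this]
  rw [← h2] at h1
  rw [card_boundaryCurve_smoothEdge, card_boundaryCurve T.edge_edge]
  by_cases hF : T.face (.cross x (k + 1)) = T.face (.cross x (k + 3))
  · left
    rw [if_pos hF] at h1
    refine ⟨by omega, ?_⟩
    apply numOrbits_swap_mul_of_eq
    · have : ∀ k : ZMod 4, k + 1 ≠ k + 3 := by decide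
      intro h
      exact this k (Corner.cross.inj h).2
    · exact (boundaryCurve_eq_iff_orbit T.edge_edge).1
        (T.curve_eq_of_face_eq hF (componentMk_eq_of_vertex _ rfl))
  · right
    rw [if_neg hF] at h1
    refine ⟨by omega, ?_⟩
    apply numOrbits_swap_mul_of_ne
    intro h
    exact hF (congrArg T.curveFace ((boundaryCurve_eq_iff_orbit T.edge_edge).2 h))

open Classical in
/-- The smoothing of a crossing. -/
noncomputable def smoothing : TangleDiagram g where
  Crossing := {y // y ≠ x}
  Bivalent := T.Bivalent ⊕ Bool
  Face := Set.range (T.smoothFace x k)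
  edge := T.smoothEdge x k
  edge_edge := T.smoothEdge_smoothEdge x k
  edge_ne d h := T.edge_ne (unsmoothDart x k d) (by rw [← unsmoothDart_smoothEdge, h])
  face := T.smoothFaceMap x k
  face_consecutive := T.smoothFaceMap_consecutive x k
  face_surjective := by
    rintro ⟨_, F, rfl⟩
    obtain ⟨c, rfl⟩ := T.face_surjective F
    obtain ⟨c, rfl⟩ := (unsmoothCorner_bijective x k).2 c
    exact ⟨c, rfl⟩
  connected := T.smoothFaceMap_connected x k
  euler := by
    refine (congrArg₂ (· + ·) rfl (sum_euler_all _)).trans ?_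
    have h1 := T.card_smoothFace_boundaryCurve x k
    have h2 := T.euler_count
    have h3 : Fintype.card {y // y ≠ x} + 1 = Fintype.card T.Crossing := by
      rw [Fintype.card_subtype_compl, Fintype.card_subtype_eq]
      have : 0 < Fintype.card T.Crossing := Fintype.card_pos_iff.2 ⟨x⟩
      omega
    rw [Nat.card_congr (unsmoothDartEquiv x k), Fintype.card_sum, Fintype.card_bool]
    push_cast
    omega

theorem isSmoothing_smoothing : T.IsSmoothing x k (T.smoothing x k) := by
  have hi : ∀ (d : Dart _ (T.Bivalent ⊕ Bool) g) d', unsmoothDart x k d = d' → (unsmoothDartEquiv x k).symm d' = d := by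
    rintro d _ rfl
    exact (unsmoothDartEquiv (V := T.Bivalent) (g := g) x k).symm_apply_apply d
  have hk : ∀ k, k + smoothIndex false 0 = k ∧ k + smoothIndex false 1 = k + 1 ∧
    k + smoothIndex true 0 = k + 2 ∧ k + smoothIndex true 1 = k + 3 := by decide
  obtain ⟨h0, h1, h2, h3⟩ := hk k
  have hl : ∀ d, (T.smoothing x k).face ((unsmoothDartEquiv x k).symm d).left
      = Set.rangeFactorization (T.smoothFace x k) (T.face d.left) := by
    intro d
    obtain ⟨d, rfl⟩ := (unsmoothDart_bijective x k).2 d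
    rw [hi d _ rfl]
    apply Subtype.ext
    change T.smoothFace x k (T.face (unsmoothCorner x k d.left)) = _
    rw [unsmoothCorner_left]
    rfl
  have he : ∀ d, (T.smoothing x k).edge ((unsmoothDartEquiv x k).symm d)
      = (unsmoothDartEquiv x k).symm (T.edge d) := by
    intro d
    obtain ⟨d, rfl⟩ := (unsmoothDart_bijective x k).2 d
    rw [hi d _ rfl]
    rfl
  exact ⟨Equiv.refl _, Equiv.refl _, Set.rangeFactorization (T.smoothFace x k),
    (unsmoothDartEquiv x k).symm, Set.rangeFactorization_surjective,
    fun F F' => by rw [← T.smoothFace_eq_iff x k]; exact Subtype.ext_iff,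
    fun y i => hi (.cross y i) _ rfl, fun v i => hi (.biv (.inl v) i) _ rfl,
    hi (.biv (.inr false) 0) _ (congrArg _ h0), hi (.biv (.inr false) 1) _ (congrArg _ h1),
    hi (.biv (.inr true) 0) _ (congrArg _ h2), hi (.biv (.inr true) 1) _ (congrArg _ h3),
    fun d _ => he d, fun i => hi (.bdry i) _ rfl, hl, fun j => rfl⟩

theorem card_crossing_smoothing :
    Fintype.card (T.smoothing x k).Crossing < Fintype.card T.Crossing := by
  classical
  exact Fintype.card_subtype_lt (x := x) (by simp)

end TangleDiagram

/-! ### Maps of darts and corners -/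

section Maps

variable {X V X' V' : Type} {g : ℕ}

/-- The map of darts given by maps of the vertices and rotations of the numberings. -/
def dartMap (eX : X → X') (f : V → V') (r : X → ZMod 4) (s : V → ZMod 2) :
    Dart X V g → Dart X' V' g
  | .cross x i => .cross (eX x) (i + r x)
  | .biv v i => .biv (f v) (i + s v)
  | .bdry i => .bdry i

/-- The map of corners given by maps of the vertices and rotations of the numberings. -/
def cornerMap (eX : X → X') (f : V → V') (r : X → ZMod 4) (s : V → ZMod 2) :
    Corner X V g → Corner X' V' g
  | .cross x i => .cross (eX x) (i + r x)
  | .biv v i => .biv (f v) (i + s v)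
  | .arc j => .arc j

section

variable {eX : X → X'} {f : V → V'} {r : X → ZMod 4} {s : V → ZMod 2}

theorem cornerMap_left (d : Dart X V g) :
    cornerMap eX f r s d.left = (dartMap eX f r s d).left := by
  cases d <;> rfl

theorem cornerMap_right (d : Dart X V g) :
    cornerMap eX f r s d.right = (dartMap eX f r s d).right := by
  cases d <;> simp only [cornerMap, dartMap, Dart.right, sub_add_eq_add_sub]

theorem dartMap_injective (hX : Function.Injective eX) (hf : Function.Injective f) :
    Function.Injective (dartMap (g := g) eX f r s) := by
  rintro (⟨x, i⟩ | ⟨v, i⟩ | i) (⟨x', i'⟩ | ⟨v', i'⟩ | i') h <;>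
    simp only [dartMap, Dart.cross.injEq, Dart.biv.injEq, Dart.bdry.injEq, reduceCtorEq,
      hX.eq_iff, hf.eq_iff] at h
  · obtain ⟨rfl, h⟩ := h; rw [add_left_injective _ h]
  · obtain ⟨rfl, h⟩ := h; rw [add_left_injective _ h]
  · rw [h]

theorem dartMap_surjective (hX : Function.Surjective eX) (hf : Function.Surjective f) :
    Function.Surjective (dartMap (g := g) eX f r s) := by
  rintro (⟨x, i⟩ | ⟨v, i⟩ | i)
  · obtain ⟨x, rfl⟩ := hX x
    exact ⟨.cross x (i - r x), by simp [dartMap]⟩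
  · obtain ⟨v, rfl⟩ := hf v
    exact ⟨.biv v (i - s v), by simp [dartMap]⟩
  · exact ⟨.bdry i, rfl⟩

theorem cornerMap_injective (hX : Function.Injective eX) (hf : Function.Injective f) :
    Function.Injective (cornerMap (g := g) eX f r s) := by
  rintro (⟨x, i⟩ | ⟨v, i⟩ | i) (⟨x', i'⟩ | ⟨v', i'⟩ | i') h <;>
    simp only [cornerMap, Corner.cross.injEq, Corner.biv.injEq, Corner.arc.injEq, reduceCtorEq,
      hX.eq_iff, hf.eq_iff] at h
  · obtain ⟨rfl, h⟩ := h; rw [add_left_injective _ h]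
  · obtain ⟨rfl, h⟩ := h; rw [add_left_injective _ h]
  · rw [h]

theorem cornerMap_surjective (hX : Function.Surjective eX) (hf : Function.Surjective f) :
    Function.Surjective (cornerMap (g := g) eX f r s) := by
  rintro (⟨x, i⟩ | ⟨v, i⟩ | i)
  · obtain ⟨x, rfl⟩ := hX x
    exact ⟨.cross x (i - r x), by simp [cornerMap]⟩
  · obtain ⟨v, rfl⟩ := hf v
    exact ⟨.biv v (i - s v), by simp [cornerMap]⟩
  · exact ⟨.arc i, rfl⟩

theorem cornerMap_vertex (hX : Function.Injective eX) (hf : Function.Injective f)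
    {c c' : Corner X V g} : (cornerMap eX f r s c).vertex = (cornerMap eX f r s c').vertex ↔
      c.vertex = c'.vertex := by
  cases c <;> cases c' <;> simp [cornerMap, Corner.vertex, hX.eq_iff, hf.eq_iff]

variable {edge : Dart X V g → Dart X V g} {edge' : Dart X' V' g → Dart X' V' g}

/-- A bijection of the darts compatible with the edges gives a bijection of the curves. -/
theorem exists_curveEquiv_of_bijective (hX : Function.Bijective eX) (hf : Function.Bijective f)
    (he : ∀ d, edge' (dartMap eX f r s d) = dartMap eX f r s (edge d)) :
    ∃ Θ : BoundaryCurve edge ≃ BoundaryCurve edge', ∀ c,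
      Θ (Quot.mk _ c) = Quot.mk _ (cornerMap eX f r s c) := by
  let e : Corner X V g ≃ Corner X' V' g := Equiv.ofBijective (cornerMap eX f r s)
    ⟨cornerMap_injective hX.1 hf.1, cornerMap_surjective hX.2 hf.2⟩
  refine ⟨quotEquivOfMaps e e.symm ?_ ?_ (fun a => by simp) (fun a => by simp), fun c => rfl⟩
  · rintro _ _ (⟨d⟩ | _)
    · have := Corner.Consecutive.side (edge := edge') (dartMap eX f r s d)
      rw [he, ← cornerMap_left, ← cornerMap_right] at this
      exact Quot.sound this
    · exact Quot.sound .base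
  · rintro _ _ (⟨d⟩ | _)
    · obtain ⟨d, rfl⟩ := dartMap_surjective (g := g) (r := r) (s := s) hX.2 hf.2 d
      rw [he, ← cornerMap_left, ← cornerMap_right]
      change Quot.mk _ (e.symm (e _)) = Quot.mk _ (e.symm (e _))
      rw [Equiv.symm_apply_apply, Equiv.symm_apply_apply]
      exact Quot.sound (.side d)
    · change Quot.mk _ (e.symm (e (.arc 0))) = Quot.mk _ (e.symm (e (.arc (Fin.last g))))
      rw [Equiv.symm_apply_apply, Equiv.symm_apply_apply]
      exact Quot.sound .base

end

/-! Adding a bivalent vertex. -/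

variable (eX : X ≃ X') (eV : Option V ≃ V')

/-- The inclusion of the darts when a bivalent vertex is added. -/
abbrev inclDart : Dart X V g → Dart X' V' g := dartMap eX (fun v => eV (some v)) 0 0

/-- The inclusion of the corners when a bivalent vertex is added. -/
abbrev inclCorner : Corner X V g → Corner X' V' g := cornerMap eX (fun v => eV (some v)) 0 0

theorem some_injective_comp : Function.Injective fun v => eV (some v) :=
  eV.injective.comp (Option.some_injective _)

theorem inclDart_injective : Function.Injective (inclDart (g := g) eX eV) :=
  dartMap_injective eX.injective (some_injective_comp eV)

theorem inclCorner_injective : Function.Injective (inclCorner (g := g) eX eV) :=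
  cornerMap_injective eX.injective (some_injective_comp eV)

variable {eX eV}

theorem inclDart_ne (d : Dart X V g) (i : ZMod 2) : inclDart eX eV d ≠ .biv (eV none) i := by
  cases d <;> simp [dartMap]

theorem inclCorner_ne (c : Corner X V g) (i : ZMod 2) :
    inclCorner eX eV c ≠ .biv (eV none) i := by
  cases c <;> simp [cornerMap]

theorem inclDart_cases (eX : X ≃ X') (eV : Option V ≃ V') (d : Dart X' V' g) :
    (∃ d', d = inclDart eX eV d') ∨ ∃ i, d = .biv (eV none) i := by
  rcases d with ⟨x, i⟩ | ⟨v, i⟩ | i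
  · exact Or.inl ⟨.cross (eX.symm x) i, by simp [dartMap]⟩
  · obtain ⟨_ | v, rfl⟩ := eV.surjective v
    · exact Or.inr ⟨i, rfl⟩
    · exact Or.inl ⟨.biv v i, by simp [dartMap]⟩
  · exact Or.inl ⟨.bdry i, rfl⟩

theorem inclCorner_cases (eX : X ≃ X') (eV : Option V ≃ V') (c : Corner X' V' g) :
    (∃ c', c = inclCorner eX eV c') ∨ ∃ i, c = .biv (eV none) i := by
  rcases c with ⟨x, i⟩ | ⟨v, i⟩ | i
  · exact Or.inl ⟨.cross (eX.symm x) i, by simp [cornerMap]⟩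
  · obtain ⟨_ | v, rfl⟩ := eV.surjective v
    · exact Or.inr ⟨i, rfl⟩
    · exact Or.inl ⟨.biv v i, by simp [cornerMap]⟩
  · exact Or.inl ⟨.arc i, rfl⟩

/-- Extend a function on the darts to the darts of an added bivalent vertex. -/
theorem exists_extend_dart {β : Type*} (eX : X ≃ X') (eV : Option V ≃ V') (f : Dart X V g → β)
    (f0 : ZMod 2 → β) : ∃ F : Dart X' V' g → β, (∀ d, F (inclDart eX eV d) = f d) ∧
      ∀ i, F (.biv (eV none) i) = f0 i := by
  classical
  refine ⟨fun d => if h : ∃ d', d = inclDart eX eV d' then f h.choose else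
    if d = .biv (eV none) 0 then f0 0 else f0 1, ?_, ?_⟩
  · intro d
    have h : ∃ d', inclDart eX eV d = inclDart eX eV d' := ⟨d, rfl⟩
    beta_reduce
    rw [dif_pos h, ← inclDart_injective eX eV h.choose_spec]
  · intro i
    beta_reduce
    rw [dif_neg (by rintro ⟨d, hd⟩; exact inclDart_ne d i hd.symm)]
    have hi : ∀ i : ZMod 2, i = 0 ∨ i = 1 := by decide
    rcases hi i with rfl | rfl
    · exact if_pos rfl
    · exact if_neg (by simp)

/-- Extend a function on the corners to the corners of an added bivalent vertex. -/
theorem exists_extend_corner {β : Type*} (eX : X ≃ X') (eV : Option V ≃ V')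
    (f : Corner X V g → β) (f0 : ZMod 2 → β) : ∃ F : Corner X' V' g → β,
      (∀ d, F (inclCorner eX eV d) = f d) ∧ ∀ i, F (.biv (eV none) i) = f0 i := by
  classical
  refine ⟨fun d => if h : ∃ d', d = inclCorner eX eV d' then f h.choose else
    if d = .biv (eV none) 0 then f0 0 else f0 1, ?_, ?_⟩
  · intro d
    have h : ∃ d', inclCorner eX eV d = inclCorner eX eV d' := ⟨d, rfl⟩
    beta_reduce
    rw [dif_pos h, ← inclCorner_injective eX eV h.choose_spec]
  · intro i
    beta_reduce
    rw [dif_neg (by rintro ⟨d, hd⟩; exact inclCorner_ne d i hd.symm)]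
    have hi : ∀ i : ZMod 2, i = 0 ∨ i = 1 := by decide
    rcases hi i with rfl | rfl
    · exact if_pos rfl
    · exact if_neg (by simp)

variable (eX eV) (edge : Dart X V g → Dart X V g) (edge' : Dart X' V' g → Dart X' V' g)

/-- The edges after placing a bivalent vertex on the edge of `d`. -/
structure EdgeSubdivision (d : Dart X V g) : Prop where
  apply_of_ne : ∀ c, c ≠ d → c ≠ edge d → edge' (inclDart eX eV c) = inclDart eX eV (edge c)
  apply_self : edge' (inclDart eX eV d) = .biv (eV none) 0
  apply_edge : edge' (inclDart eX eV (edge d)) = .biv (eV none) 1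

/-- The edges after adding a loop with one bivalent vertex. -/
structure EdgeLoop : Prop where
  apply_incl : ∀ c, edge' (inclDart eX eV c) = inclDart eX eV (edge c)
  apply_zero : edge' (.biv (eV none) 0) = .biv (eV none) 1

variable {eX eV edge edge'}

theorem EdgeSubdivision.curve_zero {d : Dart X V g} (hs : EdgeSubdivision eX eV edge edge' d) :
    Quot.mk (Corner.Consecutive edge') (.biv (eV none) 0)
      = Quot.mk (Corner.Consecutive edge') (inclCorner eX eV d.right) := by
  have := Corner.Consecutive.side (edge := edge') (inclDart eX eV d)
  rw [hs.apply_self, ← cornerMap_right] at this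
  exact Quot.sound this

theorem EdgeSubdivision.curve_one {d : Dart X V g} (hs : EdgeSubdivision eX eV edge edge' d) :
    Quot.mk (Corner.Consecutive edge') (.biv (eV none) 1)
      = Quot.mk (Corner.Consecutive edge') (inclCorner eX eV (edge d).right) := by
  have := Corner.Consecutive.side (edge := edge') (inclDart eX eV (edge d))
  rw [hs.apply_edge, ← cornerMap_right] at this
  exact Quot.sound this

theorem zmod_two_sub_one_zero : (0 - 1 : ZMod 2) = 1 := rfl

/-- The two corners of the new vertex lie on the two sides of the subdivided edge, so they only
lengthen existing curves. -/
theorem EdgeSubdivision.exists_curveEquiv {d : Dart X V g} (h : ∀ d, edge (edge d) = d)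
    (h' : ∀ d, edge' (edge' d) = d) (hs : EdgeSubdivision eX eV edge edge' d) :
    ∃ Θ : BoundaryCurve edge ≃ BoundaryCurve edge', ∀ c,
      Θ (Quot.mk _ c) = Quot.mk _ (inclCorner eX eV c) := by
  have hd0 : edge' (.biv (eV none) 0) = inclDart eX eV d := by rw [← hs.apply_self, h']
  have hd1 : edge' (.biv (eV none) 1) = inclDart eX eV (edge d) := by rw [← hs.apply_edge, h']
  have hq0 := hs.curve_zero
  have hq1 := hs.curve_one
  have hr : Quot.mk (Corner.Consecutive edge) d.left = Quot.mk _ (edge d).right := by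
    have := Corner.Consecutive.side (edge := edge) (edge d)
    rw [h] at this
    exact Quot.sound this
  have e0 : Quot.mk (Corner.Consecutive edge') (inclCorner eX eV (edge d).left)
      = Quot.mk (Corner.Consecutive edge') (.biv (eV none) 0) := by
    have := Corner.Consecutive.side (edge := edge') (.biv (eV none) 1)
    rw [hd1, ← cornerMap_left] at this
    exact Quot.sound this
  have e1 : Quot.mk (Corner.Consecutive edge') (inclCorner eX eV d.left)
      = Quot.mk (Corner.Consecutive edge') (.biv (eV none) 1) := by
    have := Corner.Consecutive.side (edge := edge') (.biv (eV none) 0)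
    rw [hd0, ← cornerMap_left] at this
    exact Quot.sound this
  have hf : ∀ a b, Corner.Consecutive edge a b →
      Quot.mk (Corner.Consecutive edge') (inclCorner eX eV a) = Quot.mk _ (inclCorner eX eV b) := by
    rintro _ _ (⟨c⟩ | _)
    · by_cases hc : c = d
      · subst hc; exact e0.trans hq0
      by_cases hc' : c = edge d
      · subst hc'; rw [h]; exact e1.trans hq1
      · have := Corner.Consecutive.side (edge := edge') (inclDart eX eV c)
        rw [hs.apply_of_ne c hc hc', ← cornerMap_left, ← cornerMap_right] at this
        exact Quot.sound this
    · exact Quot.sound .base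
  obtain ⟨F, hF, hF0⟩ := exists_extend_corner eX eV (Quot.mk (Corner.Consecutive edge))
    (fun i => if i = 0 then Quot.mk _ d.right else Quot.mk _ (edge d).right)
  have hF' : ∀ a b, Corner.Consecutive edge' a b → F a = F b := by
    rintro _ _ (⟨c⟩ | _)
    · rcases inclDart_cases eX eV c with ⟨c, rfl⟩ | ⟨i, rfl⟩
      · by_cases hc : c = d
        · subst hc
          rw [hs.apply_self, ← cornerMap_right, hF]
          exact hF0 0
        by_cases hc' : c = edge d
        · subst hc'
          rw [hs.apply_edge, ← cornerMap_right, hF]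
          exact hF0 1
        · rw [hs.apply_of_ne c hc hc', ← cornerMap_left, ← cornerMap_right, hF, hF]
          exact Quot.sound (.side c)
      · have hi : ∀ i : ZMod 2, i = 0 ∨ i = 1 := by decide
        rcases hi i with rfl | rfl
        · rw [hd0, ← cornerMap_left, hF, hr]
          exact (hF0 1).symm
        · rw [hd1, ← cornerMap_left, hF]
          exact (Quot.sound (.side d)).trans (hF0 0).symm
    · exact (hF (.arc 0)).trans ((Quot.sound .base).trans (hF (.arc (Fin.last g))).symm)
  refine ⟨⟨Quot.lift (fun a => Quot.mk _ (inclCorner eX eV a)) hf, Quot.lift F hF', ?_, ?_⟩,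
    fun c => rfl⟩
  · rintro ⟨c⟩; exact hF c
  · rintro ⟨c⟩
    rcases inclCorner_cases eX eV c with ⟨c, rfl⟩ | ⟨i, rfl⟩
    · change Quot.lift _ hf (F _) = _
      rw [hF]
    · change Quot.lift _ hf (F _) = _
      rw [hF0]
      have hi : ∀ i : ZMod 2, i = 0 ∨ i = 1 := by decide
      rcases hi i with rfl | rfl
      · rw [if_pos rfl]; exact hq0.symm
      · rw [if_neg one_ne_zero]; exact hq1.symm

/-- A loop with a single vertex has two sides, each a new curve with a single corner; they are
indexed by the corners in `ZMod 2`. -/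
theorem EdgeLoop.exists_curveEquiv (h' : ∀ d, edge' (edge' d) = d)
    (hs : EdgeLoop eX eV edge edge') :
    ∃ Θ : BoundaryCurve edge ⊕ ZMod 2 ≃ BoundaryCurve edge',
      (∀ c, Θ (.inl (Quot.mk _ c)) = Quot.mk _ (inclCorner eX eV c)) ∧
      ∀ i, Θ (.inr i) = Quot.mk _ (.biv (eV none) i) := by
  have hs1 : edge' (.biv (eV none) 1) = .biv (eV none) 0 := by rw [← hs.apply_zero, h']
  have hf : ∀ a b, Corner.Consecutive edge a b →
      Quot.mk (Corner.Consecutive edge') (inclCorner eX eV a) = Quot.mk _ (inclCorner eX eV b) := by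
    rintro _ _ (⟨c⟩ | _)
    · have := Corner.Consecutive.side (edge := edge') (inclDart eX eV c)
      rw [hs.apply_incl c, ← cornerMap_left, ← cornerMap_right] at this
      exact Quot.sound this
    · exact Quot.sound .base
  obtain ⟨F, hF, hF0⟩ := exists_extend_corner (β := BoundaryCurve edge ⊕ ZMod 2) eX eV
    (fun c => .inl (Quot.mk _ c)) Sum.inr
  have hF' : ∀ a b, Corner.Consecutive edge' a b → F a = F b := by
    rintro _ _ (⟨c⟩ | _)
    · rcases inclDart_cases eX eV c with ⟨c, rfl⟩ | ⟨i, rfl⟩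
      · rw [hs.apply_incl c, ← cornerMap_left, ← cornerMap_right, hF, hF]
        exact congrArg Sum.inl (Quot.sound (.side c))
      · have hi : ∀ i : ZMod 2, i = 0 ∨ i = 1 := by decide
        rcases hi i with rfl | rfl
        · rw [hs.apply_zero]; rfl
        · rw [hs1]; rfl
    · exact (hF (.arc 0)).trans ((congrArg Sum.inl (Quot.sound .base)).trans
        (hF (.arc (Fin.last g))).symm)
  let G : BoundaryCurve edge ⊕ ZMod 2 → BoundaryCurve edge' :=
    Sum.elim (Quot.lift (fun a => Quot.mk _ (inclCorner eX eV a)) hf)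
      fun i => Quot.mk _ (.biv (eV none) i)
  refine ⟨⟨G, Quot.lift F hF', ?_, ?_⟩, fun c => rfl, fun i => rfl⟩
  · rintro (⟨⟨c⟩⟩ | i)
    · exact hF c
    · exact hF0 i
  · rintro ⟨c⟩
    rcases inclCorner_cases eX eV c with ⟨c, rfl⟩ | ⟨i, rfl⟩
    · change G (F _) = _
      rw [hF]
      rfl
    · change G (F _) = _
      rw [hF0]
      rfl

end Maps

/-! ### Removing a bivalent vertex -/

section RemoveEdge

variable {X V X' V' : Type} {g : ℕ} {eX : X ≃ X'} {eV : Option V ≃ V'}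
  {edge' : Dart X' V' g → Dart X' V' g}

theorem exists_edgeSubdivision (h' : ∀ d, edge' (edge' d) = d) (hne : ∀ d, edge' d ≠ d)
    (h01 : edge' (.biv (eV none) 0) ≠ .biv (eV none) 1) :
    ∃ (edge : Dart X V g → Dart X V g) (d : Dart X V g), (∀ d, edge (edge d) = d) ∧
      (∀ d, edge d ≠ d) ∧ EdgeSubdivision eX eV edge edge' d := by
  classical
  set b0 : Dart X' V' g := .biv (eV none) 0 with hb0
  set b1 : Dart X' V' g := .biv (eV none) 1 with hb1
  have hb : b0 ≠ b1 := by simp [b0, b1]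
  have h10 : edge' b1 ≠ b0 := fun h => h01 (by rw [← h, h'])
  -- The new pairing passes straight through the erased vertex: an edge arriving at one of its darts
  -- continues along the edge of the other one. By `h01` that edge does not lead back to the vertex.
  let f : Dart X' V' g → Dart X' V' g := fun e =>
    if e = b0 then edge' b1 else if e = b1 then edge' b0 else e
  have f0 : f b0 = edge' b1 := if_pos rfl
  have f1 : f b1 = edge' b0 := (if_neg hb.symm).trans (if_pos rfl)
  have f2 : ∀ e, e ≠ b0 → e ≠ b1 → f e = e := fun e h0 h1 => (if_neg h0).trans (if_neg h1)
  have hincl : ∀ e, e ≠ b0 → e ≠ b1 → ∃ c, inclDart eX eV c = e := by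
    intro e h0 h1
    rcases inclDart_cases eX eV e with ⟨c, rfl⟩ | ⟨i, rfl⟩
    · exact ⟨c, rfl⟩
    · have hi : ∀ i : ZMod 2, i = 0 ∨ i = 1 := by decide
      rcases hi i with rfl | rfl
      exacts [absurd rfl h0, absurd rfl h1]
  have hex : ∀ d, ∃ c, inclDart eX eV c = f (edge' (inclDart eX eV d)) := by
    intro d
    by_cases h0 : edge' (inclDart eX eV d) = b0
    · rw [h0, f0]; exact hincl _ h10 (hne _)
    by_cases h1 : edge' (inclDart eX eV d) = b1
    · rw [h1, f1]; exact hincl _ (hne _) h01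
    · rw [f2 _ h0 h1]; exact hincl _ h0 h1
  choose edge hedge using hex
  obtain ⟨d, hd⟩ := hincl (edge' b0) (hne _) h01
  have inj := inclDart_injective (g := g) eX eV
  have hd1 : inclDart eX eV (edge d) = edge' b1 := by rw [hedge, hd, h', f0]
  refine ⟨edge, d, fun c => inj ?_, fun c hc => ?_, ?_, ?_, ?_⟩
  · rw [hedge, hedge]
    by_cases h0 : edge' (inclDart eX eV c) = b0
    · rw [h0, f0, h', f1, ← h0, h']
    by_cases h1 : edge' (inclDart eX eV c) = b1
    · rw [h1, f1, h', f0, ← h1, h']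
    · rw [f2 _ h0 h1, h', f2 _ (inclDart_ne _ _) (inclDart_ne _ _)]
  · have h2 := hedge c
    rw [hc] at h2
    by_cases h0 : edge' (inclDart eX eV c) = b0
    · rw [h0, f0] at h2
      rw [h2, h'] at h0
      exact hb h0.symm
    by_cases h1 : edge' (inclDart eX eV c) = b1
    · rw [h1, f1] at h2
      rw [h2, h'] at h1
      exact hb h1
    · rw [f2 _ h0 h1] at h2
      exact hne _ h2.symm
  · intro c h0 h1
    rw [hedge, f2]
    · intro h
      exact h0 (inj (by rw [hd, ← h, h']))
    · intro h
      exact h1 (inj (by rw [hd1, ← h, h']))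
  · rw [hd, h']
  · rw [hd1, h']

theorem exists_edgeLoop (h' : ∀ d, edge' (edge' d) = d) (hne : ∀ d, edge' d ≠ d)
    (h01 : edge' (.biv (eV none) 0) = .biv (eV none) 1) :
    ∃ edge : Dart X V g → Dart X V g, (∀ d, edge (edge d) = d) ∧
      (∀ d, edge d ≠ d) ∧ EdgeLoop eX eV edge edge' := by
  have h10 : edge' (.biv (eV none) 1) = .biv (eV none) 0 := by rw [← h01, h']
  have hex : ∀ d, ∃ c, inclDart eX eV c = edge' (inclDart eX eV d) := by
    intro d
    rcases inclDart_cases eX eV (edge' (inclDart eX eV d)) with ⟨c, hc⟩ | ⟨i, hi⟩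
    · exact ⟨c, hc.symm⟩
    · have h2 : inclDart eX eV d = edge' (.biv (eV none) i) := by rw [← hi, h']
      have hi : ∀ i : ZMod 2, i = 0 ∨ i = 1 := by decide
      rcases hi i with rfl | rfl
      · rw [h01] at h2; exact absurd h2 (inclDart_ne _ _)
      · rw [h10] at h2; exact absurd h2 (inclDart_ne _ _)
  choose edge hedge using hex
  have inj := inclDart_injective (g := g) eX eV
  exact ⟨edge, fun c => inj (by rw [hedge, hedge, h']),
    fun c hc => hne (inclDart eX eV c) (by rw [← hedge, hc]), fun c => (hedge c).symm, h01⟩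

end RemoveEdge

/-! ### Erasing vertices and circles from a diagram. -/

namespace TangleDiagram

variable {g : ℕ}

theorem card_lt_of_option_equiv {V V' : Type} [Fintype V] [Fintype V'] (e : Option V ≃ V') :
    Fintype.card V' = Fintype.card V + 1 := by
  rw [← Fintype.card_congr e, Fintype.card_option]

theorem card_dart_option {X V X' V' : Type} [Fintype X] [Fintype V] [Fintype X'] [Fintype V']
    (eX : X ≃ X') (eV : Option V ≃ V') :
    Nat.card (Dart X' V' g) = Nat.card (Dart X V g) + 2 := by
  rw [card_dart, card_dart, card_lt_of_option_equiv eV, Fintype.card_congr eX]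
  ring

/-- A bivalent vertex that is not alone on a closed loop can be erased. -/
theorem exists_isSubdivision (T : TangleDiagram g) (v : T.Bivalent)
    (hv : T.edge (.biv v 0) ≠ .biv v 1) : ∃ T' : TangleDiagram g, T'.IsSubdivision T ∧
      Fintype.card T'.Crossing = Fintype.card T.Crossing ∧
      Fintype.card T'.Bivalent < Fintype.card T.Bivalent := by
  classical
  let eX : T.Crossing ≃ T.Crossing := Equiv.refl _
  let eV : Option {w // w ≠ v} ≃ T.Bivalent := Equiv.optionSubtypeNe v
  have hv : T.edge (.biv (eV none) 0) ≠ .biv (eV none) 1 := hv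
  obtain ⟨edge, d, h, hne, hs⟩ := exists_edgeSubdivision (eX := eX) T.edge_edge T.edge_ne hv
  obtain ⟨Θ, hΘ⟩ := hs.exists_curveEquiv h T.edge_edge
  have hf0 : T.face (.biv (eV none) 0) = T.face (inclCorner eX eV d.right) :=
    congrArg T.curveFace hs.curve_zero
  have hf1 : T.face (.biv (eV none) 1) = T.face (inclCorner eX eV (edge d).right) :=
    congrArg T.curveFace hs.curve_one
  have hi : ∀ i : ZMod 2, i = 0 ∨ i = 1 := by decide
  have hcons : ∀ c c', Corner.Consecutive edge c c' →
      T.face (inclCorner eX eV c) = T.face (inclCorner eX eV c') := by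
    intro c c' hc
    have := congrArg Θ (Quot.sound hc)
    rw [hΘ, hΘ] at this
    exact congrArg T.curveFace this
  let r := fun a b : Corner T.Crossing {w // w ≠ v} g => a.vertex = b.vertex ∨
    T.face (inclCorner eX eV a) = T.face (inclCorner eX eV b)
  obtain ⟨F, hF, hF0⟩ := exists_extend_corner eX eV (Quot.mk r)
    (fun i => if i = 0 then Quot.mk _ d.right else Quot.mk _ (edge d).right)
  have hF1 : ∀ a, ∃ c, F a = Quot.mk r c ∧ T.face a = T.face (inclCorner eX eV c) := by
    intro a
    rcases inclCorner_cases eX eV a with ⟨c, rfl⟩ | ⟨i, rfl⟩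
    · exact ⟨c, hF c, rfl⟩
    · rcases hi i with rfl | rfl
      · exact ⟨d.right, hF0 0, hf0⟩
      · exact ⟨(edge d).right, hF0 1, hf1⟩
  -- Connections through the erased vertex are replaced: the faces on its two sides still meet at
  -- the vertex from which `d` starts.
  have h01 : ∀ i, F (.biv (eV none) i) = Quot.mk r d.right := by
    intro i
    rcases hi i with rfl | rfl
    · exact hF0 0
    · refine (hF0 1).trans ?_
      rw [if_neg one_ne_zero]
      have h1 : Quot.mk r (edge d).right = Quot.mk r d.left := by
        have := Corner.Consecutive.side (edge := edge) (edge d)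
        rw [h] at this
        exact (Quot.sound (r := r) (Or.inr (hcons _ _ this))).symm
      exact h1.trans (Quot.sound (Or.inl d.left_vertex))
  have hconn : ∀ c c', Quot.mk r c = Quot.mk r c' := by
    intro c c'
    rw [← hF, ← hF]
    have := T.connected (inclCorner eX eV c) (inclCorner eX eV c')
    generalize inclCorner eX eV c = p at this ⊢
    generalize inclCorner eX eV c' = q at this ⊢
    induction this with
    | rel a b hab =>
      rcases hab with hab | hab
      · rcases inclCorner_cases eX eV a with ⟨a, rfl⟩ | ⟨i, rfl⟩ <;>
          rcases inclCorner_cases eX eV b with ⟨b, rfl⟩ | ⟨j, rfl⟩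
        · rw [hF, hF]
          exact Quot.sound (Or.inl
            ((cornerMap_vertex eX.injective (some_injective_comp eV)).1 hab))
        · exfalso
          cases a <;> simp [cornerMap, Corner.vertex] at hab
        · exfalso
          cases b <;> simp [cornerMap, Corner.vertex] at hab
        · rw [h01, h01]
      · obtain ⟨a', h1, h2⟩ := hF1 a
        obtain ⟨b', h3, h4⟩ := hF1 b
        rw [h1, h3]
        exact Quot.sound (Or.inr (by rw [← h2, ← h4, hab]))
    | refl a => rfl
    | symm a b _ ih => exact ih.symm
    | trans a b c _ _ ih1 ih2 => exact ih1.trans ih2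
  let T' : TangleDiagram g :=
    { Crossing := T.Crossing
      Bivalent := {w // w ≠ v}
      Face := T.Face
      edge := edge
      edge_edge := h
      edge_ne := hne
      face := fun c => T.face (inclCorner eX eV c)
      face_consecutive := hcons
      face_surjective := by
        intro G
        obtain ⟨a, rfl⟩ := T.face_surjective G
        obtain ⟨c, -, hc⟩ := hF1 a
        exact ⟨c, hc.symm⟩
      connected := fun c c' => Quot.eqvGen_exact (hconn c c')
      euler := by
        -- One vertex and one edge disappear, while faces and curves stay.
        refine (congrArg₂ (· + ·) rfl (sum_euler_all _)).trans ?_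
        have h1 := T.euler_count
        have h2 := card_dart_option (g := g) eX eV
        have h3 := card_lt_of_option_equiv eV
        rw [Nat.card_congr Θ, Nat.card_eq_fintype_card (α := T.Face)]
        rw [h2, h3] at h1
        push_cast at h1 ⊢
        omega }
  have hcr : Fintype.card {w // w ≠ v} < Fintype.card T.Bivalent :=
    Fintype.card_subtype_lt (x := v) (by simp)
  refine ⟨T', ⟨eX, eV, Equiv.refl _, inclDart eX eV, d, fun x i => by simp [dartMap],
    fun w i => by simp [dartMap], hs.apply_self, hs.apply_edge, ?_, fun i => rfl, ?_,
    fun j => rfl⟩, rfl, hcr⟩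
  · intro c hc
    simp only [Set.mem_insert_iff, Set.mem_singleton_iff, not_or] at hc
    exact hs.apply_of_ne c hc.1 hc.2
  · intro c
    change T.face (inclDart eX eV c).left = T.face (inclCorner eX eV c.left)
    rw [← cornerMap_left]

/-- A circle without crossings that bounds an empty disk can be erased. -/
theorem exists_isLoopAddition (T : TangleDiagram g) (v : T.Bivalent)
    (hv : T.edge (.biv v 0) = .biv v 1)
    (hD : ∀ c, T.face c = T.face (.biv v 0) → c = .biv v 0) :
    ∃ T' : TangleDiagram g, T'.IsLoopAddition T ∧
      Fintype.card T'.Crossing = Fintype.card T.Crossing ∧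
      Fintype.card T'.Bivalent < Fintype.card T.Bivalent := by
  classical
  let eX : T.Crossing ≃ T.Crossing := Equiv.refl _
  let eV : Option {w // w ≠ v} ≃ T.Bivalent := Equiv.optionSubtypeNe v
  have hv : T.edge (.biv (eV none) 0) = .biv (eV none) 1 := hv
  have hD : ∀ c, T.face c = T.face (.biv (eV none) 0) → c = .biv (eV none) 0 := hD
  obtain ⟨edge, h, hne, hs⟩ := exists_edgeLoop (eX := eX) T.edge_edge T.edge_ne hv
  obtain ⟨Θ, hΘ, -⟩ := hs.exists_curveEquiv T.edge_edge
  have hi : ∀ i : ZMod 2, i = 0 ∨ i = 1 := by decide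
  let D : T.Face := T.face (.biv (eV none) 0)
  have hinD : ∀ c, T.face (inclCorner eX eV c) ≠ D := fun c hc => inclCorner_ne _ _ (hD _ hc)
  have hcons : ∀ c c', Corner.Consecutive edge c c' →
      T.face (inclCorner eX eV c) = T.face (inclCorner eX eV c') := by
    intro c c' hc
    have := congrArg (fun z => Θ (.inl z)) (Quot.sound hc)
    simp only [hΘ] at this
    exact congrArg T.curveFace this
  have h1D : T.face (.biv (eV none) 1) ≠ D := fun hc => by simpa using hD _ hc
  -- The face outside the circle has a further corner not on the circle; otherwise the circle would
  -- be disconnected from the outer vertex.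
  obtain ⟨c1, hc1⟩ : ∃ c, T.face (.biv (eV none) 1) = T.face (inclCorner eX eV c) := by
    by_contra! hno
    have key : ∀ a b, Relation.EqvGen (fun a b => a.vertex = b.vertex ∨ T.face a = T.face b) a b →
        (a.vertex = some (.inr v) ↔ b.vertex = some (.inr v)) := by
      have hw : ∀ i, (Corner.biv (eV none) i : Corner T.Crossing T.Bivalent g).vertex
          = some (.inr v) := fun i => rfl
      have hw' : ∀ c, (inclCorner (g := g) eX eV c).vertex ≠ some (.inr v) := by
        intro c hc
        cases c <;> simp [cornerMap, Corner.vertex, eV] at hc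
        rename_i w _
        exact w.2 hc
      intro a b hab
      induction hab with
      | rel a b hab =>
        rcases hab with hab | hab
        · rw [hab]
        · rcases inclCorner_cases eX eV a with ⟨a, rfl⟩ | ⟨i, rfl⟩ <;>
            rcases inclCorner_cases eX eV b with ⟨b, rfl⟩ | ⟨j, rfl⟩
          · simp [hw']
          · exfalso
            rcases hi j with rfl | rfl
            exacts [hinD _ hab, hno _ hab.symm]
          · exfalso
            rcases hi i with rfl | rfl
            exacts [hinD _ hab.symm, hno _ hab]
          · simp only [hw]
      | refl a => rfl
      | symm a b _ ih => exact ih.symm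
      | trans a b c _ _ ih1 ih2 => exact ih1.trans ih2
    have := (key _ _ (T.connected (.biv v 0) (.arc 0))).1 rfl
    simp [Corner.vertex] at this
  let face : Corner T.Crossing {w // w ≠ v} g → {G // G ≠ D} :=
    fun c => ⟨T.face (inclCorner eX eV c), hinD c⟩
  let r := fun a b : Corner T.Crossing {w // w ≠ v} g => a.vertex = b.vertex ∨ face a = face b
  obtain ⟨F, hF, hF0⟩ := exists_extend_corner eX eV (Quot.mk r) (fun _ => Quot.mk _ c1)
  have hF1 : ∀ a, T.face a ≠ D → ∃ c, F a = Quot.mk r c ∧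
      T.face a = T.face (inclCorner eX eV c) := by
    intro a ha
    rcases inclCorner_cases eX eV a with ⟨c, rfl⟩ | ⟨i, rfl⟩
    · exact ⟨c, hF c, rfl⟩
    · rcases hi i with rfl | rfl
      · exact absurd rfl ha
      · exact ⟨c1, hF0 1, hc1⟩
  have hconn : ∀ c c', Quot.mk r c = Quot.mk r c' := by
    intro c c'
    rw [← hF, ← hF]
    have := T.connected (inclCorner eX eV c) (inclCorner eX eV c')
    generalize inclCorner eX eV c = p at this ⊢
    generalize inclCorner eX eV c' = q at this ⊢
    induction this with
    | rel a b hab =>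
      rcases hab with hab | hab
      · rcases inclCorner_cases eX eV a with ⟨a, rfl⟩ | ⟨i, rfl⟩ <;>
          rcases inclCorner_cases eX eV b with ⟨b, rfl⟩ | ⟨j, rfl⟩
        · rw [hF, hF]
          exact Quot.sound (Or.inl
            ((cornerMap_vertex eX.injective (some_injective_comp eV)).1 hab))
        · exfalso
          cases a <;> simp [cornerMap, Corner.vertex] at hab
        · exfalso
          cases b <;> simp [cornerMap, Corner.vertex] at hab
        · rw [hF0, hF0]
      · by_cases ha : T.face a = D
        · rw [hD a ha, hD b (hab.symm.trans ha)]
        obtain ⟨a', h1, h2⟩ := hF1 a ha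
        obtain ⟨b', h3, h4⟩ := hF1 b (hab ▸ ha)
        rw [h1, h3]
        exact Quot.sound (Or.inr (Subtype.ext (h2.symm.trans (hab.trans h4))))
    | refl a => rfl
    | symm a b _ ih => exact ih.symm
    | trans a b c _ _ ih1 ih2 => exact ih1.trans ih2
  let T' : TangleDiagram g :=
    { Crossing := T.Crossing
      Bivalent := {w // w ≠ v}
      Face := {G // G ≠ D}
      edge := edge
      edge_edge := h
      edge_ne := hne
      face := face
      face_consecutive := fun c c' hc => Subtype.ext (hcons c c' hc)
      face_surjective := by
        rintro ⟨G, hG⟩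
        obtain ⟨a, rfl⟩ := T.face_surjective G
        obtain ⟨c, -, hc⟩ := hF1 a hG
        exact ⟨c, Subtype.ext hc.symm⟩
      connected := fun c c' => Quot.eqvGen_exact (hconn c c')
      euler := by
        -- One vertex, one edge, one face and two curves disappear, which leaves the Euler
        -- characteristic unchanged.
        refine (congrArg₂ (· + ·) rfl (sum_euler_all _)).trans ?_
        have h1 := T.euler_count
        have h2 := card_dart_option (g := g) eX eV
        have h3 := card_lt_of_option_equiv eV
        have h4 := card_lt_of_option_equiv (Equiv.optionSubtypeNe D)
        have h5 : Nat.card (BoundaryCurve T.edge) = Nat.card (BoundaryCurve edge) + 2 := by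
          have : Finite (BoundaryCurve edge) := Quot.finite _
          rw [← Nat.card_congr Θ, Nat.card_sum, Nat.card_zmod]
        rw [Nat.card_eq_fintype_card (α := {G // G ≠ D})]
        rw [h2, h3, h4, h5] at h1
        push_cast at h1 ⊢
        omega }
  have hcr : Fintype.card {w // w ≠ v} < Fintype.card T.Bivalent :=
    Fintype.card_subtype_lt (x := v) (by simp)
  refine ⟨T', ⟨⟨T.face (.biv (eV none) 1), h1D⟩, eX, eV, Equiv.optionSubtypeNe D,
    inclDart eX eV, fun x i => by simp [dartMap],
    fun w i => by simp [dartMap], hv, rfl, rfl, fun c _ => hs.apply_incl c, fun i => rfl, ?_,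
    fun j => rfl⟩, rfl, hcr⟩
  intro c
  change T.face (inclDart eX eV c).left = T.face (inclCorner eX eV c.left)
  rw [← cornerMap_left]

/-- Rotating the numbering of the darts at all bivalent vertices. -/
theorem exists_isIso_rotate (T : TangleDiagram g) : ∃ T' : TangleDiagram g, T'.IsIso T ∧
    ∃ eV : T'.Bivalent ≃ T.Bivalent,
      (∀ v, T.edge (.biv (eV v) 0) = .biv (eV v) 1 → T'.edge (.biv v 0) = .biv v 1) ∧
      ∀ v, (∀ c, T.face c = T.face (.biv (eV v) 1) → c = .biv (eV v) 1) →
        ∀ c, T'.face c = T'.face (.biv v 0) → c = .biv v 0 := by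
  -- The rotation by 1 exchanges the two corners of each bivalent vertex, so an empty disk at corner
  -- `1` moves to corner `0`, where `IsLoopAddition` expects it.
  let ι : Dart T.Crossing T.Bivalent g → Dart T.Crossing T.Bivalent g := dartMap id id 0 1
  let ψ : Corner T.Crossing T.Bivalent g → Corner T.Crossing T.Bivalent g := cornerMap id id 0 1
  have h2 : ∀ i : ZMod 2, i + 1 + 1 = i := by decide
  have hι : ∀ d, ι (ι d) = d := by
    intro d; cases d <;> simp [ι, dartMap, h2]
  have hψ : ∀ c, ψ (ψ c) = c := by
    intro d; cases d <;> simp [ψ, cornerMap, h2]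
  have hv : ∀ c c', (ψ c).vertex = (ψ c').vertex ↔ c.vertex = c'.vertex := fun c c' =>
    cornerMap_vertex Function.injective_id Function.injective_id
  let edge := fun d => ι (T.edge (ι d))
  obtain ⟨Θ, hΘ⟩ := exists_curveEquiv_of_bijective (edge := edge) (edge' := T.edge) (r := 0) (s := 1)
    Function.bijective_id Function.bijective_id (fun d => by
      change _ = ι (ι _)
      rw [hι])
  have hcons : ∀ c c', Corner.Consecutive edge c c' → T.face (ψ c) = T.face (ψ c') := by
    intro c c' hc
    have := congrArg Θ (Quot.sound hc)
    rw [hΘ, hΘ] at this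
    exact congrArg T.curveFace this
  let T' : TangleDiagram g :=
    { Crossing := T.Crossing
      Bivalent := T.Bivalent
      Face := T.Face
      edge := edge
      edge_edge := fun d => by simp only [edge, hι, T.edge_edge]
      edge_ne := fun d hd => T.edge_ne (ι d) (by rw [← hι (T.edge _)]; exact congrArg ι hd)
      face := fun c => T.face (ψ c)
      face_consecutive := hcons
      face_surjective := fun G => by
        obtain ⟨c, rfl⟩ := T.face_surjective G
        exact ⟨ψ c, congrArg T.face (hψ c)⟩
      connected := fun c c' => by
        apply Quot.eqvGen_exact
        have key : ∀ a b, Relation.EqvGen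
            (fun a b => a.vertex = b.vertex ∨ T.face a = T.face b) a b →
            Quot.mk (fun a b => a.vertex = b.vertex ∨ T.face (ψ a) = T.face (ψ b)) (ψ a)
              = Quot.mk _ (ψ b) := by
          intro a b hab
          induction hab with
          | rel a b hab =>
            refine Quot.sound ?_
            rwa [hψ, hψ, hv]
          | refl a => rfl
          | symm a b _ ih => exact ih.symm
          | trans a b c _ _ ih1 ih2 => exact ih1.trans ih2
        have := key _ _ (T.connected (ψ c) (ψ c'))
        rwa [hψ, hψ] at this
      euler := by
        refine (congrArg₂ (· + ·) rfl (sum_euler_all _)).trans ?_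
        rw [Nat.card_congr Θ, Nat.card_eq_fintype_card (α := T.Face)]
        exact_mod_cast T.euler_count }
  refine ⟨T', ⟨Equiv.refl _, Equiv.refl _, Equiv.refl _, 0, 1, ι, fun x => Or.inl rfl,
    fun x i => rfl, fun v i => rfl, fun d _ => ?_, fun i => rfl, fun d => ?_, fun j => rfl⟩,
    Equiv.refl _, fun v h => ?_, fun v h c hc => ?_⟩
  · change T.edge (ι d) = ι (ι (T.edge (ι d)))
    rw [hι]
  · exact congrArg T.face (cornerMap_left d).symm
  · change ι (T.edge (.biv v (0 + 1))) = _
    have h : T.edge (.biv v 0) = .biv v 1 := h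
    rw [zero_add, ← h, T.edge_edge, h]
    rfl
  · have := h (ψ c) (by simpa [T', ψ, cornerMap] using hc)
    rw [← hψ c, this]
    change Corner.biv v (1 + 1) = _
    rfl

end TangleDiagram

namespace TangleDiagram

variable {g : ℕ}

/-! ### Innermost circles -/

/-- Whether the corner lies at a bivalent vertex. -/
def _root_.Corner.IsBiv {X V : Type} : Corner X V g → Prop
  | .biv _ _ => True
  | _ => False

/-- In a diagram that consists of arcs and at least one circle, some circle bounds an empty
disk. -/
theorem exists_empty_disk (T : TangleDiagram g) [IsEmpty T.Crossing]
    (h0 : ∀ v : T.Bivalent, T.edge (.biv v 0) = .biv v 1) (v0 : T.Bivalent) :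
    ∃ v i, ∀ c, T.face c = T.face (.biv v i) → c = .biv v i := by
  classical
  by_contra! hno
  have h1 : ∀ v : T.Bivalent, T.edge (.biv v 1) = .biv v 0 := fun v => by rw [← h0, T.edge_edge]
  have hi : ∀ i : ZMod 2, i = 0 ∨ i = 1 := by decide
  have hb : ∀ (v : T.Bivalent) i, T.edge (.biv v i) = .biv v (i - 1) := by
    intro v i
    rcases hi i with rfl | rfl
    exacts [h0 v, h1 v]
  -- Each side of a circle is a curve with a single corner; the remaining curves run along the outer
  -- vertex only.
  have hs : ∀ c c', Corner.Consecutive T.edge c c' →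
      (c.IsBiv ∧ c = c') ∨ (¬ c.IsBiv ∧ ¬ c'.IsBiv) := by
    rintro _ _ (⟨d⟩ | _)
    · rcases d with ⟨x, _⟩ | ⟨v, i⟩ | j
      · exact isEmptyElim x
      · rw [hb]
        exact Or.inl ⟨trivial, rfl⟩
      · refine Or.inr ⟨?_, fun h => h⟩
        cases he : T.edge (.bdry j) with
        | cross x _ => exact isEmptyElim x
        | biv v i =>
          have := T.edge_edge (.bdry j)
          rw [he, hb] at this
          exact absurd this (by simp)
        | bdry j => exact fun h => h
    · exact Or.inr ⟨fun h => h, fun h => h⟩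
  let P : BoundaryCurve T.edge → Prop := Quot.lift Corner.IsBiv fun c c' h => by
    rcases hs c c' h with ⟨-, rfl⟩ | ⟨h1, h2⟩
    · rfl
    · simp [h1, h2]
  have hPinj : ∀ c c', c.IsBiv → T.curve c = T.curve c' → c = c' := by
    intro c c' hc h
    exact ((Quot.iff_of_forall (p := fun z => c = z) (fun a b hab => by
      rcases hs a b hab with ⟨-, rfl⟩ | ⟨h1, h2⟩
      · rfl
      · constructor
        · rintro rfl; exact absurd hc h1
        · rintro rfl; exact absurd hc h2) h).1 rfl)
  have tb : ∀ (v : T.Bivalent) i, (Corner.biv v i : Corner T.Crossing T.Bivalent g).IsBiv :=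
    fun _ _ => trivial
  let := Fintype.ofFinite (BoundaryCurve T.edge)
  -- With weight 1 for the sides of circles and 2 for the other curves, a face of weight below 2
  -- would be an empty disk. The total weight is twice the number of curves minus twice the number
  -- of circles, hence at most twice the number of faces, so no face could weigh more than 2.
  let w : BoundaryCurve T.edge → ℕ := fun c => if P c then 1 else 2
  have hcirc : (Finset.univ.filter P).card = 2 * Fintype.card T.Bivalent := by
    have : (Finset.univ.filter P)
        = (Finset.univ : Finset (T.Bivalent × ZMod 2)).image fun p => T.curve (.biv p.1 p.2) := by
      ext c
      simp only [Finset.mem_filter, Finset.mem_univ, true_and, Finset.mem_image]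
      constructor
      · intro hc
        induction c using Quot.ind with
        | _ c =>
        rcases c with ⟨x, _⟩ | ⟨v, i⟩ | j
        · exact isEmptyElim x
        · exact ⟨(v, i), rfl⟩
        · exact hc.elim
      · rintro ⟨p, rfl⟩; trivial
    rw [this, Finset.card_image_of_injective, Finset.card_univ, Fintype.card_prod, ZMod.card,
      mul_comm]
    rintro ⟨v, i⟩ ⟨v', i'⟩ h
    simpa using hPinj _ _ (tb _ _) h
  have hsum : ∑ c, w c + 2 * Fintype.card T.Bivalent = 2 * Nat.card (BoundaryCurve T.edge) := by
    rw [← hcirc, Finset.card_filter P Finset.univ, ← Finset.sum_add_distrib, Nat.card_eq_fintype_card,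
      ← Finset.card_univ, Finset.card_eq_sum_ones, Finset.mul_sum]
    refine Finset.sum_congr rfl fun c _ => ?_
    by_cases hc : P c <;> simp [w, hc]
  -- The tree count, where the components are at most the circles and the one of the outer vertex.
  have hle : Nat.card (BoundaryCurve T.edge) ≤ Fintype.card T.Face + Fintype.card T.Bivalent := by
    have h2 := T.card_boundaryCurve_add_one_le
    have h3 := numComponents_le T.edge_edge
    rw [Fintype.card_eq_zero] at h3
    omega
  have hfib : ∑ c, w c = ∑ F : T.Face, ∑ c with T.curveFace c = F, w c :=
    (Finset.sum_fiberwise _ _ _).symm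
  have hpos : ∀ c, 1 ≤ w c := fun c => by simp only [w]; split_ifs <;> omega
  have htwo : ∀ c c' : BoundaryCurve T.edge, c ≠ c' → T.curveFace c = T.curveFace c' →
      w c + w c' ≤ ∑ e with T.curveFace e = T.curveFace c', w e := by
    intro c c' hcc h
    rw [← Finset.sum_pair hcc]
    refine Finset.sum_le_sum_of_subset fun e he => ?_
    simp only [Finset.mem_insert, Finset.mem_singleton] at he
    rcases he with rfl | rfl <;> simp [h]
  have hF : ∀ F : T.Face, 2 ≤ ∑ c with T.curveFace c = F, w c := by
    intro F
    obtain ⟨c, rfl⟩ := T.face_surjective F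
    rcases c with ⟨x, _⟩ | ⟨v, i⟩ | j
    · exact isEmptyElim x
    · obtain ⟨c, hc, hne⟩ := hno v i
      have := htwo (T.curve c) (T.curve (.biv v i))
        (fun h => hne (hPinj _ _ (tb _ _) h.symm).symm) hc
      have h2 := hpos (T.curve c)
      have h3 := hpos (T.curve (.biv v i))
      exact le_trans (by omega) this
    · have : w (T.curve (.arc j)) = 2 := if_neg fun h => h
      rw [← this]
      exact Finset.single_le_sum (f := w) (fun _ _ => Nat.zero_le _)
        (s := Finset.univ.filter fun c => T.curveFace c = T.face (.arc j)) (Finset.mem_filter.2 ⟨Finset.mem_univ (T.curve (.arc j)), rfl⟩)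
  -- By connectedness some face borders both a circle and the boundary of the disk; its weight is at
  -- least 3, which contradicts the total.
  obtain ⟨v, i, j, hvj⟩ : ∃ v i j, T.face (.biv v i) = T.face (.arc j) := by
    by_contra! hno'
    have key : ∀ a b, Relation.EqvGen (fun a b => a.vertex = b.vertex ∨ T.face a = T.face b) a b →
        (a.IsBiv ↔ b.IsBiv) := by
      intro a b hab
      induction hab with
      | rel a b hab =>
        rcases a with ⟨x, _⟩ | ⟨v, i⟩ | j <;> rcases b with ⟨x', _⟩ | ⟨v', i'⟩ | j' <;>
          try first | exact isEmptyElim ‹T.Crossing› | exact Iff.rfl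
        · rcases hab with hab | hab
          · simp [Corner.vertex] at hab
          · exact absurd hab (hno' _ _ _)
        · rcases hab with hab | hab
          · simp [Corner.vertex] at hab
          · exact absurd hab.symm (hno' _ _ _)
      | refl a => rfl
      | symm a b _ ih => exact ih.symm
      | trans a b c _ _ ih1 ih2 => exact ih1.trans ih2
    exact (key _ _ (T.connected (.biv v0 0) (.arc 0))).1 trivial
  have hlt : ∑ _F : T.Face, 2 < ∑ F : T.Face, ∑ c with T.curveFace c = F, w c := by
    refine Finset.sum_lt_sum (fun F _ => hF F) ⟨T.face (.arc j), Finset.mem_univ _, ?_⟩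
    have h2 := htwo (T.curve (.biv v i)) (T.curve (.arc j))
      (fun h => by simpa using hPinj _ _ (tb _ _) h) hvj
    have h3 : w (T.curve (.arc j)) = 2 := if_neg fun h => h
    have h4 := hpos (T.curve (.biv v i))
    exact lt_of_lt_of_le (by omega) h2
  simp only [Finset.sum_const, Finset.card_univ, smul_eq_mul] at hlt
  omega

/-! ### Reduction to base tangles -/

/-- Every diagram is built from diagrams without crossings and bivalent vertices. -/
theorem reduction {motive : TangleDiagram g → Prop}
    (crossing : ∀ (T : TangleDiagram g) x TA TB, T.IsSmoothing x 0 TA → T.IsSmoothing x 1 TB →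
      motive TA → motive TB → motive T)
    (subdivision : ∀ T T' : TangleDiagram g, T.IsSubdivision T' → motive T → motive T')
    (loop : ∀ T T' : TangleDiagram g, T.IsLoopAddition T' → motive T → motive T')
    (iso : ∀ T T' : TangleDiagram g, T.IsIso T' → motive T → motive T')
    (base : ∀ T : TangleDiagram g, IsEmpty T.Crossing → IsEmpty T.Bivalent → motive T)
    (T : TangleDiagram g) : motive T := by
  -- The induction is lexicographic: a smoothing removes a crossing but adds two bivalent vertices.
  induction hn : Fintype.card T.Crossing using Nat.strong_induction_on generalizing T with
  | _ n ihn =>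
  induction hm : Fintype.card T.Bivalent using Nat.strong_induction_on generalizing T with
  | _ m ihm =>
  subst hn
  rcases isEmpty_or_nonempty T.Crossing with hX | ⟨⟨x⟩⟩
  · rcases isEmpty_or_nonempty T.Bivalent with hV | ⟨⟨v⟩⟩
    · exact base T hX hV
    · by_cases h : ∀ v : T.Bivalent, T.edge (.biv v 0) = .biv v 1
      · obtain ⟨v, i, hD⟩ := T.exists_empty_disk h v
        have hi : ∀ i : ZMod 2, i = 0 ∨ i = 1 := by decide
        rcases hi i with rfl | rfl
        · obtain ⟨T', h1, h2, h3⟩ := T.exists_isLoopAddition v (h v) hD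
          exact loop _ _ h1 (ihm _ (by omega) T' h2 rfl)
        · obtain ⟨T', h1, eV, h2, h3⟩ := T.exists_isIso_rotate
          obtain ⟨v, rfl⟩ := eV.surjective v
          obtain ⟨T'', h4, h5, h6⟩ := T'.exists_isLoopAddition v (h2 v (h _)) (h3 v hD)
          have hc1 : Fintype.card T'.Bivalent = Fintype.card T.Bivalent := Fintype.card_congr eV
          have hc2 : Fintype.card T'.Crossing = Fintype.card T.Crossing := by
            obtain ⟨eX, -⟩ := h1
            exact Fintype.card_congr eX
          exact iso _ _ h1 (loop _ _ h4 (ihm _ (by omega) T'' (by omega) rfl))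
      · push Not at h
        obtain ⟨v, hv⟩ := h
        obtain ⟨T', h1, h2, h3⟩ := T.exists_isSubdivision v hv
        exact subdivision _ _ h1 (ihm _ (by omega) T' h2 rfl)
  · exact crossing T x _ _ (T.isSmoothing_smoothing x 0) (T.isSmoothing_smoothing x 1)
      (ihn _ (T.card_crossing_smoothing x 0) _ rfl) (ihn _ (T.card_crossing_smoothing x 1) _ rfl)

/-! ### Base tangles -/

/-- In a base tangle, the faces are disks. -/
theorem curveFace_injective (T : TangleDiagram g) [IsEmpty T.Crossing] [IsEmpty T.Bivalent] :
    Function.Injective T.curveFace := by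
  have hv : ∀ c : Corner T.Crossing T.Bivalent g, c.vertex = none := by
    rintro (⟨x, _⟩ | ⟨v, _⟩ | _)
    exacts [isEmptyElim x, isEmptyElim v, rfl]
  rintro ⟨a⟩ ⟨b⟩ h
  exact T.curve_eq_of_face_eq h (componentMk_eq_of_vertex _ ((hv a).trans (hv b).symm))

/-- A base tangle is determined by the way in which it connects the boundary points. -/
theorem isIso_of_edge_eq (T T' : TangleDiagram g) [IsEmpty T.Crossing] [IsEmpty T.Bivalent]
    [IsEmpty T'.Crossing] [IsEmpty T'.Bivalent]
    (h : ∀ i j, T.edge (.bdry i) = .bdry j ↔ T'.edge (.bdry i) = .bdry j) : T.IsIso T' := by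
  let eX : T.Crossing ≃ T'.Crossing := Equiv.equivOfIsEmpty _ _
  let eV : T.Bivalent ≃ T'.Bivalent := Equiv.equivOfIsEmpty _ _
  have he : ∀ d, T'.edge (dartMap eX eV 0 0 d) = dartMap eX eV 0 0 (T.edge d) := by
    rintro (⟨x, _⟩ | ⟨v, _⟩ | i)
    · exact isEmptyElim x
    · exact isEmptyElim v
    · rcases hj : T.edge (.bdry i) with ⟨x, _⟩ | ⟨v, _⟩ | j
      · exact isEmptyElim x
      · exact isEmptyElim v
      · exact (h i j).1 hj
  obtain ⟨Θ, hΘ⟩ := exists_curveEquiv_of_bijective (edge := T.edge) (edge' := T'.edge)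
    (r := 0) (s := 0) eX.bijective eV.bijective he
  have hs : ∀ T : TangleDiagram g, Function.Surjective T.curveFace := fun T F => by
    obtain ⟨c, rfl⟩ := T.face_surjective F
    exact ⟨T.curve c, rfl⟩
  -- As all faces are disks, they correspond to the boundary curves, so the bijection of the faces
  -- is forced by the edges.
  let e1 : BoundaryCurve T.edge ≃ T.Face := Equiv.ofBijective _ ⟨T.curveFace_injective, hs T⟩
  let e2 : BoundaryCurve T'.edge ≃ T'.Face := Equiv.ofBijective _ ⟨T'.curveFace_injective, hs T'⟩
  have hq : ∀ c, T'.face (cornerMap eX eV 0 0 c) = (e1.symm.trans (Θ.trans e2)) (T.face c) := by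
    intro c
    have : T.face c = e1 (T.curve c) := rfl
    rw [this, Equiv.trans_apply, Equiv.symm_apply_apply, Equiv.trans_apply, hΘ]
    rfl
  exact ⟨eX, eV, e1.symm.trans (Θ.trans e2), 0, 0, dartMap eX eV 0 0, fun x => Or.inl rfl,
    fun x i => rfl, fun v i => rfl, fun d _ => he d, fun i => rfl,
    fun d => by rw [← hq, cornerMap_left], fun j => hq (.arc j)⟩

end TangleDiagram

namespace TangleDiagram

variable {g : ℕ}

/-! ### The relations between diagrams in terms of explicit maps -/

/-- The map of darts is determined by its prescribed values, and every corner is either the left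
corner of a dart or on the boundary circle. So the compatibility with faces extends to all corners;
the same holds for the other relations below. -/
theorem IsIso.exists_maps {T T' : TangleDiagram g} (h : T.IsIso T') :
    ∃ (eX : T.Crossing ≃ T'.Crossing) (eV : T.Bivalent ≃ T'.Bivalent) (eF : T.Face ≃ T'.Face)
      (r : T.Crossing → ZMod 4) (s : T.Bivalent → ZMod 2), (∀ x, r x = 0 ∨ r x = 2) ∧
      (∀ d, T'.edge (dartMap eX eV r s d) = dartMap eX eV r s (T.edge d)) ∧
      ∀ c, T'.face (cornerMap eX eV r s c) = eF (T.face c) := by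
  obtain ⟨eX, eV, eF, r, s, ι, hr, h1, h2, he, h3, hf, ha⟩ := h
  have hι : ι = dartMap eX eV r s := by
    funext d; cases d
    exacts [h1 _ _, h2 _ _, h3 _]
  subst hι
  refine ⟨eX, eV, eF, r, s, hr, fun d => he d (Set.notMem_empty d), fun c => ?_⟩
  rcases c.eq_left_or_arc with ⟨d, rfl⟩ | ⟨j, rfl⟩
  · exact (congrArg T'.face (cornerMap_left d)).trans (hf d)
  · exact ha j

theorem IsSubdivision.exists_maps {T T' : TangleDiagram g} (h : T.IsSubdivision T') :
    ∃ (eX : T.Crossing ≃ T'.Crossing) (eV : Option T.Bivalent ≃ T'.Bivalent)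
      (eF : T.Face ≃ T'.Face) (d : Dart T.Crossing T.Bivalent g),
      EdgeSubdivision eX eV T.edge T'.edge d ∧
      ∀ c, T'.face (inclCorner eX eV c) = eF (T.face c) := by
  obtain ⟨eX, eV, eF, ι, d, h1, h2, h4, h5, he, h3, hf, ha⟩ := h
  have hι : ι = inclDart eX eV := by
    funext d; cases d
    · simp [h1, dartMap]
    · simp [h2, dartMap]
    · exact h3 _
  subst hι
  refine ⟨eX, eV, eF, d, ⟨fun c hc hc' => he c (by simp [hc, hc']), h4, h5⟩, fun c => ?_⟩
  rcases c.eq_left_or_arc with ⟨d, rfl⟩ | ⟨j, rfl⟩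
  · exact (congrArg T'.face (cornerMap_left d)).trans (hf d)
  · exact ha j

theorem IsLoopAddition.exists_maps {T T' : TangleDiagram g} (h : T.IsLoopAddition T') :
    ∃ (F : T.Face) (eX : T.Crossing ≃ T'.Crossing) (eV : Option T.Bivalent ≃ T'.Bivalent)
      (eF : Option T.Face ≃ T'.Face), EdgeLoop eX eV T.edge T'.edge ∧
      T'.face (.biv (eV none) 0) = eF none ∧
      T'.face (.biv (eV none) 1) = eF (some F) ∧
      ∀ c, T'.face (inclCorner eX eV c) = eF (some (T.face c)) := by
  obtain ⟨F, eX, eV, eF, ι, h1, h2, h4, h5, h6, he, h3, hf, ha⟩ := h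
  have hι : ι = inclDart eX eV := by
    funext d; cases d
    · simp [h1, dartMap]
    · simp [h2, dartMap]
    · exact h3 _
  subst hι
  refine ⟨F, eX, eV, eF, ⟨fun c => he c (Set.notMem_empty c), h4⟩, h5, h6, fun c => ?_⟩
  rcases c.eq_left_or_arc with ⟨d, rfl⟩ | ⟨j, rfl⟩
  · exact (congrArg T'.face (cornerMap_left d)).trans (hf d)
  · exact ha j

section

variable {X V X' V' : Type}

/-- The correspondence of darts in a smoothing. -/
noncomputable def smoothDartEquiv (x : X) (k : ZMod 4) (eX : {y // y ≠ x} ≃ X')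
    (eV : V ⊕ Bool ≃ V') : Dart X' V' g ≃ Dart X V g :=
  Equiv.ofBijective (unsmoothDart x k ∘ dartMap eX.symm eV.symm 0 0)
    ((unsmoothDart_bijective x k).comp ⟨dartMap_injective eX.symm.injective eV.symm.injective,
      dartMap_surjective eX.symm.surjective eV.symm.surjective⟩)

/-- The correspondence of corners in a smoothing. -/
noncomputable def smoothCornerEquiv (x : X) (k : ZMod 4) (eX : {y // y ≠ x} ≃ X')
    (eV : V ⊕ Bool ≃ V') : Corner X' V' g ≃ Corner X V g :=
  Equiv.ofBijective (unsmoothCorner x k ∘ cornerMap eX.symm eV.symm 0 0)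
    ((unsmoothCorner_bijective x k).comp
      ⟨cornerMap_injective eX.symm.injective eV.symm.injective,
      cornerMap_surjective eX.symm.surjective eV.symm.surjective⟩)

theorem smoothCornerEquiv_left (x : X) (k : ZMod 4) (eX : {y // y ≠ x} ≃ X')
    (eV : V ⊕ Bool ≃ V') (d : Dart X' V' g) :
    smoothCornerEquiv x k eX eV d.left = (smoothDartEquiv x k eX eV d).left := by
  change unsmoothCorner x k (cornerMap eX.symm eV.symm 0 0 _) = _
  rw [cornerMap_left, unsmoothCorner_left]
  rfl

theorem smoothCornerEquiv_right [DecidableEq (Corner X V g)] (x : X) (k : ZMod 4)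
    (eX : {y // y ≠ x} ≃ X') (eV : V ⊕ Bool ≃ V') (d : Dart X' V' g) :
    smoothCornerEquiv x k eX eV d.right
      = Equiv.swap (.cross x (k + 1)) (.cross x (k + 3)) (smoothDartEquiv x k eX eV d).right := by
  change unsmoothCorner x k (cornerMap eX.symm eV.symm 0 0 _) = _
  rw [cornerMap_right, unsmoothCorner_right]
  rfl

end

theorem IsSmoothing.exists_maps {T T' : TangleDiagram g} {x : T.Crossing} {k : ZMod 4}
    (h : T.IsSmoothing x k T') :
    ∃ (eX : {y : T.Crossing // y ≠ x} ≃ T'.Crossing) (eV : T.Bivalent ⊕ Bool ≃ T'.Bivalent)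
      (q : T.Face → T'.Face), Function.Surjective q ∧
      (∀ F F', q F = q F' ↔ F = F' ∨
        (F = T.face (.cross x (k + 1)) ∧ F' = T.face (.cross x (k + 3))) ∨
        (F = T.face (.cross x (k + 3)) ∧ F' = T.face (.cross x (k + 1)))) ∧
      (∀ d, smoothDartEquiv x k eX eV (T'.edge d) = T.edge (smoothDartEquiv x k eX eV d)) ∧
      ∀ c, T'.face c = q (T.face (smoothCornerEquiv x k eX eV c)) := by
  obtain ⟨eX, eV, q, ι, hq, hqq, h1, h2, h4, h5, h6, h7, he, h3, hf, ha⟩ := h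
  have hk : ∀ k, k + smoothIndex false 0 = k ∧ k + smoothIndex false 1 = k + 1 ∧
    k + smoothIndex true 0 = k + 2 ∧ k + smoothIndex true 1 = k + 3 := by decide
  obtain ⟨k0, k1, k2, k3⟩ := hk k
  have hi : ∀ i : ZMod 2, i = 0 ∨ i = 1 := by decide
  have hι : ∀ d, ι (smoothDartEquiv x k eX eV d) = d := by
    rintro (⟨y, i⟩ | ⟨v, i⟩ | i)
    · change ι (.cross (eX.symm y) (i + 0)) = _
      rw [h1, Equiv.apply_symm_apply, add_zero]
    · obtain ⟨v, rfl⟩ := eV.surjective v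
      have : smoothDartEquiv (g := g) x k eX eV (.biv (eV v) i) = unsmoothDart x k (.biv v i) := by
        change unsmoothDart x k (.biv (eV.symm (eV v)) (i + 0)) = _
        rw [Equiv.symm_apply_apply, add_zero]
      rw [this]
      rcases v with v | b
      · exact h2 v i
      · change ι (.cross x (k + smoothIndex b i)) = _
        cases b <;> rcases hi i with rfl | rfl
        · rw [k0, h4]
        · rw [k1, h5]
        · rw [k2, h6]
        · rw [k3, h7]
    · exact h3 i
  refine ⟨eX, eV, q, hq, hqq, fun d => ?_, fun c => ?_⟩
  · have := he (smoothDartEquiv x k eX eV d) (Set.notMem_empty _)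
    rw [hι] at this
    rw [this]
    obtain ⟨d', hd'⟩ := (smoothDartEquiv x k eX eV).surjective
      (T.edge (smoothDartEquiv x k eX eV d))
    rw [← hd', hι]
  · rcases c.eq_left_or_arc with ⟨d, rfl⟩ | ⟨j, rfl⟩
    · rw [smoothCornerEquiv_left, ← hf, hι]
    · exact ha j

/-! ### The states of a diagram -/

/-- The first of the two darts of a crossing that are joined by an arc of the smoothing: `true` is
the `A`-smoothing. -/
def stateShift (b : Bool) : ZMod 4 := if b then 0 else 1

/-- Darts that follow each other along a strand, after all crossings have been smoothed. -/
inductive Strand (T : TangleDiagram g) (s : T.Crossing → Bool) :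
    Dart T.Crossing T.Bivalent g → Dart T.Crossing T.Bivalent g → Prop
  | edge (d) : Strand T s d (T.edge d)
  | biv (v) : Strand T s (.biv v 0) (.biv v 1)
  | low (x) : Strand T s (.cross x (stateShift (s x))) (.cross x (stateShift (s x) + 1))
  | high (x) : Strand T s (.cross x (stateShift (s x) + 2)) (.cross x (stateShift (s x) + 3))

/-- The number of closed loops of a state. -/
noncomputable def numLoops (T : TangleDiagram g) (s : T.Crossing → Bool) : ℕ :=
  Nat.card {c : Quot (T.Strand s) // ∀ i, c ≠ Quot.mk _ (.bdry i)}

/-- The boundary points that are connected in a state. -/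
def connection (T : TangleDiagram g) (s : T.Crossing → Bool) : Fin g → Fin g → Prop :=
  fun i j => Quot.mk (T.Strand s) (.bdry i) = Quot.mk (T.Strand s) (.bdry j)

theorem strand_biv (T : TangleDiagram g) (s : T.Crossing → Bool) (v : T.Bivalent) (i j : ZMod 2) :
    Quot.mk (T.Strand s) (.biv v i) = Quot.mk (T.Strand s) (.biv v j) := by
  have hi : ∀ i : ZMod 2, i = 0 ∨ i = 1 := by decide
  have h : Quot.mk (T.Strand s) (.biv v 0) = Quot.mk (T.Strand s) (.biv v 1) :=
    Quot.sound (.biv v)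
  rcases hi i with rfl | rfl <;> rcases hi j with rfl | rfl
  exacts [rfl, h, h.symm, rfl]

theorem strand_edge (T : TangleDiagram g) (s : T.Crossing → Bool)
    (d : Dart T.Crossing T.Bivalent g) :
    Quot.mk (T.Strand s) (T.edge d) = Quot.mk (T.Strand s) d :=
  (Quot.sound (Strand.edge d)).symm

/-- Both arcs of a smoothing in one formula: `r = 2` is the arc obtained by a half turn, so half
turns of the numbering can be absorbed in `r`. -/
theorem strand_cross (T : TangleDiagram g) (s : T.Crossing → Bool) (x : T.Crossing) {r : ZMod 4}
    (hr : r = 0 ∨ r = 2) : Quot.mk (T.Strand s) (.cross x (stateShift (s x) + r))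
      = Quot.mk (T.Strand s) (.cross x (stateShift (s x) + 1 + r)) := by
  rcases hr with rfl | rfl
  · rw [add_zero, add_zero]
    exact Quot.sound (.low x)
  · have : ∀ k : ZMod 4, k + 1 + 2 = k + 3 := by decide
    rw [this]
    exact Quot.sound (.high x)

theorem connection_eq_of_equiv {T T' : TangleDiagram g} {s : T.Crossing → Bool}
    {s' : T'.Crossing → Bool} (Θ : Quot (T.Strand s) ≃ Quot (T'.Strand s'))
    (hΘ : ∀ i, Θ (Quot.mk _ (.bdry i)) = Quot.mk _ (.bdry i)) :
    T'.connection s' = T.connection s := by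
  funext i j
  simp only [connection, ← hΘ, Θ.apply_eq_iff_eq]

theorem numLoops_eq_of_equiv {T T' : TangleDiagram g} {s : T.Crossing → Bool}
    {s' : T'.Crossing → Bool} (Θ : Quot (T.Strand s) ≃ Quot (T'.Strand s'))
    (hΘ : ∀ i, Θ (Quot.mk _ (.bdry i)) = Quot.mk _ (.bdry i)) :
    T'.numLoops s' = T.numLoops s := by
  refine (Nat.card_congr (Θ.subtypeEquiv fun c => ?_)).symm
  simp only [ne_eq, ← hΘ, Θ.apply_eq_iff_eq]

/-- A half turn at a crossing only exchanges the two arcs of its smoothing, so strands correspond to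
strands. -/
theorem IsIso.exists_stateEquiv {T T' : TangleDiagram g} (h : T.IsIso T') :
    ∃ eX : T.Crossing ≃ T'.Crossing, ∀ s : T.Crossing → Bool, ∀ s' : T'.Crossing → Bool,
      (∀ x, s' (eX x) = s x) → T'.connection s' = T.connection s ∧
        T'.numLoops s' = T.numLoops s := by
  obtain ⟨eX, eV, eF, r, t, hr, he, -⟩ := h.exists_maps
  refine ⟨eX, fun s s' hs => ?_⟩
  let e : Dart T.Crossing T.Bivalent g ≃ Dart T'.Crossing T'.Bivalent g :=
    Equiv.ofBijective (dartMap eX eV r t) ⟨dartMap_injective eX.injective eV.injective,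
      dartMap_surjective eX.surjective eV.surjective⟩
  have hsymm : ∀ d d', dartMap eX eV r t d = d' → e.symm d' = d := by
    rintro d _ rfl
    exact e.symm_apply_apply d
  have hex : ∀ (x : T.Crossing) i, e.symm (.cross (eX x) i) = .cross x (i - r x) := fun x i =>
    hsymm _ _ (by simp [dartMap])
  have hev : ∀ (v : T.Bivalent) i, e.symm (.biv (eV v) i) = .biv v (i - t v) := fun x i =>
    hsymm _ _ (by simp [dartMap])
  have hneg : ∀ r : ZMod 4, r = 0 ∨ r = 2 → -r = 0 ∨ -r = 2 := by decide
  have h2 : ∀ r : ZMod 4, r = 0 ∨ r = 2 → 2 + r = 0 ∨ 2 + r = 2 := by decide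
  have h3 : ∀ k r : ZMod 4, k + 3 + r = k + 1 + (2 + r) := by decide
  let Θ : Quot (T.Strand s) ≃ Quot (T'.Strand s') := quotEquivOfMaps e e.symm (by
      rintro d _ (_ | v | x | x)
      · change _ = Quot.mk _ (dartMap eX eV r t _)
        rw [← he, strand_edge]
        rfl
      · exact strand_biv _ _ _ _ _
      · have := strand_cross T' s' (eX x) (hr x)
        rw [hs] at this
        exact this
      · have := strand_cross T' s' (eX x) (h2 _ (hr x))
        rw [hs] at this
        change Quot.mk _ (Dart.cross (eX x) (_ + _)) = Quot.mk _ (Dart.cross (eX x) (_ + _))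
        rw [h3, add_assoc, this]) (by
      rintro d _ (_ | v | x | x)
      · obtain ⟨d, rfl⟩ := e.surjective d
        change _ = Quot.mk _ (e.symm (T'.edge (dartMap eX eV r t d)))
        rw [he, hsymm _ _ rfl, strand_edge, Equiv.symm_apply_apply]
      · obtain ⟨v, rfl⟩ := eV.surjective v
        rw [hev, hev]
        exact strand_biv _ _ _ _ _
      · obtain ⟨x, rfl⟩ := eX.surjective x
        rw [hex, hex, hs, sub_eq_add_neg, sub_eq_add_neg]
        exact strand_cross T s x (hneg _ (hr x))
      · obtain ⟨x, rfl⟩ := eX.surjective x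
        rw [hex, hex, hs, sub_eq_add_neg, sub_eq_add_neg, h3, add_assoc]
        exact strand_cross T s x (h2 _ (hneg _ (hr x)))) (fun a => by simp) (fun b => by simp)
  exact ⟨connection_eq_of_equiv Θ fun i => rfl, numLoops_eq_of_equiv Θ fun i => rfl⟩

theorem IsSubdivision.exists_stateEquiv {T T' : TangleDiagram g} (h : T.IsSubdivision T') :
    ∃ eX : T.Crossing ≃ T'.Crossing, ∀ s : T.Crossing → Bool, ∀ s' : T'.Crossing → Bool,
      (∀ x, s' (eX x) = s x) → T'.connection s' = T.connection s ∧
        T'.numLoops s' = T.numLoops s := by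
  obtain ⟨eX, eV, eF, d, he, -⟩ := h.exists_maps
  refine ⟨eX, fun s s' hs => ?_⟩
  have hi : ∀ i : ZMod 2, i = 0 ∨ i = 1 := by decide
  obtain ⟨F, hF, hF0⟩ := exists_extend_dart eX eV (Quot.mk (T.Strand s)) (fun _ => Quot.mk _ d)
  have hx : ∀ x i, F (.cross (eX x) i) = Quot.mk _ (.cross x i) := fun x i => by
    rw [← hF]; simp [dartMap]
  have hv : ∀ v i, F (.biv (eV (some v)) i) = Quot.mk _ (.biv v i) := fun x i => by
    rw [← hF]; simp [dartMap]
  have q0 : Quot.mk (T'.Strand s') (.biv (eV none) 0) = Quot.mk _ (inclDart eX eV d) := by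
    rw [← he.apply_self, strand_edge]
  have q1 : Quot.mk (T'.Strand s') (.biv (eV none) 1) = Quot.mk _ (inclDart eX eV (T.edge d)) := by
    rw [← he.apply_edge, strand_edge]
  have hbiv : ∀ i, Quot.mk (T'.Strand s') (.biv (eV none) i) = Quot.mk _ (inclDart eX eV d) :=
    fun i => (strand_biv _ _ _ _ _).trans q0
  have hf : ∀ a b, T.Strand s a b → Quot.mk (T'.Strand s') (inclDart eX eV a)
      = Quot.mk (T'.Strand s') (inclDart eX eV b) := by
    rintro c _ (_ | v | x | x)
    · by_cases hc : c = d
      · subst hc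
        rw [← q1, hbiv]
      by_cases hc' : c = T.edge d
      · subst hc'
        rw [T.edge_edge, ← q1, hbiv]
      · rw [← he.apply_of_ne c hc hc', strand_edge]
    · exact strand_biv _ _ _ _ _
    · have := Quot.sound (Strand.low (s := s') (eX x))
      rw [hs] at this
      simpa [dartMap] using this
    · have := Quot.sound (Strand.high (s := s') (eX x))
      rw [hs] at this
      simpa [dartMap] using this
  have hF' : ∀ a b, T'.Strand s' a b → F a = F b := by
    rintro c _ (_ | v | x | x)
    · rcases inclDart_cases eX eV c with ⟨c, rfl⟩ | ⟨i, rfl⟩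
      · by_cases hc : c = d
        · subst hc
          rw [he.apply_self, hF0, hF]
        by_cases hc' : c = T.edge d
        · subst hc'
          rw [he.apply_edge, hF0, hF, strand_edge]
        · rw [he.apply_of_ne c hc hc', hF, hF, strand_edge]
      · rw [hF0]
        rcases hi i with rfl | rfl
        · rw [← he.apply_self, T'.edge_edge, hF]
        · rw [← he.apply_edge, T'.edge_edge, hF, strand_edge]
    · obtain ⟨_ | v, rfl⟩ := eV.surjective v
      · rw [hF0, hF0]
      · rw [hv, hv]
        exact strand_biv _ _ _ _ _
    · obtain ⟨x, rfl⟩ := eX.surjective x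
      rw [hx, hx, hs]
      exact Quot.sound (.low x)
    · obtain ⟨x, rfl⟩ := eX.surjective x
      rw [hx, hx, hs]
      exact Quot.sound (.high x)
  let Θ : Quot (T.Strand s) ≃ Quot (T'.Strand s') :=
    ⟨Quot.lift (fun a => Quot.mk _ (inclDart eX eV a)) hf, Quot.lift F hF', by
      rintro ⟨c⟩; exact hF c, by
      rintro ⟨c⟩
      change Quot.lift _ hf (F _) = _
      rcases inclDart_cases eX eV c with ⟨c, rfl⟩ | ⟨i, rfl⟩
      · rw [hF]
      · rw [hF0]
        exact (hbiv i).symm⟩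
  exact ⟨connection_eq_of_equiv Θ fun i => rfl, numLoops_eq_of_equiv Θ fun i => rfl⟩

theorem IsLoopAddition.exists_stateEquiv {T T' : TangleDiagram g} (h : T.IsLoopAddition T') :
    ∃ eX : T.Crossing ≃ T'.Crossing, ∀ s : T.Crossing → Bool, ∀ s' : T'.Crossing → Bool,
      (∀ x, s' (eX x) = s x) → T'.connection s' = T.connection s ∧
        T'.numLoops s' = T.numLoops s + 1 := by
  obtain ⟨-, eX, eV, eF, he, -⟩ := h.exists_maps
  refine ⟨eX, fun s s' hs => ?_⟩
  have hi : ∀ i : ZMod 2, i = 0 ∨ i = 1 := by decide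
  -- `none` stands for the added circle, a strand class without boundary points.
  obtain ⟨F, hF, hF0⟩ := exists_extend_dart (β := Option (Quot (T.Strand s))) eX eV
    (fun c => some (Quot.mk _ c)) (fun _ => none)
  have hx : ∀ x i, F (.cross (eX x) i) = some (Quot.mk _ (.cross x i)) := fun x i => by
    rw [← hF]; simp [dartMap]
  have hv : ∀ v i, F (.biv (eV (some v)) i) = some (Quot.mk _ (.biv v i)) := fun x i => by
    rw [← hF]; simp [dartMap]
  have hf : ∀ a b, T.Strand s a b → Quot.mk (T'.Strand s') (inclDart eX eV a)
      = Quot.mk (T'.Strand s') (inclDart eX eV b) := by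
    rintro c _ (_ | v | x | x)
    · rw [← he.apply_incl, strand_edge]
    · exact strand_biv _ _ _ _ _
    · have := Quot.sound (Strand.low (s := s') (eX x))
      rw [hs] at this
      simpa [dartMap] using this
    · have := Quot.sound (Strand.high (s := s') (eX x))
      rw [hs] at this
      simpa [dartMap] using this
  have hF' : ∀ a b, T'.Strand s' a b → F a = F b := by
    rintro c _ (_ | v | x | x)
    · rcases inclDart_cases eX eV c with ⟨c, rfl⟩ | ⟨i, rfl⟩
      · rw [he.apply_incl, hF, hF, strand_edge]
      · rcases hi i with rfl | rfl
        · rw [he.apply_zero, hF0, hF0]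
        · rw [← he.apply_zero, T'.edge_edge, he.apply_zero, hF0, hF0]
    · obtain ⟨_ | v, rfl⟩ := eV.surjective v
      · rw [hF0, hF0]
      · rw [hv, hv]
        exact congrArg some (strand_biv _ _ _ _ _)
    · obtain ⟨x, rfl⟩ := eX.surjective x
      rw [hx, hx, hs]
      exact congrArg some (Quot.sound (.low x))
    · obtain ⟨x, rfl⟩ := eX.surjective x
      rw [hx, hx, hs]
      exact congrArg some (Quot.sound (.high x))
  let G : Option (Quot (T.Strand s)) → Quot (T'.Strand s')
    | some c => Quot.lift (fun a => Quot.mk _ (inclDart eX eV a)) hf c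
    | none => Quot.mk _ (.biv (eV none) 0)
  let Θ : Option (Quot (T.Strand s)) ≃ Quot (T'.Strand s') :=
    ⟨G, Quot.lift F hF', by
      rintro (_ | ⟨⟨c⟩⟩)
      · exact hF0 0
      · exact hF c, by
      rintro ⟨c⟩
      change G (F _) = _
      rcases inclDart_cases eX eV c with ⟨c, rfl⟩ | ⟨i, rfl⟩
      · rw [hF]
      · rw [hF0]
        exact strand_biv _ _ _ _ _⟩
  have hΘ : ∀ i, Quot.mk (T'.Strand s') (.bdry i) = Θ (some (Quot.mk _ (.bdry i))) := fun i => rfl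
  constructor
  · funext i j
    simp only [connection, hΘ, Θ.apply_eq_iff_eq, Option.some.injEq]
  · have h1 : T'.numLoops s' = Nat.card {c : Option (Quot (T.Strand s)) //
        ∀ i, c ≠ some (Quot.mk _ (.bdry i))} := by
      refine (Nat.card_congr (Θ.subtypeEquiv fun c => ?_)).symm
      simp only [ne_eq, hΘ, Θ.apply_eq_iff_eq]
    have e : {c : Option (Quot (T.Strand s)) // ∀ i, c ≠ some (Quot.mk _ (.bdry i))}
        ≃ Option {c : Quot (T.Strand s) // ∀ i, c ≠ Quot.mk _ (.bdry i)} :=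
      { toFun := fun c => match c with
          | ⟨none, _⟩ => none
          | ⟨some c, h⟩ => some ⟨c, fun i hi => h i (by rw [hi])⟩
        invFun := fun c => match c with
          | none => ⟨none, fun i => by simp⟩
          | some c => ⟨some c.1, fun i hi => c.2 i (Option.some_injective _ hi)⟩
        left_inv := by rintro ⟨_ | c, h⟩ <;> rfl
        right_inv := by rintro (_ | c) <;> rfl }
    have : Finite (Quot (T.Strand s)) := Quot.finite _
    rw [h1, Nat.card_congr e, Finite.card_option]
    rfl

/-- The two bivalent vertices that replace `x` join the same darts as the arcs `low` and `high` of a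
state with value `b` at `x`. -/
theorem IsSmoothing.exists_stateEquiv {T T' : TangleDiagram g} {x : T.Crossing} {b : Bool}
    (h : T.IsSmoothing x (stateShift b) T') :
    ∃ eX : {y : T.Crossing // y ≠ x} ≃ T'.Crossing, ∀ s : T.Crossing → Bool,
      ∀ s' : T'.Crossing → Bool, s x = b → (∀ y, s' (eX y) = s y) →
        T'.connection s' = T.connection s ∧ T'.numLoops s' = T.numLoops s := by
  obtain ⟨eX, eV, q, -, -, he, -⟩ := h.exists_maps
  refine ⟨eX, fun s s' hsx hs => ?_⟩
  set e := smoothDartEquiv (g := g) x (stateShift b) eX eV with he'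
  have hx : ∀ y i, e (.cross (eX y) i) = .cross y i := by
    intro y i
    change unsmoothDart x (stateShift b) (.cross (eX.symm (eX y)) (i + 0)) = _
    rw [Equiv.symm_apply_apply, add_zero]
    rfl
  have hv : ∀ v i, e (.biv (eV v) i) = unsmoothDart x (stateShift b) (.biv v i) := by
    intro v i
    change unsmoothDart x _ (.biv (eV.symm (eV v)) (i + 0)) = _
    rw [Equiv.symm_apply_apply, add_zero]
  have hsy : ∀ d d', e d' = d → e.symm d = d' := by
    rintro _ d rfl
    exact e.symm_apply_apply d
  have hk : ∀ k, k + smoothIndex false 0 = k ∧ k + smoothIndex false 1 = k + 1 ∧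
    k + smoothIndex true 0 = k + 2 ∧ k + smoothIndex true 1 = k + 3 := by decide
  obtain ⟨k0, k1, k2, k3⟩ := hk (stateShift b)
  have x0 : e (.biv (eV (.inr false)) 0) = .cross x (stateShift b) := by
    rw [hv, unsmoothDart, k0]
  have x1 : e (.biv (eV (.inr false)) 1) = .cross x (stateShift b + 1) := by
    rw [hv, unsmoothDart, k1]
  have x2 : e (.biv (eV (.inr true)) 0) = .cross x (stateShift b + 2) := by
    rw [hv, unsmoothDart, k2]
  have x3 : e (.biv (eV (.inr true)) 1) = .cross x (stateShift b + 3) := by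
    rw [hv, unsmoothDart, k3]
  let Θ : Quot (T.Strand s) ≃ Quot (T'.Strand s') := quotEquivOfMaps e.symm e (by
      rintro d _ (_ | v | y | y)
      · obtain ⟨d, rfl⟩ := e.surjective d
        rw [← he, Equiv.symm_apply_apply, Equiv.symm_apply_apply, strand_edge]
      · rw [hsy (.biv v 0) _ (hv (.inl v) 0), hsy (.biv v 1) _ (hv (.inl v) 1)]
        exact strand_biv _ _ _ _ _
      · by_cases hy : y = x
        · subst hy
          rw [hsx, hsy _ _ x0, hsy _ _ x1]
          exact strand_biv _ _ _ _ _
        · rw [hsy _ _ (hx ⟨y, hy⟩ _), hsy _ _ (hx ⟨y, hy⟩ _), ← hs ⟨y, hy⟩]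
          exact Quot.sound (.low _)
      · by_cases hy : y = x
        · subst hy
          rw [hsx, hsy _ _ x2, hsy _ _ x3]
          exact strand_biv _ _ _ _ _
        · rw [hsy _ _ (hx ⟨y, hy⟩ _), hsy _ _ (hx ⟨y, hy⟩ _), ← hs ⟨y, hy⟩]
          exact Quot.sound (.high _)) (by
      rintro d _ (_ | v | y | y)
      · rw [he, strand_edge]
      · obtain ⟨v | c, rfl⟩ := eV.surjective v
        · rw [hv, hv]
          exact strand_biv _ _ _ _ _
        · cases c
          · rw [x0, x1, ← hsx]
            exact Quot.sound (.low x)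
          · rw [x2, x3, ← hsx]
            exact Quot.sound (.high x)
      · obtain ⟨y, rfl⟩ := eX.surjective y
        rw [hx, hx, hs]
        exact Quot.sound (.low _)
      · obtain ⟨y, rfl⟩ := eX.surjective y
        rw [hx, hx, hs]
        exact Quot.sound (.high _)) (fun a => by simp) (fun b => by simp)
  have hb : ∀ i, Θ (Quot.mk _ (.bdry i)) = Quot.mk _ (.bdry i) := fun i =>
    congrArg (Quot.mk _) (hsy (.bdry i) (.bdry i) rfl)
  exact ⟨connection_eq_of_equiv Θ hb, numLoops_eq_of_equiv Θ hb⟩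

end TangleDiagram

/-! ### The Kauffman bracket -/

/-- The value of a closed loop. -/
noncomputable def loopValue : LaurentPolynomial ℤ :=
  -LaurentPolynomial.T 2 - LaurentPolynomial.T (-2)

/-- The weight of a smoothing. -/
noncomputable def smoothingWeight (b : Bool) : LaurentPolynomial ℤ :=
  LaurentPolynomial.T (if b then 1 else -1)

namespace TangleDiagram

variable {g : ℕ}

open Classical in
/-- The state sum. -/
noncomputable def bracket (T : TangleDiagram g) : (Fin g → Fin g → Prop) →₀ LaurentPolynomial ℤ :=
  ∑ s : T.Crossing → Bool, Finsupp.single (T.connection s)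
    ((∏ x, smoothingWeight (s x)) * loopValue ^ T.numLoops s)

/-- The states are matched term by term. The case `m = 0` is invariance under isotopy and
subdivision, `m = 1` is the loop relation. -/
theorem bracket_eq_of_stateEquiv {T T' : TangleDiagram g} (eX : T.Crossing ≃ T'.Crossing) (m : ℕ)
    (h : ∀ s : T.Crossing → Bool, ∀ s' : T'.Crossing → Bool, (∀ x, s' (eX x) = s x) →
      T'.connection s' = T.connection s ∧ T'.numLoops s' = T.numLoops s + m) :
    T'.bracket = loopValue ^ m • T.bracket := by
  classical
  unfold bracket
  rw [Finset.smul_sum]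
  refine (Fintype.sum_equiv (Equiv.arrowCongr eX (Equiv.refl Bool)) _ _ fun s => ?_).symm
  obtain ⟨h1, h2⟩ := h s (Equiv.arrowCongr eX (Equiv.refl Bool) s) (fun x => by simp)
  rw [h1, h2, Finsupp.smul_single, smul_eq_mul, pow_add]
  have : ∏ x, smoothingWeight (Equiv.arrowCongr eX (Equiv.refl Bool) s x)
      = ∏ x, smoothingWeight (s x) :=
    (Fintype.prod_equiv eX _ _ fun x => by simp).symm
  rw [this]
  congr 1
  ring

theorem IsIso.bracket_eq {T T' : TangleDiagram g} (h : T.IsIso T') : T'.bracket = T.bracket := by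
  obtain ⟨eX, h⟩ := h.exists_stateEquiv
  simpa using bracket_eq_of_stateEquiv eX 0 h

theorem IsSubdivision.bracket_eq {T T' : TangleDiagram g} (h : T.IsSubdivision T') :
    T'.bracket = T.bracket := by
  obtain ⟨eX, h⟩ := h.exists_stateEquiv
  simpa using bracket_eq_of_stateEquiv eX 0 h

theorem IsLoopAddition.bracket_eq {T T' : TangleDiagram g} (h : T.IsLoopAddition T') :
    T'.bracket = loopValue • T.bracket := by
  obtain ⟨eX, h⟩ := h.exists_stateEquiv
  simpa using bracket_eq_of_stateEquiv eX 1 h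

-- The part of the state sum of `T` over the states with value `b` at `x`; the factor in front is
-- the weight of `x`.
open Classical in
theorem IsSmoothing.smul_bracket_eq {T T' : TangleDiagram g} {x : T.Crossing} {b : Bool}
    (h : T.IsSmoothing x (stateShift b) T') :
    smoothingWeight b • T'.bracket = ∑ t : {y : T.Crossing // y ≠ x} → Bool,
      Finsupp.single (T.connection ((Equiv.funSplitAt x Bool).symm (b, t)))
        ((∏ x', smoothingWeight ((Equiv.funSplitAt x Bool).symm (b, t) x')) *
          loopValue ^ T.numLoops ((Equiv.funSplitAt x Bool).symm (b, t))) := by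
  obtain ⟨eX, h⟩ := h.exists_stateEquiv
  unfold bracket
  rw [Finset.smul_sum]
  refine (Fintype.sum_equiv (Equiv.arrowCongr eX (Equiv.refl Bool)) _ _ fun t => ?_).symm
  set s := (Equiv.funSplitAt x Bool).symm (b, t) with hs
  have hsx : s x = b := by simp [s, Equiv.funSplitAt, Equiv.piSplitAt]
  have hsy : ∀ y : {y // y ≠ x}, s y = t y := fun y => by
    simp [s, Equiv.funSplitAt, Equiv.piSplitAt, y.2]
  obtain ⟨h1, h2⟩ := h s (Equiv.arrowCongr eX (Equiv.refl Bool) t) hsx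
    (fun y => by simp [hsy])
  rw [h1, h2, Finsupp.smul_single, smul_eq_mul, ← mul_assoc]
  have h3 : ∏ x, smoothingWeight (Equiv.arrowCongr eX (Equiv.refl Bool) t x)
      = ∏ y : {y // y ≠ x}, smoothingWeight (s y) :=
    (Fintype.prod_equiv eX _ _ fun y => by simp [hsy]).symm
  have h4 : ∏ y, smoothingWeight (s y)
      = smoothingWeight b * ∏ y : {y // y ≠ x}, smoothingWeight (s y) := by
    rw [← hsx, ← (Equiv.optionSubtypeNe x).prod_comp, Fintype.prod_option]
    simp
  rw [h3, h4]

theorem bracket_eq_add {T TA TB : TangleDiagram g} {x : T.Crossing} (hA : T.IsSmoothing x 0 TA)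
    (hB : T.IsSmoothing x 1 TB) :
    T.bracket = (LaurentPolynomial.T 1 : LaurentPolynomial ℤ) • TA.bracket
      + (LaurentPolynomial.T (-1) : LaurentPolynomial ℤ) • TB.bracket := by
  classical
  have h1 := IsSmoothing.smul_bracket_eq (b := true) hA
  have h2 := IsSmoothing.smul_bracket_eq (b := false) hB
  change (LaurentPolynomial.T 1 : LaurentPolynomial ℤ) • _ = _ at h1
  change (LaurentPolynomial.T (-1) : LaurentPolynomial ℤ) • _ = _ at h2
  rw [h1, h2, bracket, ← (Equiv.funSplitAt x Bool).symm.sum_comp, Fintype.sum_prod_type,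
    Fintype.sum_bool]

end TangleDiagram

/-! ### The bracket as a linear map on the skein module. -/

variable {g : ℕ}

/-- The bracket of a class of diagrams. -/
noncomputable def TangleClass.bracket (t : TangleClass g) :
    (Fin g → Fin g → Prop) →₀ LaurentPolynomial ℤ :=
  Quot.lift TangleDiagram.bracket (fun _ _ h => h.elim (fun h => h.bracket_eq.symm)
    fun h => h.bracket_eq.symm) t

/-- The bracket on the free module on the diagrams. -/
noncomputable def diagramBracket (g : ℕ) : DiagramModule g →ₗ[LaurentPolynomial ℤ]
    (Fin g → Fin g → Prop) →₀ LaurentPolynomial ℤ :=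
  Finsupp.linearCombination _ TangleClass.bracket

theorem diagramBracket_gen (T : TangleDiagram g) :
    diagramBracket g T.toClass.gen = T.bracket := by
  rw [diagramBracket, TangleClass.gen, Finsupp.linearCombination_single, one_smul]
  rfl

theorem kauffmanSubmodule_le_ker : kauffmanSubmodule g ≤ LinearMap.ker (diagramBracket g) := by
  refine Submodule.span_le.2 ?_
  rintro _ (⟨T, T', h, rfl⟩ | ⟨T, x, TA, TB, hA, hB, rfl⟩)
  · rw [SetLike.mem_coe, LinearMap.mem_ker, map_sub, map_smul, diagramBracket_gen,
      diagramBracket_gen, h.bracket_eq]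
    exact sub_self _
  · rw [SetLike.mem_coe, LinearMap.mem_ker, map_sub, map_add, map_smul, map_smul,
      diagramBracket_gen, diagramBracket_gen, diagramBracket_gen,
      TangleDiagram.bracket_eq_add hA hB]
    exact sub_self _

/-- The bracket on the skein module. -/
noncomputable def skeinBracket (g : ℕ) : SkeinModule g →ₗ[LaurentPolynomial ℤ]
    (Fin g → Fin g → Prop) →₀ LaurentPolynomial ℤ :=
  (kauffmanSubmodule g).liftQ (diagramBracket g) kauffmanSubmodule_le_ker

theorem skeinBracket_skein (T : TangleDiagram g) :
    skeinBracket g T.toClass.skein = T.bracket := by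
  rw [TangleClass.skein, skeinBracket, Submodule.mkQ_apply, Submodule.liftQ_apply,
    diagramBracket_gen]

/-! ### Independence of the base tangles -/

namespace TangleDiagram

theorem connection_iff_of_isEmpty (T : TangleDiagram g) [IsEmpty T.Crossing] [IsEmpty T.Bivalent]
    (s : T.Crossing → Bool) (i j : Fin g) :
    T.connection s i j ↔ i = j ∨ T.edge (.bdry i) = .bdry j := by
  constructor
  · intro h
    have := (Quot.iff_of_forall (r := T.Strand s)
      (p := fun d => d = .bdry i ∨ d = T.edge (.bdry i)) (by
        rintro d _ (_ | v | x | x)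
        · constructor
          · rintro (rfl | rfl)
            exacts [Or.inr rfl, Or.inl (T.edge_edge _)]
          · rintro (h | h)
            · exact Or.inr (by rw [← h, T.edge_edge])
            · exact Or.inl (by rw [← T.edge_edge d, h, T.edge_edge])
        · exact isEmptyElim v
        · exact isEmptyElim x
        · exact isEmptyElim x) h).1 (Or.inl rfl)
    rcases this with h | h
    · exact Or.inl (Dart.bdry.inj h).symm
    · exact Or.inr h.symm
  · rintro (rfl | h)
    · rfl
    · rw [connection, ← h, strand_edge]

theorem bracket_of_isEmpty (T : TangleDiagram g) [IsEmpty T.Crossing] [IsEmpty T.Bivalent] :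
    T.bracket = Finsupp.single (T.connection isEmptyElim) 1 := by
  classical
  have h0 : ∀ s, T.numLoops s = 0 := by
    intro s
    have : IsEmpty {c : Quot (T.Strand s) // ∀ i, c ≠ Quot.mk _ (.bdry i)} := by
      refine ⟨?_⟩
      rintro ⟨⟨d⟩, h⟩
      rcases d with ⟨x, _⟩ | ⟨v, _⟩ | i
      exacts [isEmptyElim x, isEmptyElim v, h i rfl]
    exact Nat.card_of_isEmpty
  rw [bracket, Finset.sum_eq_single isEmptyElim (fun s _ hs => absurd (Subsingleton.elim _ _) hs)
    (fun h => by
      simp at h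
      exact absurd (Subsingleton.elim _ _) h)]
  simp only [h0, pow_zero, mul_one, Finset.univ_eq_empty, Finset.prod_empty]

/-- The basis vector gives the connection relation, and its pairs of distinct points are exactly the
arcs of the base tangle. -/
theorem isIso_of_bracket_eq (T T' : TangleDiagram g) [IsEmpty T.Crossing] [IsEmpty T.Bivalent]
    [IsEmpty T'.Crossing] [IsEmpty T'.Bivalent] (h : T.bracket = T'.bracket) : T.IsIso T' := by
  rw [bracket_of_isEmpty, bracket_of_isEmpty] at h
  have hc : T.connection isEmptyElim = T'.connection isEmptyElim :=
    Finsupp.single_left_injective one_ne_zero h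
  have key : ∀ (T : TangleDiagram g) [IsEmpty T.Crossing] [IsEmpty T.Bivalent] (i j : Fin g),
      T.edge (.bdry i) = .bdry j ↔ T.connection isEmptyElim i j ∧ i ≠ j := by
    intro T _ _ i j
    rw [connection_iff_of_isEmpty]
    constructor
    · intro h
      exact ⟨Or.inr h, fun hij => T.edge_ne (.bdry i) (by rw [h, hij])⟩
    · rintro ⟨h | h, hij⟩
      exacts [absurd h hij, h]
  refine T.isIso_of_edge_eq T' fun i j => ?_
  rw [key T, key T', hc]

end TangleDiagram

/-- The way in which a base tangle connects the boundary points. -/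
theorem BaseTangle.exists_bracket_eq_single (B : BaseTangle g) :
    ∃ m, skeinBracket g B.1.skein = Finsupp.single m 1 := by
  obtain ⟨_, T, rfl, h1, h2⟩ := B
  exact ⟨_, (skeinBracket_skein T).trans T.bracket_of_isEmpty⟩

/-- The way in which a base tangle connects the boundary points. -/
noncomputable def BaseTangle.connection (B : BaseTangle g) : Fin g → Fin g → Prop :=
  B.exists_bracket_eq_single.choose

theorem BaseTangle.skeinBracket_eq (B : BaseTangle g) :
    skeinBracket g B.1.skein = Finsupp.single B.connection 1 :=
  B.exists_bracket_eq_single.choose_spec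

/-- Equal connections mean equal brackets of representatives without crossings and loops, and these
brackets determine the diagram up to isotopy. -/
theorem BaseTangle.connection_injective :
    Function.Injective (BaseTangle.connection : BaseTangle g → _) := by
  intro B B' h
  have h1 : skeinBracket g B.1.skein = skeinBracket g B'.1.skein := by
    rw [B.skeinBracket_eq, B'.skeinBracket_eq, h]
  obtain ⟨_, T, rfl, i1, i2⟩ := B
  obtain ⟨_, T', rfl, i3, i4⟩ := B'
  have h1 : skeinBracket g T.toClass.skein = skeinBracket g T'.toClass.skein := h1
  rw [skeinBracket_skein, skeinBracket_skein] at h1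
  exact Subtype.ext (Quot.sound (Or.inl (T.isIso_of_bracket_eq T' h1)))

/-- The skein bracket turns an expansion into the same coefficients on distinct basis vectors, so
they can be read off from `T`. -/
theorem TangleDiagram.IsExpansion.unique {T : TangleDiagram g}
    {c c' : BaseTangle g →₀ LaurentPolynomial ℤ} (h : T.IsExpansion c) (h' : T.IsExpansion c') :
    c = c' := by
  have key : ∀ c : BaseTangle g →₀ LaurentPolynomial ℤ, T.IsExpansion c →
      skeinBracket g T.toClass.skein = c.mapDomain BaseTangle.connection := by
    intro c h
    rw [h, Finsupp.mapDomain, Finsupp.sum, map_sum]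
    refine Finset.sum_congr rfl fun B _ => ?_
    rw [map_smul, B.skeinBracket_eq, Finsupp.smul_single, smul_eq_mul, mul_one]
  exact Finsupp.mapDomain_injective BaseTangle.connection_injective
    ((key c h).symm.trans (key c' h'))

namespace TangleDiagram

variable {g : ℕ}

/-! ### Checkerboardings of base tangles -/

/-- In `ZMod 2` the ones attached to `a` and `f a` cancel. -/
theorem even_card_of_involution {α : Type*} (s : Finset α) (f : α → α) (hs : ∀ a ∈ s, f a ∈ s)
    (hf : ∀ a, f (f a) = a) (hne : ∀ a, f a ≠ a) : Even s.card := by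
  have h := Finset.sum_involution (s := s) (f := fun _ => (1 : ZMod 2)) (fun a _ => f a)
    (fun a _ => by decide) (fun a _ _ => hne a) hs (fun a _ => hf a)
  rw [Finset.sum_const, nsmul_one, ZMod.natCast_eq_zero_iff] at h
  exact even_iff_two_dvd.2 h

/-- Euler's formula with the outer vertex as only vertex and all faces disks. -/
theorem card_boundaryCurve_of_isEmpty (T : TangleDiagram g) [IsEmpty T.Crossing]
    [IsEmpty T.Bivalent] : Nat.card (BoundaryCurve T.edge) = g / 2 + 1 := by
  have h1 := T.euler_count
  have h2 : Nat.card (BoundaryCurve T.edge) = Fintype.card T.Face := by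
    rw [← Nat.card_eq_fintype_card]
    refine Nat.card_congr (Equiv.ofBijective T.curveFace ⟨T.curveFace_injective, fun F => ?_⟩)
    obtain ⟨c, rfl⟩ := T.face_surjective F
    exact ⟨T.curve c, rfl⟩
  rw [card_dart, Fintype.card_eq_zero, Fintype.card_eq_zero] at h1
  rw [h2] at h1 ⊢
  push_cast at h1
  omega

/-- If two arcs of a base tangle would cross, its surface would not be planar. -/
theorem orbitMk_mul_swap_of_isEmpty (T : TangleDiagram g) [IsEmpty T.Crossing]
    [IsEmpty T.Bivalent] [DecidableEq (Corner T.Crossing T.Bivalent g)]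
    (d : Dart T.Crossing T.Bivalent g) (c : Corner T.Crossing T.Bivalent g) :
    (cornerRot * Equiv.swap d.left (T.edge d).left).orbitMk
        ((cornerEdge T.edge_edge * Equiv.swap d.left (T.edge d).left) c)
      = (cornerRot * Equiv.swap d.left (T.edge d).left).orbitMk c := by
  set a := d.left with ha
  set b := (T.edge d).left with hb
  set ε := cornerEdge T.edge_edge with hε
  have hab : a ≠ b := fun h => T.edge_ne d (Dart.left_injective h).symm
  have hεa : ε a = b := cornerEdge_left _ _
  have hεb : ε b = a := by rw [hb, hε, cornerEdge_left, T.edge_edge]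
  have hεε : ∀ c, ε (ε c) = c := cornerEdge_cornerEdge _
  have hρ : (cornerRot : Equiv.Perm (Corner T.Crossing T.Bivalent g)).numOrbits = 1 := by
    rw [numOrbits_cornerRot, Fintype.card_eq_zero, Fintype.card_eq_zero]
  have hsub : Subsingleton (Quot fun x y : Corner T.Crossing T.Bivalent g => y = cornerRot x) :=
    Finite.card_le_one_iff_subsingleton.1 hρ.le
  -- Contracting the arc of `d` cuts the outer vertex into two, one for each side of the arc. The
  -- edge is removed from the pairing and, by `hprod`, the boundary curves stay the same.
  have hρ1 : (cornerRot * Equiv.swap a b).numOrbits = 2 := by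
    rw [Equiv.Perm.numOrbits_mul_swap_of_eq hab (Subsingleton.elim _ _), hρ]
  have hcomm : Equiv.swap a b * ε = ε * Equiv.swap a b := by
    rw [Equiv.mul_swap_eq_swap_mul, hεa, hεb, Equiv.swap_comm]
  have hprod : (cornerRot * Equiv.swap a b) * (ε * Equiv.swap a b) = cornerRot * ε := by
    rw [← hcomm, mul_assoc, ← mul_assoc (Equiv.swap a b), Equiv.swap_mul_self, one_mul]
  let := Fintype.ofFinite (Corner T.Crossing T.Bivalent g)
  have h1 := Equiv.Perm.numOrbits_add_numOrbits_mul_le (cornerRot * Equiv.swap a b)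
    (ε * Equiv.swap a b) (fun c => by
      rw [← hcomm]
      change (Equiv.swap a b * ε * (Equiv.swap a b * ε)) c = c
      rw [hcomm, mul_assoc, ← mul_assoc (Equiv.swap a b), hcomm, mul_assoc, Equiv.swap_mul_self,
        mul_one]
      exact hεε c)
  have hsupp : (ε * Equiv.swap a b).support.card + 2 ≤ g := by
    have h2 : (ε * Equiv.swap a b).support ⊆ (ε.support.erase a).erase b := by
      intro x hx
      rw [Equiv.Perm.mem_support] at hx
      have hxa : x ≠ a := by
        rintro rfl
        simp [hεb] at hx
      have hxb : x ≠ b := by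
        rintro rfl
        simp [hεa] at hx
      simp only [Finset.mem_erase, Equiv.Perm.mem_support]
      refine ⟨hxb, hxa, ?_⟩
      rwa [Equiv.Perm.mul_apply, Equiv.swap_apply_of_ne_of_ne hxa hxb] at hx
    have h3 := Finset.card_le_card h2
    have h4 := card_support_cornerEdge_le T.edge_edge
    rw [card_dart, Fintype.card_eq_zero, Fintype.card_eq_zero] at h4
    have ha' : a ∈ ε.support := by
      rw [Equiv.Perm.mem_support, hεa]; exact hab.symm
    have hb' : b ∈ ε.support.erase a := by
      rw [Finset.mem_erase, Equiv.Perm.mem_support, hεb]; exact ⟨hab.symm, hab⟩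
    rw [Finset.card_erase_of_mem hb', Finset.card_erase_of_mem ha'] at h3
    have h5 : 1 < ε.support.card := Finset.one_lt_card.2
      ⟨a, ha', b, Finset.mem_of_mem_erase hb', hab⟩
    rw [← hε] at h4
    omega
  -- Two vertices, one edge less and still `g / 2 + 1` curves: the genus inequality leaves room only
  -- for at least two components.
  have hk : 2 ≤ (cornerRot * Equiv.swap a b).numOrbits₂ (ε * Equiv.swap a b) := by
    rw [hprod, hρ1, ← card_boundaryCurve, T.card_boundaryCurve_of_isEmpty] at h1
    omega
  -- An arc joining the two vertices would leave only one component.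
  by_contra hc
  have h2 := card_quot_addPair_of_ne (fun h => hc h.symm)
  change _ = (cornerRot * Equiv.swap a b).numOrbits at h2
  have h3 : (cornerRot * Equiv.swap a b).numOrbits₂ (ε * Equiv.swap a b)
      ≤ Nat.card (Quot (AddPair (fun x y => y = (cornerRot * Equiv.swap a b : Equiv.Perm _) x)
        c ((ε * Equiv.swap a b) c))) := by
    refine Nat.card_le_card_of_surjective (Quot.lift (Quot.mk _) ?_) ?_
    · rintro x y (h | ⟨rfl, rfl⟩)
      exacts [Quot.sound (Or.inl h), Quot.sound (Or.inr rfl)]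
    · rintro ⟨x⟩
      exact ⟨Quot.mk _ x, rfl⟩
  omega

theorem exists_matching (T : TangleDiagram g) [IsEmpty T.Crossing] [IsEmpty T.Bivalent] :
    ∃ m : Fin g → Fin g, (∀ i, T.edge (.bdry i) = .bdry (m i)) ∧ (∀ i, m (m i) = i) ∧
      ∀ i, m i ≠ i := by
  have h : ∀ i, ∃ j, T.edge (.bdry i) = .bdry j := by
    intro i
    rcases T.edge (.bdry i) with ⟨x, _⟩ | ⟨v, _⟩ | j
    exacts [isEmptyElim x, isEmptyElim v, ⟨j, rfl⟩]
  choose m hm using h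
  refine ⟨m, hm, fun i => ?_, fun i hi => T.edge_ne (.bdry i) (by rw [hm, hi])⟩
  have := T.edge_edge (.bdry i)
  rw [hm, hm] at this
  exact Dart.bdry.inj this

theorem matching_parity_of_lt (T : TangleDiagram g) [IsEmpty T.Crossing] [IsEmpty T.Bivalent]
    {m : Fin g → Fin g} (hm : ∀ i, T.edge (.bdry i) = .bdry (m i)) (hmm : ∀ i, m (m i) = i)
    (hne : ∀ i, m i ≠ i) {i : Fin g} (hi : i < m i) : Even ((m i : ℕ) - i - 1) := by
  classical
  set d : Dart T.Crossing T.Bivalent g := .bdry i with hd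
  -- The corners on one side of the arc from `i` to `m i`, an invariant set of the cut rotation. The
  -- left corner of the boundary point `l` is `arc l`, so the arcs cannot leave the interval between
  -- `i` and `m i`, whose points are therefore matched among themselves.
  let p : Corner T.Crossing T.Bivalent g → Prop
    | .arc l => (i : ℕ) < l ∧ (l : ℕ) ≤ m i
    | _ => False
  have hρ : ∀ l : Fin g, cornerRot (.arc l.castSucc : Corner T.Crossing T.Bivalent g)
      = .arc l.succ := fun l => cornerRot_left (.bdry l)
  have hl : d.left = .arc i.castSucc := rfl
  have hr : (T.edge d).left = .arc (m i).castSucc := by rw [hm]; rfl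
  have hp : ∀ c, p c ↔ p ((cornerRot * Equiv.swap d.left (T.edge d).left : Equiv.Perm _) c) := by
    rw [hl, hr]
    rintro (⟨x, _⟩ | ⟨v, _⟩ | l)
    · exact isEmptyElim x
    · exact isEmptyElim v
    · rw [Equiv.Perm.mul_apply]
      by_cases h1 : l = i.castSucc
      · subst h1
        rw [Equiv.swap_apply_left, hρ]
        simp [p]
      by_cases h2 : l = (m i).castSucc
      · subst h2
        rw [Equiv.swap_apply_right, hρ]
        simp [p]
      · rw [Equiv.swap_apply_of_ne_of_ne (by simpa using h1) (by simpa using h2)]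
        induction l using Fin.lastCases with
        | last =>
          rw [cornerRot_last]
          simp [p]
        | cast l =>
          rw [hρ]
          simp only [Fin.ext_iff, Fin.val_castSucc] at h1 h2
          simp only [p, Fin.val_castSucc, Fin.val_succ]
          omega
  have hε : ∀ l : Fin g, l ∈ Finset.Ioo i (m i) → m l ∈ Finset.Ioo i (m i) := by
    intro l hlm
    rw [Finset.mem_Ioo] at hlm ⊢
    have h1 := T.orbitMk_mul_swap_of_isEmpty d (.arc l.castSucc)
    have h2 := Quot.iff_of_forall (p := p) (fun a b hab => by subst hab; exact hp a) h1
    have h3 : (cornerEdge T.edge_edge * Equiv.swap d.left (T.edge d).left) (.arc l.castSucc)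
        = .arc (m l).castSucc := by
      rw [Equiv.Perm.mul_apply, Equiv.swap_apply_of_ne_of_ne]
      · have := cornerEdge_left T.edge_edge (.bdry l)
        rw [hm] at this
        exact this
      · rw [hl]
        intro h
        simp only [Corner.arc.injEq, Fin.ext_iff, Fin.val_castSucc] at h
        exact absurd (Fin.ext h) hlm.1.ne'
      · rw [hr]
        intro h
        simp only [Corner.arc.injEq, Fin.ext_iff, Fin.val_castSucc] at h
        exact absurd (Fin.ext h) hlm.2.ne
    rw [h3] at h2
    have h4 := h2.2 ⟨hlm.1, le_of_lt hlm.2⟩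
    refine ⟨h4.1, lt_of_le_of_ne h4.2 fun h => ?_⟩
    have h5 : l = i := by rw [← hmm l, h, hmm]
    exact hlm.1.ne' h5
  have := even_card_of_involution (Finset.Ioo i (m i)) m hε hmm hne
  rwa [Fin.card_Ioo] at this

theorem exists_checkerboarding_of_isEmpty (T : TangleDiagram g) [IsEmpty T.Crossing]
    [IsEmpty T.Bivalent] : Nonempty T.Checkerboarding := by
  classical
  obtain ⟨m, hm, hmm, hne⟩ := T.exists_matching
  have hg : Even g := by
    have := even_card_of_involution Finset.univ m (by simp) hmm hne
    rwa [Finset.card_univ, Fintype.card_fin] at this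
  have hpar : ∀ i, (m i : ℕ) % 2 = ((i : ℕ) + 1) % 2 := by
    intro i
    rcases lt_or_gt_of_ne (hne i) with h | h
    · have h2 := T.matching_parity_of_lt hm hmm hne (i := m i) (by rwa [hmm])
      rw [hmm, Nat.even_iff] at h2
      have : (m i : ℕ) < i := h
      omega
    · have h2 := T.matching_parity_of_lt hm hmm hne h
      rw [Nat.even_iff] at h2
      have : (i : ℕ) < m i := h
      omega
  -- Colours alternate along the boundary circle. They agree along each arc because `m i` has the
  -- parity of `i + 1`, and across the base point because `g` is even.
  let col : Corner T.Crossing T.Bivalent g → Bool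
    | .arc l => decide ((l : ℕ) % 2 = 0)
    | _ => true
  have hcol : ∀ c c', Corner.Consecutive T.edge c c' → col c = col c' := by
    rintro _ _ (⟨d⟩ | _)
    · rcases d with ⟨x, _⟩ | ⟨v, _⟩ | i
      · exact isEmptyElim x
      · exact isEmptyElim v
      · rw [hm]
        simp [col, Dart.left, Dart.right, hpar]
    · rw [Nat.even_iff] at hg
      simp [col, hg]
  have hs : Function.Surjective T.curveFace := fun F => by
    obtain ⟨c, rfl⟩ := T.face_surjective F
    exact ⟨T.curve c, rfl⟩
  let e : BoundaryCurve T.edge ≃ T.Face := Equiv.ofBijective _ ⟨T.curveFace_injective, hs⟩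
  have he : ∀ c, Quot.lift col hcol (e.symm (T.face c)) = col c := by
    intro c
    have : e.symm (T.face c) = T.curve c := e.symm_apply_apply (T.curve c)
    rw [this]
  refine ⟨⟨fun F => Quot.lift col hcol (e.symm F), fun d => ?_⟩⟩
  rw [he, he]
  rcases d with ⟨x, _⟩ | ⟨v, _⟩ | i
  · exact isEmptyElim x
  · exact isEmptyElim v
  · simp only [Dart.left, Dart.right, col, Fin.val_castSucc, Fin.val_succ, ne_eq,
      decide_eq_decide]
    omega

end TangleDiagram

namespace TangleDiagram

variable {g : ℕ}

/-! ### Checkerboardings and the relations between diagrams -/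

namespace Checkerboarding

variable {T T' : TangleDiagram g}

/-- The colour at the base point. -/
def baseColour (κ : T.Checkerboarding) : Bool := κ.dark (T.face (.arc 0))

/-- Exchange the colours. -/
def swapColours (κ : T.Checkerboarding) : T.Checkerboarding where
  dark F := !κ.dark F
  alternate d h := κ.alternate d (Bool.not_inj h)

/-- The difference of two checkerboardings does not change when an edge is crossed, so it is
constant on a connected diagram. -/
theorem dark_eq_of_baseColour_eq {κ κ' : T.Checkerboarding} (h : κ.baseColour = κ'.baseColour) :
    κ.dark = κ'.dark := by
  let f : Corner T.Crossing T.Bivalent g → Bool := fun c =>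
    xor (κ.dark (T.face c)) (κ'.dark (T.face c))
  have hrot : ∀ a b : Corner T.Crossing T.Bivalent g, b = cornerRot a → f a = f b := by
    rintro a _ rfl
    rcases a.eq_left_or_last with ⟨d, rfl⟩ | rfl
    · rw [cornerRot_left]
      have h1 := κ.alternate d
      have h2 := κ'.alternate d
      simp only [f]
      revert h1 h2
      generalize κ.dark (T.face d.left) = a
      generalize κ.dark (T.face d.right) = b
      generalize κ'.dark (T.face d.left) = c
      generalize κ'.dark (T.face d.right) = e
      revert a b c e
      decide
    · rw [cornerRot_last]
      simp only [f]
      rw [T.face_consecutive _ _ .base]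
  have key : ∀ a b, f a = f b := by
    intro a b
    have := T.connected a b
    induction this with
    | rel a b hab =>
      rcases hab with hab | hab
      · exact Quot.apply_eq_of_forall hrot (orbitMk_cornerRot_eq_iff.2 hab)
      · simp only [f, hab]
    | refl a => rfl
    | symm a b _ ih => exact ih.symm
    | trans a b c _ _ ih1 ih2 => exact ih1.trans ih2
  funext F
  obtain ⟨c, rfl⟩ := T.face_surjective F
  have h1 := key c (.arc 0)
  have h2 : f (.arc 0) = false := by
    change xor κ.baseColour κ'.baseColour = false
    rw [h, Bool.xor_self]
  rw [h2] at h1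
  simpa [f] using h1

theorem eq_of_baseColour_eq {κ κ' : T.Checkerboarding} (h : κ.baseColour = κ'.baseColour) :
    κ = κ' := by
  have := dark_eq_of_baseColour_eq h
  cases κ
  cases κ'
  congr

theorem dark_cross_add_two (κ : T.Checkerboarding) (x : T.Crossing) (i : ZMod 4) :
    κ.dark (T.face (.cross x (i + 2))) = κ.dark (T.face (.cross x i)) := by
  have h1 := κ.alternate (.cross x (i + 2))
  have h2 := κ.alternate (.cross x (i + 1))
  simp only [Dart.left, Dart.right] at h1 h2
  rw [show i + 2 - 1 = i + 1 by ring] at h1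
  rw [show i + 1 - 1 = i by ring] at h2
  revert h1 h2
  generalize κ.dark (T.face (.cross x (i + 2))) = a
  generalize κ.dark (T.face (.cross x (i + 1))) = b
  generalize κ.dark (T.face (.cross x i)) = c
  revert a b c
  decide

theorem dark_cross_add_one (κ : T.Checkerboarding) (x : T.Crossing) (i : ZMod 4) :
    κ.dark (T.face (.cross x (i + 1))) = !κ.dark (T.face (.cross x i)) := by
  have h := κ.alternate (.cross x (i + 1))
  simp only [Dart.left, Dart.right, add_sub_cancel_right] at h
  revert h
  generalize κ.dark (T.face (.cross x (i + 1))) = b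
  generalize κ.dark (T.face (.cross x i)) = c
  revert b c
  decide

/-- The number of boundary curves of the dark faces. -/
noncomputable def numDarkCurves (κ : T.Checkerboarding) : ℕ :=
  Nat.card {c : BoundaryCurve T.edge // κ.dark (T.curveFace c) = true}

/-- The exponent of the variable that belongs to a checkerboarding, modulo 4. -/
noncomputable def degree (κ : T.Checkerboarding) : ZMod 4 :=
  (κ.signedCrossings + 2 * κ.eulerChar : ℤ)

/-- The faces contribute multiples of 4 to `2e` except through their boundary curves, and signs do
not matter for even numbers modulo 4. -/
theorem two_mul_eulerChar (κ : T.Checkerboarding) : (2 * κ.eulerChar : ZMod 4)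
    = 2 * (κ.numDarkCurves : ZMod 4) + 2 * (Fintype.card T.Crossing : ZMod 4) := by
  have h := sum_euler T.curveFace (fun F => κ.dark F = true)
  have h1 : κ.eulerChar = 2 * (Nat.card {G // κ.dark G = true} : ℤ) - κ.numDarkCurves
      - Fintype.card T.Crossing := by
    rw [numDarkCurves, ← h]
    rfl
  rw [h1]
  push_cast
  generalize (Nat.card {G // κ.dark G = true} : ZMod 4) = a
  generalize (κ.numDarkCurves : ZMod 4) = b
  generalize (Fintype.card T.Crossing : ZMod 4) = c
  revert a b c
  decide

theorem degree_eq (κ : T.Checkerboarding) : κ.degree = (κ.signedCrossings : ZMod 4)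
    + 2 * (κ.numDarkCurves : ZMod 4) + 2 * (Fintype.card T.Crossing : ZMod 4) := by
  rw [degree]
  push_cast
  rw [κ.two_mul_eulerChar, add_assoc]

end Checkerboarding

theorem IsIso.exists_pull {T T' : TangleDiagram g} (h : T.IsIso T') (κ' : T'.Checkerboarding) :
    ∃ κ : T.Checkerboarding, κ.baseColour = κ'.baseColour ∧ κ.degree = κ'.degree ∧
      2 * (κ.eulerChar : ZMod 4) = 2 * κ'.eulerChar := by
  obtain ⟨eX, eV, eF, r, t, hr, he, hf⟩ := h.exists_maps
  let κ : T.Checkerboarding := ⟨fun F => κ'.dark (eF F), fun d => by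
    rw [← hf, ← hf, cornerMap_left, cornerMap_right]
    exact κ'.alternate _⟩
  obtain ⟨Θ, hΘ⟩ := exists_curveEquiv_of_bijective (edge := T.edge) (edge' := T'.edge)
    eX.bijective eV.bijective he
  have h1 : κ.numDarkCurves = κ'.numDarkCurves := by
    refine Nat.card_congr (Θ.subtypeEquiv ?_)
    rintro ⟨c⟩
    rw [hΘ]
    change κ'.dark (eF (T.face c)) = true ↔ κ'.dark (T'.face _) = true
    rw [hf]
  have h2 : κ.signedCrossings = κ'.signedCrossings := by
    refine Fintype.sum_equiv eX _ _ fun x => ?_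
    have h3 : κ.dark (T.face (.cross x 1)) = κ'.dark (T'.face (.cross (eX x) 1)) := by
      change κ'.dark (eF (T.face (.cross x 1))) = _
      rw [← hf]
      change κ'.dark (T'.face (.cross (eX x) (1 + r x))) = _
      rcases hr x with h | h
      · rw [h, add_zero]
      · rw [h, κ'.dark_cross_add_two]
    rw [h3]
  have h3 := Fintype.card_congr eX
  refine ⟨κ, ?_, by rw [κ.degree_eq, κ'.degree_eq, h1, h2, h3], ?_⟩
  · change κ'.dark (eF (T.face (.arc 0))) = _
    rw [← hf]
    rfl
  · rw [κ.two_mul_eulerChar, κ'.two_mul_eulerChar, h1, h3]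

theorem IsSubdivision.exists_pull {T T' : TangleDiagram g} (h : T.IsSubdivision T')
    (κ' : T'.Checkerboarding) : ∃ κ : T.Checkerboarding, κ.baseColour = κ'.baseColour ∧
      κ.degree = κ'.degree ∧ 2 * (κ.eulerChar : ZMod 4) = 2 * κ'.eulerChar := by
  obtain ⟨eX, eV, eF, d, he, hf⟩ := h.exists_maps
  let κ : T.Checkerboarding := ⟨fun F => κ'.dark (eF F), fun d => by
    have := κ'.alternate (inclDart eX eV d)
    rw [← cornerMap_left, ← cornerMap_right, hf, hf] at this
    exact this⟩
  obtain ⟨Θ, hΘ⟩ := he.exists_curveEquiv T.edge_edge T'.edge_edge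
  have h1 : κ.numDarkCurves = κ'.numDarkCurves := by
    refine Nat.card_congr (Θ.subtypeEquiv ?_)
    rintro ⟨c⟩
    rw [hΘ]
    change κ'.dark (eF (T.face c)) = true ↔ κ'.dark (T'.face _) = true
    rw [hf]
  have h2 : κ.signedCrossings = κ'.signedCrossings := by
    refine Fintype.sum_equiv eX _ _ fun x => ?_
    have h3 : κ.dark (T.face (.cross x 1)) = κ'.dark (T'.face (.cross (eX x) 1)) := by
      change κ'.dark (eF (T.face (.cross x 1))) = _
      rw [← hf]
      change κ'.dark (T'.face (.cross (eX x) (1 + 0))) = _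
      rw [add_zero]
    rw [h3]
  have h3 := Fintype.card_congr eX
  refine ⟨κ, ?_, by rw [κ.degree_eq, κ'.degree_eq, h1, h2, h3], ?_⟩
  · change κ'.dark (eF (T.face (.arc 0))) = _
    rw [← hf]
    rfl
  · rw [κ.two_mul_eulerChar, κ'.two_mul_eulerChar, h1, h3]

/-- Exactly one of the two sides of the circle is dark, so there is one more dark curve. -/
theorem IsLoopAddition.exists_pull {T T' : TangleDiagram g} (h : T.IsLoopAddition T')
    (κ' : T'.Checkerboarding) : ∃ κ : T.Checkerboarding, κ.baseColour = κ'.baseColour ∧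
      κ'.degree = κ.degree + 2 := by
  obtain ⟨F, eX, eV, eF, he, hf0, hf1, hf⟩ := h.exists_maps
  let κ : T.Checkerboarding := ⟨fun F => κ'.dark (eF (some F)), fun d => by
    have := κ'.alternate (inclDart eX eV d)
    rw [← cornerMap_left, ← cornerMap_right, hf, hf] at this
    exact this⟩
  obtain ⟨Θ, hΘ, hΘ'⟩ := he.exists_curveEquiv T'.edge_edge
  have hi : ∀ i : ZMod 2, i = 0 ∨ i = 1 := by decide
  have h1 : κ'.numDarkCurves = κ.numDarkCurves + 1 := by
    have e1 : Nat.card {c // κ'.dark (T'.curveFace (Θ c)) = true} = κ'.numDarkCurves :=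
      Nat.card_congr (Θ.subtypeEquiv fun c => Iff.rfl)
    rw [← e1, Nat.card_congr (Equiv.subtypeSum), Nat.card_sum]
    congr 1
    · refine Nat.card_congr (Equiv.subtypeEquivRight ?_)
      rintro ⟨c⟩
      rw [hΘ]
      change κ'.dark (T'.face _) = true ↔ κ'.dark (eF (some (T.face c))) = true
      rw [hf]
    · have h2 : ∀ i, T'.curveFace (Θ (.inr i)) = T'.face (.biv (eV none) i) := fun i => by
        rw [hΘ']
      simp only [h2]
      have h3 := κ'.alternate (.biv (eV none) 0)
      simp only [Dart.left, Dart.right, zmod_two_sub_one_zero] at h3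
      rw [Nat.card_eq_one_iff_unique]
      cases h0 : κ'.dark (T'.face (.biv (eV none) 0)) <;>
        cases h1 : κ'.dark (T'.face (.biv (eV none) 1)) <;> rw [h0, h1] at h3
      · exact absurd rfl h3
      · refine ⟨⟨?_⟩, ⟨⟨1, h1⟩⟩⟩
        rintro ⟨i, hi'⟩ ⟨j, hj'⟩
        rcases hi i with rfl | rfl
        · exact absurd (h0.symm.trans hi') (by decide)
        · rcases hi j with rfl | rfl
          · exact absurd (h0.symm.trans hj') (by decide)
          · rfl
      · refine ⟨⟨?_⟩, ⟨⟨0, h0⟩⟩⟩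
        rintro ⟨i, hi'⟩ ⟨j, hj'⟩
        rcases hi i with rfl | rfl
        · rcases hi j with rfl | rfl
          · rfl
          · exact absurd (h1.symm.trans hj') (by decide)
        · exact absurd (h1.symm.trans hi') (by decide)
      · exact absurd rfl h3
  have h2 : κ.signedCrossings = κ'.signedCrossings := by
    refine Fintype.sum_equiv eX _ _ fun x => ?_
    have h3 : κ.dark (T.face (.cross x 1)) = κ'.dark (T'.face (.cross (eX x) 1)) := by
      change κ'.dark (eF (some (T.face (.cross x 1)))) = _
      rw [← hf]
      change κ'.dark (T'.face (.cross (eX x) (1 + 0))) = _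
      rw [add_zero]
    rw [h3]
  have h3 := Fintype.card_congr eX
  refine ⟨κ, ?_, ?_⟩
  · change κ'.dark (eF (some (T.face (.arc 0)))) = _
    rw [← hf]
    rfl
  · rw [κ.degree_eq, κ'.degree_eq, h1, h2, h3]
    push_cast
    ring

theorem IsIso.exists_push {T T' : TangleDiagram g} (h : T.IsIso T') (κ : T.Checkerboarding) :
    Nonempty T'.Checkerboarding := by
  obtain ⟨eX, eV, eF, r, t, hr, he, hf⟩ := h.exists_maps
  refine ⟨⟨fun F => κ.dark (eF.symm F), fun d => ?_⟩⟩
  obtain ⟨d, rfl⟩ := dartMap_surjective (g := g) (r := r) (s := t) eX.surjective eV.surjective d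
  rw [← cornerMap_left, ← cornerMap_right, hf, hf, Equiv.symm_apply_apply, Equiv.symm_apply_apply]
  exact κ.alternate d

theorem IsSubdivision.exists_push {T T' : TangleDiagram g} (h : T.IsSubdivision T')
    (κ : T.Checkerboarding) : Nonempty T'.Checkerboarding := by
  obtain ⟨eX, eV, eF, d, he, hf⟩ := h.exists_maps
  have hf0 : T'.face (.biv (eV none) 0) = eF (T.face d.right) :=
    (congrArg T'.curveFace he.curve_zero).trans (hf _)
  have hf1 : T'.face (.biv (eV none) 1) = eF (T.face d.left) := by
    refine ((congrArg T'.curveFace he.curve_one).trans (hf _)).trans ?_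
    have := Corner.Consecutive.side (edge := T.edge) (T.edge d)
    rw [T.edge_edge] at this
    rw [T.face_consecutive _ _ this]
  refine ⟨⟨fun F => κ.dark (eF.symm F), fun c => ?_⟩⟩
  rcases inclDart_cases eX eV c with ⟨c, rfl⟩ | ⟨i, rfl⟩
  · rw [← cornerMap_left, ← cornerMap_right, hf, hf, Equiv.symm_apply_apply,
      Equiv.symm_apply_apply]
    exact κ.alternate c
  · have hi : ∀ i : ZMod 2, i = 0 ∨ i = 1 := by decide
    rcases hi i with rfl | rfl
    · simp only [Dart.left, Dart.right, zmod_two_sub_one_zero, hf0, hf1, Equiv.symm_apply_apply]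
      exact (κ.alternate d).symm
    · simp only [Dart.left, Dart.right, sub_self, hf0, hf1, Equiv.symm_apply_apply]
      exact κ.alternate d

theorem IsLoopAddition.exists_push {T T' : TangleDiagram g} (h : T.IsLoopAddition T')
    (κ : T.Checkerboarding) : Nonempty T'.Checkerboarding := by
  obtain ⟨F, eX, eV, eF, he, hf0, hf1, hf⟩ := h.exists_maps
  refine ⟨⟨fun G => (eF.symm G).elim (!κ.dark F) κ.dark, fun c => ?_⟩⟩
  rcases inclDart_cases eX eV c with ⟨c, rfl⟩ | ⟨i, rfl⟩
  · rw [← cornerMap_left, ← cornerMap_right, hf, hf, Equiv.symm_apply_apply,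
      Equiv.symm_apply_apply]
    exact κ.alternate c
  · have hi : ∀ i : ZMod 2, i = 0 ∨ i = 1 := by decide
    rcases hi i with rfl | rfl
    · simp only [Dart.left, Dart.right, zmod_two_sub_one_zero, hf0, hf1, Equiv.symm_apply_apply]
      simp
    · simp only [Dart.left, Dart.right, sub_self, hf0, hf1, Equiv.symm_apply_apply]
      simp

end TangleDiagram

namespace TangleDiagram

variable {g : ℕ}

/-! ### Checkerboardings and smoothings -/

theorem IsSmoothing.exists_pull {T T' : TangleDiagram g} {x : T.Crossing} {k : ZMod 4}
    (h : T.IsSmoothing x k T') (κ' : T'.Checkerboarding) : Nonempty T.Checkerboarding := by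
  classical
  obtain ⟨eX, eV, q, hq, hqq, he, hf⟩ := h.exists_maps
  have hsw : ∀ c, q (T.face (Equiv.swap (.cross x (k + 1)) (.cross x (k + 3)) c))
      = q (T.face c) := fun c => by
    rw [Equiv.swap_apply_def]
    split_ifs with h1 h2
    · exact (hqq _ _).2 (Or.inr (Or.inr ⟨rfl, by rw [h1]⟩))
    · exact (hqq _ _).2 (Or.inr (Or.inl ⟨rfl, by rw [h2]⟩))
    · rfl
  refine ⟨⟨fun F => κ'.dark (q F), fun d => ?_⟩⟩
  obtain ⟨d, rfl⟩ := (smoothDartEquiv x k eX eV).surjective d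
  have h1 := κ'.alternate d
  rwa [hf, hf, smoothCornerEquiv_left, smoothCornerEquiv_right, hsw] at h1

theorem Checkerboarding.card_curve {T : TangleDiagram g} (κ : T.Checkerboarding) :
    Nat.card (BoundaryCurve T.edge) = κ.numDarkCurves
      + Nat.card {c : BoundaryCurve T.edge // κ.dark (T.curveFace c) = false} := by
  rw [numDarkCurves, ← Nat.card_sum]
  refine Nat.card_congr ((Equiv.sumCompl fun c => κ.dark (T.curveFace c) = true).symm.trans
    (Equiv.sumCongr (Equiv.refl _) (Equiv.subtypeEquivRight fun c => ?_)))
  exact Bool.not_eq_true _ ▸ Iff.rfl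

/-- The opposite corners at a crossing have equal colours, so the colouring descends to the merged
faces. Losing the crossing shifts `2e` by 2 modulo 4; if the merged corners are dark, this is
cancelled by an odd change of the number of dark curves. -/
theorem IsSmoothing.exists_push {T T' : TangleDiagram g} {x : T.Crossing} {k : ZMod 4}
    (h : T.IsSmoothing x k T') (κ : T.Checkerboarding) :
    ∃ κ' : T'.Checkerboarding, κ'.baseColour = κ.baseColour ∧ κ.degree = κ'.degree
      + (if κ.dark (T.face (.cross x 1)) = true then 1 else -1)
      + (if κ.dark (T.face (.cross x (k + 1))) = true then 0 else 2) := by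
  classical
  obtain ⟨eX, eV, q, hq, hqq, he, hf⟩ := h.exists_maps
  have h13 : κ.dark (T.face (.cross x (k + 3))) = κ.dark (T.face (.cross x (k + 1))) := by
    rw [← κ.dark_cross_add_two x (k + 1)]
    congr 3
    ring
  have hsw : ∀ c, κ.dark (T.face (Equiv.swap (.cross x (k + 1)) (.cross x (k + 3)) c))
      = κ.dark (T.face c) := fun c => by
    rw [Equiv.swap_apply_def]
    split_ifs with h1 h2
    · rw [h13, h1]
    · rw [h2, h13]
    · rfl
  have hdark : ∀ F, κ.dark (Function.surjInv hq (q F)) = κ.dark F := fun F => by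
    rcases (hqq _ _).1 (Function.surjInv_eq hq (q F)) with h | ⟨h1, h2⟩ | ⟨h1, h2⟩
    · rw [h]
    · rw [h1, h2, h13]
    · rw [h1, h2, h13]
  let κ' : T'.Checkerboarding := ⟨fun G => κ.dark (Function.surjInv hq G), fun d => by
    rw [hf, hf, hdark, hdark, smoothCornerEquiv_left, smoothCornerEquiv_right, hsw]
    exact κ.alternate _⟩
  have hκ : ∀ c, κ'.dark (T'.face c) = κ.dark (T.face (smoothCornerEquiv x k eX eV c)) :=
    fun c => (congrArg κ'.dark (hf c)).trans (hdark _)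
  -- The swap of corners moves only corners of the colour at `k + 1`, so the curves of the other
  -- colour are untouched.
  have hcurve : ∀ b, κ.dark (T.face (.cross x (k + 1))) ≠ b →
      Nat.card {c : BoundaryCurve T'.edge // κ'.dark (T'.curveFace c) = b}
        = Nat.card {c : BoundaryCurve T.edge // κ.dark (T.curveFace c) = b} := by
    intro b hb
    have hswb : ∀ c, κ.dark (T.face c) = b →
        Equiv.swap (.cross x (k + 1)) (.cross x (k + 3)) c = c := fun c hc =>
      Equiv.swap_apply_of_ne_of_ne (fun h => hb (by rw [← hc, h]))
        (fun h => hb (by rw [← hc, h, h13]))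
    refine (card_quot_subtype (fun c => κ'.dark (T'.face c) = b) _ (fun c => Iff.rfl)).trans
      (Eq.trans ?_ (card_quot_subtype (fun c => κ.dark (T.face c) = b) _ (fun c => Iff.rfl)).symm)
    refine Nat.card_congr (Quot.congr
      ((smoothCornerEquiv x k eX eV).subtypeEquiv fun c => by rw [hκ]) ?_)
    rintro ⟨c, hc⟩ ⟨c', hc'⟩
    rw [hκ] at hc hc'
    have hr : ∀ d, κ.dark (T.face (smoothCornerEquiv x k eX eV (Dart.right d))) = b →
        smoothCornerEquiv x k eX eV d.right = (smoothDartEquiv x k eX eV d).right := fun d hd => by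
      rw [smoothCornerEquiv_right] at hd ⊢
      rw [hsw] at hd
      exact hswb _ hd
    change Corner.Consecutive T'.edge c c' ↔ Corner.Consecutive T.edge
      (smoothCornerEquiv x k eX eV c) (smoothCornerEquiv x k eX eV c')
    constructor
    · rintro (⟨d⟩ | _)
      · rw [hr d hc', smoothCornerEquiv_left, he]
        exact .side _
      · exact .base
    · generalize hu : smoothCornerEquiv x k eX eV c = u
      generalize hu' : smoothCornerEquiv x k eX eV c' = u'
      rw [hu] at hc
      rw [hu'] at hc'
      rintro (⟨d⟩ | _)
      · obtain ⟨d, rfl⟩ := (smoothDartEquiv x k eX eV).surjective d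
        have h1 : c = (T'.edge d).left := (smoothCornerEquiv x k eX eV).injective (by
          rw [hu, smoothCornerEquiv_left, he])
        have h2 : c' = d.right := (smoothCornerEquiv x k eX eV).injective (by
          rw [hu', smoothCornerEquiv_right, hswb _ hc'])
        rw [h1, h2]
        exact .side _
      · have h1 : c = .arc 0 := (smoothCornerEquiv x k eX eV).injective hu
        have h2 : c' = .arc (Fin.last g) := (smoothCornerEquiv x k eX eV).injective hu'
        rw [h1, h2]
        exact .base
  have hX : Fintype.card T.Crossing = Fintype.card T'.Crossing + 1 := by
    rw [← Fintype.card_congr eX, ← Fintype.card_option]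
    exact Fintype.card_congr (Equiv.optionSubtypeNe x).symm
  have hV : Fintype.card T'.Bivalent = Fintype.card T.Bivalent + 2 := by
    rw [← Fintype.card_congr eV]
    simp
  have hE : Nat.card (Dart T'.Crossing T'.Bivalent g) = Nat.card (Dart T.Crossing T.Bivalent g) :=
    Nat.card_congr (smoothDartEquiv x k eX eV)
  -- If the merged corners are dark, the light curves are unchanged, and comparing the Euler
  -- conditions of the two diagrams shows that the total number of curves changes by an odd number.
  have hnum : (2 * (κ'.numDarkCurves : ZMod 4)) = 2 * κ.numDarkCurves
      + (if κ.dark (T.face (.cross x (k + 1))) = true then 2 else 0) := by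
    split_ifs with hb
    · have h1 := hcurve false (by simp [hb])
      have h2 := T.euler_count
      have h3 := T'.euler_count
      rw [hE, hV] at h3
      rw [hX] at h2
      rw [κ.card_curve] at h2
      rw [κ'.card_curve, h1] at h3
      have h4 : (κ'.numDarkCurves : ℤ) = κ.numDarkCurves + 1
          + 2 * (Fintype.card T'.Face - Fintype.card T.Face) := by
        push_cast at h2 h3
        linarith
      have h5 := congrArg (Int.cast : ℤ → ZMod 4) h4
      push_cast at h5
      rw [h5]
      generalize (κ.numDarkCurves : ZMod 4) = a
      generalize (Fintype.card T'.Face : ZMod 4) = b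
      generalize (Fintype.card T.Face : ZMod 4) = c
      revert a b c
      decide
    · rw [Checkerboarding.numDarkCurves, hcurve true hb, add_zero]
      rfl
  have hs : κ.signedCrossings = κ'.signedCrossings
      + (if κ.dark (T.face (.cross x 1)) = true then 1 else -1) := by
    unfold Checkerboarding.signedCrossings
    rw [← (Equiv.optionSubtypeNe x).sum_comp, Fintype.sum_option, add_comm]
    congr 1
    refine Fintype.sum_equiv eX _ _ fun y => ?_
    have h1 : smoothCornerEquiv x k eX eV (.cross (eX y) 1)
        = (.cross y.1 1 : Corner T.Crossing T.Bivalent g) := by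
      change Corner.cross (eX.symm (eX y)).1 (1 + 0) = _
      rw [Equiv.symm_apply_apply, add_zero]
    rw [hκ, h1]
    rfl
  refine ⟨κ', hκ _, ?_⟩
  rw [κ.degree_eq, κ'.degree_eq, hnum, hs, hX]
  push_cast
  split_ifs
  · ring
  · ring
  · ring
  · ring

/-- The corner `1` decides both the sign of the crossing and whether the merged corners are dark:
the shift is `1 + 0` or `-1 + 2`. -/
theorem IsSmoothing.exists_push_zero {T T' : TangleDiagram g} {x : T.Crossing}
    (h : T.IsSmoothing x 0 T') (κ : T.Checkerboarding) :
    ∃ κ' : T'.Checkerboarding, κ'.baseColour = κ.baseColour ∧ κ.degree = κ'.degree + 1 := by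
  obtain ⟨κ', h1, h2⟩ := h.exists_push κ
  refine ⟨κ', h1, ?_⟩
  rw [h2, zero_add, add_assoc]
  congr 1
  split_ifs <;> rfl

/-- Here the merged corners have the colour opposite to that of corner `1`: the shift is `1 + 2` or
`-1 + 0`. -/
theorem IsSmoothing.exists_push_one {T T' : TangleDiagram g} {x : T.Crossing}
    (h : T.IsSmoothing x 1 T') (κ : T.Checkerboarding) :
    ∃ κ' : T'.Checkerboarding, κ'.baseColour = κ.baseColour ∧ κ.degree = κ'.degree - 1 := by
  obtain ⟨κ', h1, h2⟩ := h.exists_push κ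
  refine ⟨κ', h1, ?_⟩
  rw [h2, κ.dark_cross_add_one, add_assoc, sub_eq_add_neg]
  congr 1
  cases κ.dark (T.face (.cross x 1)) <;> rfl

/-! ### Existence and invariance -/

/-- A checkerboarding of a smoothing separates into one of the crossing, because the merging corners
face each other there; the reduction then leads back to base tangles. -/
theorem nonempty_checkerboarding (T : TangleDiagram g) : Nonempty T.Checkerboarding := by
  induction T using TangleDiagram.reduction with
  | crossing T x TA TB hA hB ihA ihB => exact ihA.elim hA.exists_pull
  | subdivision T T' h ih => exact ih.elim h.exists_push
  | loop T T' h ih => exact ih.elim h.exists_push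
  | iso T T' h ih => exact ih.elim h.exists_push
  | base T hX hV => exact T.exists_checkerboarding_of_isEmpty

theorem exists_checkerboarding (T : TangleDiagram g) (b : Bool) :
    ∃ κ : T.Checkerboarding, κ.baseColour = b := by
  obtain ⟨κ⟩ := T.nonempty_checkerboarding
  by_cases h : κ.baseColour = b
  · exact ⟨κ, h⟩
  · exact ⟨κ.swapColours, Bool.not_eq.2 h⟩

/-- Degrees are compared for the diagram that is expanded, values of `2e` for the representatives of
a base tangle. -/
theorem degree_eq_of_toClass_eq {T T' : TangleDiagram g} (h : T.toClass = T'.toClass)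
    (κ : T.Checkerboarding) (κ' : T'.Checkerboarding) (hb : κ.baseColour = κ'.baseColour) :
    κ.degree = κ'.degree ∧ 2 * (κ.eulerChar : ZMod 4) = 2 * κ'.eulerChar := by
  replace h := Quot.eqvGen_exact h
  induction h with
  | rel T T' h =>
    have : ∃ κ₀ : T.Checkerboarding, κ₀.baseColour = κ'.baseColour ∧
        κ₀.degree = κ'.degree ∧ 2 * (κ₀.eulerChar : ZMod 4) = 2 * κ'.eulerChar :=
      h.elim (fun h => h.exists_pull κ') (fun h => h.exists_pull κ')
    obtain ⟨κ₀, h0, h1⟩ := this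
    rwa [Checkerboarding.eq_of_baseColour_eq (hb.trans h0.symm)]
  | refl T => rw [Checkerboarding.eq_of_baseColour_eq hb]; exact ⟨rfl, rfl⟩
  | symm T T' _ ih =>
    obtain ⟨h1, h2⟩ := ih κ' κ hb.symm
    exact ⟨h1.symm, h2.symm⟩
  | trans T T' T'' _ _ ih1 ih2 =>
    -- The intermediate diagram needs a checkerboarding of its own, with the same colour at the base
    -- point.
    obtain ⟨κ₀, h0⟩ := T'.exists_checkerboarding κ.baseColour
    obtain ⟨h1, h2⟩ := ih1 κ κ₀ h0.symm
    obtain ⟨h3, h4⟩ := ih2 κ₀ κ' (h0.trans hb)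
    exact ⟨h1.trans h3, h2.trans h4⟩

end TangleDiagram

/-! ### Expansions -/

theorem coeff_T_mul (n k : ℤ) (p : LaurentPolynomial ℤ) :
    (LaurentPolynomial.T n * p).coeff k = p.coeff (k - n) := by
  have := AddMonoidAlgebra.coeff_single_mul_add p (1 : ℤ) n (k - n)
  rw [add_sub_cancel, one_mul] at this
  exact this

namespace TangleDiagram

variable {g : ℕ}

/-- The exponents that occur in the coefficients are those predicted by checkerboardings. -/
def HasDegrees (T : TangleDiagram g) (c : BaseTangle g →₀ LaurentPolynomial ℤ) : Prop :=
  ∀ (κ : T.Checkerboarding) (B : BaseTangle g) (D : TangleDiagram g), D.toClass = B.1 →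
    ∀ κ' : D.Checkerboarding, κ'.baseColour = κ.baseColour →
      ∀ k : ℤ, (c B).coeff k ≠ 0 → (k : ZMod 4) = κ.degree - 2 * κ'.eulerChar

theorem IsLoopAddition.skein_eq {T T' : TangleDiagram g} (h : T.IsLoopAddition T') :
    T'.toClass.skein = loopValue • T.toClass.skein :=
  (Submodule.Quotient.eq _).2 (Submodule.subset_span (Or.inl ⟨T, T', h, rfl⟩))

theorem skein_eq_add {T TA TB : TangleDiagram g} {x : T.Crossing} (hA : T.IsSmoothing x 0 TA)
    (hB : T.IsSmoothing x 1 TB) : T.toClass.skein =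
      (LaurentPolynomial.T 1 : LaurentPolynomial ℤ) • TA.toClass.skein
        + (LaurentPolynomial.T (-1) : LaurentPolynomial ℤ) • TB.toClass.skein :=
  (Submodule.Quotient.eq _).2 (Submodule.subset_span (Or.inr ⟨T, x, TA, TB, hA, hB, rfl⟩))

theorem isExpansion_iff {T : TangleDiagram g} {c : BaseTangle g →₀ LaurentPolynomial ℤ} :
    T.IsExpansion c ↔ T.toClass.skein
      = Finsupp.linearCombination (LaurentPolynomial ℤ) (fun B : BaseTangle g => B.1.skein) c :=
  Iff.rfl

theorem exists_expansion_of_toClass_eq {T T' : TangleDiagram g} (h : T.toClass = T'.toClass)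
    (ih : ∃ c, T.IsExpansion c ∧ T.HasDegrees c) : ∃ c, T'.IsExpansion c ∧ T'.HasDegrees c := by
  obtain ⟨c, h1, h2⟩ := ih
  refine ⟨c, by rwa [IsExpansion, ← h], fun κ B D hD κ' hb k hk => ?_⟩
  obtain ⟨κ₀, h0⟩ := T.exists_checkerboarding κ.baseColour
  rw [← (degree_eq_of_toClass_eq h κ₀ κ h0).1]
  exact h2 κ₀ B D hD κ' (hb.trans h0.symm) k hk

theorem exists_expansion (T : TangleDiagram g) : ∃ c, T.IsExpansion c ∧ T.HasDegrees c := by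
  induction T using TangleDiagram.reduction with
  | crossing T x TA TB hA hB ihA ihB =>
    obtain ⟨cA, hA1, hA2⟩ := ihA
    obtain ⟨cB, hB1, hB2⟩ := ihB
    refine ⟨(LaurentPolynomial.T 1 : LaurentPolynomial ℤ) • cA
      + (LaurentPolynomial.T (-1) : LaurentPolynomial ℤ) • cB, ?_, ?_⟩
    · rw [isExpansion_iff] at hA1 hB1 ⊢
      rw [map_add, map_smul, map_smul, ← hA1, ← hB1, skein_eq_add hA hB]
    · intro κ B D hD κ' hb k hk
      have hk' : (cA B).coeff (k - 1) ≠ 0 ∨ (cB B).coeff (k - -1) ≠ 0 := by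
        by_contra! h
        refine hk ?_
        change (LaurentPolynomial.T 1 * cA B).coeff k
          + (LaurentPolynomial.T (-1) * cB B).coeff k = 0
        rw [coeff_T_mul, coeff_T_mul, h.1, h.2, add_zero]
      rcases hk' with hk' | hk'
      · obtain ⟨κA, h1, h2⟩ := hA.exists_push_zero κ
        have := hA2 κA B D hD κ' (hb.trans h1.symm) _ hk'
        push_cast at this
        rw [h2]
        linear_combination this
      · obtain ⟨κB, h1, h2⟩ := hB.exists_push_one κ
        have := hB2 κB B D hD κ' (hb.trans h1.symm) _ hk'
        push_cast at this
        rw [h2]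
        linear_combination this
  | subdivision T T' h ih => exact exists_expansion_of_toClass_eq (Quot.sound (Or.inr h)) ih
  | loop T T' h ih =>
    obtain ⟨c, h1, h2⟩ := ih
    refine ⟨loopValue • c, ?_, ?_⟩
    · rw [isExpansion_iff] at h1 ⊢
      rw [map_smul, ← h1, h.skein_eq]
    · intro κ B D hD κ' hb k hk
      -- The two exponents of the loop value, 2 and -2, agree modulo 4 with each other and with the
      -- change of degree by the circle.
      have hk' : (c B).coeff (k - 2) ≠ 0 ∨ (c B).coeff (k - -2) ≠ 0 := by
        by_contra! h
        refine hk ?_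
        have h3 : (loopValue • c) B = -(LaurentPolynomial.T 2 * c B)
            - LaurentPolynomial.T (-2) * c B := by
          rw [Finsupp.smul_apply, smul_eq_mul, loopValue, sub_mul, neg_mul]
        rw [h3]
        change -(LaurentPolynomial.T 2 * c B).coeff k
          - (LaurentPolynomial.T (-2) * c B).coeff k = 0
        rw [coeff_T_mul, coeff_T_mul, h.1, h.2, neg_zero, sub_zero]
      obtain ⟨κ₀, h3, h4⟩ := h.exists_pull κ
      have h5 : (4 : ZMod 4) = 0 := rfl
      rw [h4]
      rcases hk' with hk' | hk'
      · have := h2 κ₀ B D hD κ' (hb.trans h3.symm) _ hk'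
        push_cast at this
        linear_combination this
      · have := h2 κ₀ B D hD κ' (hb.trans h3.symm) _ hk'
        push_cast at this
        linear_combination this - h5
  | iso T T' h ih => exact exists_expansion_of_toClass_eq (Quot.sound (Or.inl h)) ih
  | base T hX hV =>
    classical
    let B₀ : BaseTangle g := ⟨T.toClass, T, rfl, hX, hV⟩
    refine ⟨Finsupp.single B₀ 1, ?_, ?_⟩
    · rw [isExpansion_iff, Finsupp.linearCombination_single, one_smul]
    · intro κ B D hD κ' hb k hk
      have hB : B.1 = T.toClass := by
        by_contra hne
        refine hk ?_
        rw [Finsupp.single_eq_of_ne (fun h : B = B₀ => hne (congrArg Subtype.val h))]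
        rfl
      -- A base tangle has coefficient 1 at itself. Without crossings its degree is `2e`, so the
      -- predicted exponent is 0 as well.
      have hk0 : k = 0 := by
        by_contra hne
        refine hk ?_
        rw [show B = B₀ from Subtype.ext hB, Finsupp.single_eq_same]
        exact Finsupp.single_eq_of_ne hne
      have h1 := (degree_eq_of_toClass_eq (hD.trans hB) κ' κ hb).2
      have h2 : κ.signedCrossings = 0 := Fintype.sum_empty _
      rw [Checkerboarding.degree, h1, h2, hk0]
      push_cast
      ring

end TangleDiagram

/-! ### The theorem. -/

theorem mainTheorem2 (g : ℕ) (T : TangleDiagram g) :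
    (∃! c : BaseTangle g →₀ LaurentPolynomial ℤ, T.IsExpansion c) ∧
    ∀ c : BaseTangle g →₀ LaurentPolynomial ℤ, T.IsExpansion c → ∀ B : BaseTangle g,
      (∀ k ∈ (c B).coeff.support, ∀ l ∈ (c B).coeff.support, k ≡ l [ZMOD 4]) ∧
      ∀ (κ : T.Checkerboarding) (D : TangleDiagram g), D.toClass = B.1 →
        ∀ κ' : D.Checkerboarding,
          (∀ j : Fin (g + 1), κ'.dark (D.face (.arc j)) = κ.dark (T.face (.arc j))) →
          ∀ k ∈ (c B).coeff.support,
            k ≡ κ.signedCrossings + 2 * κ.eulerChar - 2 * κ'.eulerChar [ZMOD 4] := by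
  obtain ⟨c₀, h1, h2⟩ := T.exists_expansion
  refine ⟨⟨c₀, h1, fun c h => h.unique h1⟩, fun c h B => ?_⟩
  obtain rfl := h.unique h1
  constructor
  · intro k hk l hl
    -- Any checkerboarding will do: it predicts one residue class for all exponents at `B`.
    obtain ⟨κ⟩ := T.nonempty_checkerboarding
    obtain ⟨D, hD, -⟩ := B.2
    obtain ⟨κ', hκ'⟩ := D.exists_checkerboarding κ.baseColour
    have hk := h2 κ B D hD κ' hκ' k (Finsupp.mem_support_iff.1 hk)
    have hl := h2 κ B D hD κ' hκ' l (Finsupp.mem_support_iff.1 hl)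
    exact (ZMod.intCast_eq_intCast_iff k l 4).1 (hk.trans hl.symm)
  · intro κ D hD κ' hκ' k hk
    have hk := h2 κ B D hD κ' (hκ' 0) k (Finsupp.mem_support_iff.1 hk)
    refine (ZMod.intCast_eq_intCast_iff k _ 4).1 ?_
    rw [hk, TangleDiagram.Checkerboarding.degree]
    push_cast
    ring
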